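/- Let $\lambda,\mu\ge 0$ and $\beta>0$. For $N\ge 2$ and $f\in L^1(\mathbb R^N)$ put \[ \mathscr G f=\lambda N(I-Q)f+\mu\sum_{j=1}^N (I-R_j)f,\qquad Q f(\mathbf v)=\frac1{\binom N2}\sum_{i<j}\frac1{2\pi}\int_0^{2\pi} f(\mathbf v_{i,j}(\theta))\,d\theta , \] \[ R_jf(\mathbf v)=\int_{\mathbb R}dw\,\frac1{2\pi}\int_0^{2\pi}d\theta\,\sqrt{\tfrac{\beta}{2\pi}}\, e^{-\frac\beta2(-v_j\sin\theta+w\cos\theta)^2} f(\mathbf v_j(\theta,w)), \] where $\mathbf v_{i,j}(\theta)$ is $\mathbf v$ with $v_i,v_j$ replaced by $v_i\cos\theta+v_j\sin\theta$ and $-v_i\sin\theta+v_j\cos\theta$, and $\mathbf v_j(\theta,w)$ is $\mathbf v$ with $v_j$ replaced by $v_j\cos\theta+w\sin\theta$; for $N=1$ there are no collisions between particles and $Q=I$. For each $N\ge1$ let $f^{(N)}(\cdot,t)$, $t\ge0$, be a solution in $L^1(\mathbb R^N)$ of the master equation $\partial_t f=-\mathscr G f$ (with the time derivative taken in $L^1(\mathbb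 R^N)$). Call a sequence of probability densities $f^{(N)}$ on $\mathbb R^N$, each symmetric under permutations of the variables, \emph{chaotic} if, for every $k\in\mathbb N$ and all bounded continuous $\varphi_1,\dots,\varphi_k:\mathbb R\to\mathbb R$, the following limits exist and \[ \lim_{N\to\infty}\int_{\mathbb R^N}\varphi_1(v_1)\cdots\varphi_k(v_k)f^{(N)}(\mathbf v)\,d\mathbf v =\prod_{j=1}^k\lim_{N\to\infty}\int_{\mathbb R^N}\varphi_j(v_j)f^{(N)}(\mathbf v)\,d\mathbf v . \] If the sequence of initial densities $f^{(N)}(\cdot,0)$ is chaotic, then for every fixed $t\ge0$ the sequence $f^{(N)}(\cdot,t)$ is chaotic. -/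

import Mathlib

open MeasureTheory Filter Topology
open scoped BoundedContinuousFunction

namespace KacThermostat

noncomputable section

/-- The average `(1/2π) ∫₀^{2π} h(θ) dθ`. -/
def angleAvg (h : ℝ → ℝ) : ℝ :=
  (2 * Real.pi)⁻¹ * ∫ θ in (0 : ℝ)..(2 * Real.pi), h θ

/-- The velocities `v_{i,j}(θ)` after particles `i` and `j` have collided with angle `θ`. -/
def collide {N : ℕ} (i j : Fin N) (θ : ℝ) (v : Fin N → ℝ) : Fin N → ℝ :=
  Function.update
    (Function.update v i (v i * Real.cos θ + v j * Real.sin θ))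
    j (-v i * Real.sin θ + v j * Real.cos θ)

/-- The Kac collision operator `Q`, the average over all pairs `i < j` and all angles.
With fewer than two particles there is no pair, no collision takes place, and `Q` is the
identity. -/
def kacQ {N : ℕ} (f : (Fin N → ℝ) → ℝ) (v : Fin N → ℝ) : ℝ :=
  if N < 2 then f v
  else ((N.choose 2 : ℕ) : ℝ)⁻¹ *
    ∑ i : Fin N, ∑ j ∈ Finset.Ioi i, angleAvg (fun θ => f (collide i j θ v))

/-- The centred Gaussian density at inverse temperature `β`. -/
def gauss (β w : ℝ) : ℝ :=
  Real.sqrt (β / (2 * Real.pi)) * Real.exp (-(β / 2) * w ^ 2)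

/-- The thermostat operator `R_j`: particle `j` collides with a particle `w` of the bath. -/
def thermR (β : ℝ) {N : ℕ} (j : Fin N) (f : (Fin N → ℝ) → ℝ) (v : Fin N → ℝ) : ℝ :=
  ∫ w : ℝ, angleAvg (fun θ =>
    gauss β (-v j * Real.sin θ + w * Real.cos θ) *
      f (Function.update v j (v j * Real.cos θ + w * Real.sin θ)))

/-- The generator `𝒢 f = lam N (I - Q) f + mu ∑ⱼ (I - R_j) f`. -/
def generator (lam mu β : ℝ) {N : ℕ} (f : (Fin N → ℝ) → ℝ) (v : Fin N → ℝ) : ℝ :=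
  lam * (N : ℝ) * (f v - kacQ f v) + mu * ∑ j : Fin N, (f v - thermR β j f v)

/-- `f`, with `f t` the density at time `t`, solves the master equation `∂f/∂t = -𝒢 f` for
`t ≥ 0`: every `f t` is in `L¹(ℝ^N)`, and the time derivative exists in the norm of `L¹`
(one-sided at `t = 0`) and equals `-𝒢 (f t)`. -/
def SolvesMaster (lam mu β : ℝ) {N : ℕ} (f : ℝ → (Fin N → ℝ) → ℝ) : Prop :=
  (∀ t : ℝ, 0 ≤ t → Integrable (f t) volume) ∧
  ∀ t : ℝ, 0 ≤ t →
    Tendsto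
      (fun s : ℝ =>
        eLpNorm (fun v => (f s v - f t v) / (s - t) + generator lam mu β (f t) v) 1 volume)
      (𝓝[Set.Ici 0 \ {t}] t) (𝓝 0)

/-- `f` is a probability density on `ℝ^N`, symmetric under permutations of the particles.
Densities are functions up to null sets. -/
structure IsSymmDensity {N : ℕ} (f : (Fin N → ℝ) → ℝ) : Prop where
  integrable : Integrable f volume
  nonneg : ∀ᵐ v : Fin N → ℝ, 0 ≤ f v
  integral_eq_one : ∫ v : Fin N → ℝ, f v = 1
  symm : ∀ σ : Equiv.Perm (Fin N), ∀ᵐ v : Fin N → ℝ, f (fun i => v (σ i)) = f v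

/-- A sequence of symmetric probability densities `f N` on `ℝ^N` is chaotic: for all `k` and all
bounded continuous `φ₁, …, φ_k`, the limits of `∫ φ_j(v_j) f N` and of `∫ φ₁(v₁)⋯φ_k(v_k) f N`
exist as `N → ∞`, and the latter is the product of the former.
The number of particles is written `N = k + n` with `n → ∞`. -/
def IsChaotic (f : ∀ N : ℕ, (Fin N → ℝ) → ℝ) : Prop :=
  (∀ N : ℕ, IsSymmDensity (f N)) ∧
  ∀ (k : ℕ) (φ : Fin k → (ℝ →ᵇ ℝ)), ∃ L : Fin k → ℝ,
    (∀ j : Fin k,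
      Tendsto (fun n : ℕ => ∫ v : Fin (k + n) → ℝ, φ j (v (Fin.castAdd n j)) * f (k + n) v)
        atTop (𝓝 (L j))) ∧
    Tendsto
      (fun n : ℕ => ∫ v : Fin (k + n) → ℝ,
        (∏ j : Fin k, φ j (v (Fin.castAdd n j))) * f (k + n) v)
      atTop (𝓝 (∏ j : Fin k, L j))

end

end KacThermostat

namespace KacThermostat

noncomputable section

/-! The proof follows the empirical characteristic function `u_ξ(v) = N⁻¹ ∑ⱼ exp(i ξ vⱼ)`. For
symmetric densities, chaos amounts to two facts about it, collected in `IsCharChaotic`: its variance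
tends to 0, and its mean is Cauchy in `N`, both uniformly for `ξ` in bounded sets. This form of
chaos is easy to propagate, because the evolution of `u` closes up to errors of order `1/N`.

Rotations preserve Lebesgue measure, so the master equation can be tested against any bounded
measurable function (`generator_dual`, `SolvesMaster.hasDerivWithinAt_integral`); the dual operator
`jumpGen` is the generator of a jump process. Positivity, mass and symmetry of the solution follow
from this weak form, so its densities define a flow of exchangeable laws.

Applied to `u_ξ`, `jumpGen` gives `limitGen` of `u` itself, with error `O(1/N)` uniform in the
configuration (`jumpGen_empChar_sub_le`). `limitGen` is quadratic in `u`, but `|u| ≤ 1` makes it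
Lipschitz, and it evaluates `u` only at `ξ`, `ξ cos θ` and `± ξ sin θ`, so a window `|ξ| ≤ ρ` is
never left. In the derivative of the variance the constant `limitGen` of the mean can be subtracted
for free, since `u - E u` has mean zero; what is left is bounded by a multiple of the supremum of
the variances over the window plus `O(1/N)` (`deriv_devChar_le`). Grönwall propagates the small
variance. The means of the systems with `N` and `M` particles then solve the same Lipschitz equation
up to small errors, and a second Grönwall argument compares them directly; no solution of the
limiting equation has to be constructed.

To return to chaos, small variance and exchangeability factorize the characteristic functions of the
marginals (`IsSymmDensity.norm_integral_prod_character_sub_le`), and Lévy's continuity theorem turns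
this into weak convergence to a product law. In the other direction, chaos with `k = 1, 2` gives the
two facts for each single `ξ`. Uniformity on bounded sets needs equicontinuity in `ξ`, hence
tightness. Chaos only says that integrals of bounded continuous functions converge, without a
limiting law; `exists_eventually_measureReal_tail_le` extracts tightness from that by a Baire
category argument. -/

/-! ### Averages over the collision angle and their self-adjointness. -/

/-- The uniform probability measure on the angles `(0, 2π]`. -/
def angleMeas : Measure ℝ :=
  ENNReal.ofReal (2 * Real.pi)⁻¹ • volume.restrict (Set.Ioc 0 (2 * Real.pi))

instance isProbabilityMeasure_angleMeas : IsProbabilityMeasure angleMeas := by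
  constructor
  have h : (0 : ℝ) < 2 * Real.pi := Real.two_pi_pos
  simp only [angleMeas, Measure.smul_apply, Measure.restrict_apply MeasurableSet.univ,
    Set.univ_inter, Real.volume_Ioc, sub_zero, smul_eq_mul]
  rw [← ENNReal.ofReal_mul (by positivity), inv_mul_cancel₀ h.ne', ENNReal.ofReal_one]

theorem integral_angleMeas {E : Type*} [NormedAddCommGroup E] [NormedSpace ℝ E] (h : ℝ → E) :
    ∫ θ, h θ ∂angleMeas = (2 * Real.pi)⁻¹ • ∫ θ in (0 : ℝ)..(2 * Real.pi), h θ := by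
  have hp : (0 : ℝ) < 2 * Real.pi := Real.two_pi_pos
  rw [angleMeas, integral_smul_measure, intervalIntegral.integral_of_le hp.le,
    ENNReal.toReal_ofReal (by positivity)]

theorem angleAvg_eq_integral (h : ℝ → ℝ) : angleAvg h = ∫ θ, h θ ∂angleMeas := by
  rw [integral_angleMeas, angleAvg, smul_eq_mul]

theorem integral_angleMeas_neg {E : Type*} [NormedAddCommGroup E] [NormedSpace ℝ E] {h : ℝ → E}
    (hp : Function.Periodic h (2 * Real.pi)) :
    ∫ θ, h (-θ) ∂angleMeas = ∫ θ, h θ ∂angleMeas := by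
  rw [integral_angleMeas, integral_angleMeas]
  congr 1
  rw [intervalIntegral.integral_comp_neg]
  have := hp.intervalIntegral_add_eq (-(2 * Real.pi)) 0
  simpa using this

section Duality

variable {E : Type*} [NormedAddCommGroup E] [NormedSpace ℝ E]

theorem integrable_smul_of_bound {M : Type*} [MeasurableSpace M] {μ : Measure M} {H : M → ℝ}
    (hH : Integrable H μ) {Ψ : M → E} (hΨ : StronglyMeasurable Ψ) {C : ℝ}
    (hC : ∀ m, ‖Ψ m‖ ≤ C) : Integrable (fun m => H m • Ψ m) μ :=
  hH.smul_bdd C hΨ.aestronglyMeasurable (ae_of_all _ hC)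

/-- A measurable periodic one-parameter family of measure preserving maps, such as rotations,
averaged over the angle, is symmetric. -/
theorem integral_rotAvg_smul [CompleteSpace E] {M : Type*} [MeasurableSpace M] {μ : Measure M} [SFinite μ]
    {T : ℝ → M → M} (hTm : Measurable (Function.uncurry T))
    (hT : ∀ θ, MeasurePreserving (T θ) μ μ) (hinv : ∀ θ m, T (-θ) (T θ m) = m)
    (hper : ∀ m θ, T (θ + 2 * Real.pi) m = T θ m) {H : M → ℝ} (hH : Integrable H μ) {Ψ : M → E}
    (hΨ : StronglyMeasurable Ψ) {C : ℝ} (hC : ∀ m, ‖Ψ m‖ ≤ C) :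
    Integrable (fun m => ∫ θ, H (T θ m) ∂angleMeas) μ ∧
      ∫ m, (∫ θ, H (T θ m) ∂angleMeas) • Ψ m ∂μ
        = ∫ m, H m • (∫ θ, Ψ (T θ m) ∂angleMeas) ∂μ := by
  -- Integrability over all angles at once comes from the skew product `(θ, m) ↦ (θ, T θ m)`, which
  -- preserves the product measure.
  have hS : MeasurePreserving (fun p : ℝ × M => (id p.1, T p.1 p.2)) (angleMeas.prod μ)
      (angleMeas.prod μ) :=
    (MeasurePreserving.id angleMeas).skew_product hTm (ae_of_all _ fun θ => (hT θ).map_eq)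
  have hH2 : Integrable (fun p : ℝ × M => H p.2) (angleMeas.prod μ) := hH.comp_snd angleMeas
  have hI : Integrable (fun p : ℝ × M => H (T p.1 p.2)) (angleMeas.prod μ) :=
    (hS.integrable_comp hH2.aestronglyMeasurable).2 hH2
  refine ⟨hI.integral_prod_right, ?_⟩
  have hI1 : Integrable (fun p : ℝ × M => H (T p.1 p.2) • Ψ p.2) (angleMeas.prod μ) :=
    integrable_smul_of_bound hI (hΨ.comp_measurable measurable_snd) fun p => hC p.2
  have hTn : Measurable fun p : ℝ × M => T (-p.1) p.2 :=
    hTm.comp (measurable_fst.neg.prodMk measurable_snd)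
  have hI2 : Integrable (fun p : ℝ × M => H p.2 • Ψ (T (-p.1) p.2)) (angleMeas.prod μ) :=
    integrable_smul_of_bound hH2 (hΨ.comp_measurable hTn) fun p => hC _
  have hinv' : ∀ θ m, T θ (T (-θ) m) = m := fun θ m => by
    simpa using hinv (-θ) m
  calc ∫ m, (∫ θ, H (T θ m) ∂angleMeas) • Ψ m ∂μ
      = ∫ m, ∫ θ, H (T θ m) • Ψ m ∂angleMeas ∂μ := by
        congr 1; ext m; rw [integral_smul_const]
    _ = ∫ θ, ∫ m, H (T θ m) • Ψ m ∂μ ∂angleMeas :=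
        (integral_integral_swap (f := fun θ m => H (T θ m) • Ψ m) hI1).symm
    _ = ∫ θ, ∫ m, H m • Ψ (T (-θ) m) ∂μ ∂angleMeas := by
        congr 1; ext θ
        let e : M ≃ᵐ M :=
          { toFun := T (-θ), invFun := T θ, left_inv := hinv' θ, right_inv := hinv θ
            measurable_toFun := (hT (-θ)).measurable
            measurable_invFun := (hT θ).measurable }
        have := (show MeasurePreserving e μ μ from hT (-θ)).integral_comp'
          (fun m => H (T θ m) • Ψ m)
        rw [← this]
        congr 1; ext m
        change H (T θ (T (-θ) m)) • _ = _
        rw [hinv' θ m]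
        rfl
    _ = ∫ m, ∫ θ, H m • Ψ (T (-θ) m) ∂angleMeas ∂μ :=
        integral_integral_swap (f := fun θ m => H m • Ψ (T (-θ) m)) hI2
    _ = ∫ m, H m • (∫ θ, Ψ (T θ m) ∂angleMeas) ∂μ := by
        -- The change of variables has produced the inverse rotations; periodicity lets the angle
        -- change sign under the average.
        congr 1; ext m
        rw [integral_smul, integral_angleMeas_neg (h := fun θ => Ψ (T θ m))]
        intro θ
        simp only [hper]

end Duality

/-! ### Collisions preserve Lebesgue measure. -/

/-- A linear map which is conjugate to its inverse by an involution preserves Lebesgue measure. -/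
theorem measurePreserving_of_conj_inverse {V : Type*} [NormedAddCommGroup V] [NormedSpace ℝ V]
    [FiniteDimensional ℝ V] [MeasurableSpace V] [BorelSpace V] (μ : Measure V)
    [μ.IsAddHaarMeasure] (L L' S : V →ₗ[ℝ] V) (h1 : L ∘ₗ L' = LinearMap.id)
    (h2 : L' = S ∘ₗ L ∘ₗ S) (h3 : S ∘ₗ S = LinearMap.id) : MeasurePreserving L μ μ := by
  have hS : LinearMap.det S * LinearMap.det S = 1 := by
    rw [← LinearMap.det_comp, h3, LinearMap.det_id]
  -- Conjugation by `S` gives `L` and its inverse the same determinant, so its square is 1; the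
  -- determinant itself is never computed.
  have hL : LinearMap.det L * LinearMap.det L = 1 := by
    have h : LinearMap.det L * LinearMap.det L' = 1 := by
      rw [← LinearMap.det_comp, h1, LinearMap.det_id]
    rw [h2, LinearMap.det_comp, LinearMap.det_comp] at h
    linear_combination h - LinearMap.det L * LinearMap.det L * hS
  have h0 : LinearMap.det L ≠ 0 := fun h => by simp [h] at hL
  refine ⟨L.continuous_of_finiteDimensional.measurable, ?_⟩
  rw [Measure.map_linearMap_addHaar_eq_smul_addHaar μ h0]
  have : |(LinearMap.det L)⁻¹| = 1 := by
    rcases mul_self_eq_one_iff.1 hL with h | h <;> simp [h]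
  simp [this]

theorem collide_apply {N : ℕ} (i j : Fin N) (θ : ℝ) (v : Fin N → ℝ) (l : Fin N) :
    collide i j θ v l = if l = j then -v i * Real.sin θ + v j * Real.cos θ
      else if l = i then v i * Real.cos θ + v j * Real.sin θ else v l := by
  simp only [collide, Function.update_apply]

theorem measurable_collide {N : ℕ} (i j : Fin N) :
    Measurable (Function.uncurry (collide i j)) := by
  refine measurable_pi_lambda _ fun l => ?_
  simp only [Function.uncurry_def, collide_apply]
  split_ifs <;> fun_prop

theorem collide_neg_collide {N : ℕ} {i j : Fin N} (h : i ≠ j) (θ : ℝ) (v : Fin N → ℝ) :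
    collide i j (-θ) (collide i j θ v) = v := by
  have := Real.sin_sq_add_cos_sq θ
  ext l
  simp only [collide_apply, Real.sin_neg, Real.cos_neg, h, if_false, if_true]
  split_ifs with h1 h2
  · subst h1; linear_combination v l * this
  · subst h2; linear_combination v l * this
  · rfl

theorem collide_swap {N : ℕ} {i j : Fin N} (h : i ≠ j) (θ : ℝ) (v : Fin N → ℝ) :
    collide j i θ v = collide i j (-θ) v := by
  ext l
  simp only [collide_apply, Real.sin_neg, Real.cos_neg]
  split_ifs with h1 h2
  · exact absurd (h1.symm.trans h2) h
  · ring
  · ring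
  · rfl

/-- The reflection `v_j ↦ -v_j` conjugates the rotation by `θ` to the rotation by `-θ`. -/
theorem measurePreserving_collide {N : ℕ} {i j : Fin N} (h : i ≠ j) (θ : ℝ) :
    MeasurePreserving (collide i j θ) volume volume := by
  let L : ℝ → (Fin N → ℝ) →ₗ[ℝ] (Fin N → ℝ) := fun θ =>
    { toFun := collide i j θ
      map_add' := fun v w => by
        ext l; simp only [collide_apply, Pi.add_apply]; split_ifs <;> ring
      map_smul' := fun a v => by
        ext l
        simp only [collide_apply, Pi.smul_apply, smul_eq_mul, RingHom.id_apply]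
        split_ifs <;> ring }
  let S : (Fin N → ℝ) →ₗ[ℝ] (Fin N → ℝ) :=
    { toFun := fun v => Function.update v j (-v j)
      map_add' := fun v w => by
        ext l; simp only [Function.update_apply, Pi.add_apply]; split_ifs <;> ring
      map_smul' := fun a v => by
        ext l
        simp only [Function.update_apply, Pi.smul_apply, smul_eq_mul, RingHom.id_apply]
        split_ifs <;> ring }
  refine measurePreserving_of_conj_inverse volume (L θ) (L (-θ)) S ?_ ?_ ?_
  · refine LinearMap.ext fun v => ?_
    have := collide_neg_collide h (-θ) v
    rwa [neg_neg] at this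
  · refine LinearMap.ext fun v => ?_
    ext l
    change collide i j (-θ) v l = Function.update (collide i j θ (Function.update v j (-v j))) j
      (-collide i j θ (Function.update v j (-v j)) j) l
    simp only [collide_apply, Function.update_apply, Real.sin_neg, Real.cos_neg, h, if_true,
      if_false]
    split_ifs <;> ring
  · refine LinearMap.ext fun v => ?_
    ext l
    change Function.update (Function.update v j (-v j)) j
      (-(Function.update v j (-v j)) j) l = v l
    simp only [Function.update_apply, if_true]
    split_ifs with h1
    · subst h1; ring
    · rfl

/-- The collision of particle `j` with a particle `w` of the bath, as a rotation of `(v_j, w)`. -/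
def bathCollide {N : ℕ} (j : Fin N) (θ : ℝ) (p : (Fin N → ℝ) × ℝ) : (Fin N → ℝ) × ℝ :=
  (Function.update p.1 j (p.1 j * Real.cos θ + p.2 * Real.sin θ),
    -p.1 j * Real.sin θ + p.2 * Real.cos θ)

theorem measurable_bathCollide {N : ℕ} (j : Fin N) :
    Measurable (Function.uncurry (bathCollide j)) := by
  refine Measurable.prodMk (measurable_pi_lambda _ fun l => ?_) ?_
  · simp only [Function.update_apply]
    split_ifs <;> fun_prop
  · fun_prop

theorem bathCollide_neg_bathCollide {N : ℕ} (j : Fin N) (θ : ℝ) (p : (Fin N → ℝ) × ℝ) :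
    bathCollide j (-θ) (bathCollide j θ p) = p := by
  have := Real.sin_sq_add_cos_sq θ
  refine Prod.ext ?_ ?_
  · ext l
    simp only [bathCollide, Function.update_apply, Real.sin_neg, Real.cos_neg, if_true]
    split_ifs with h1
    · subst h1; linear_combination p.1 l * this
    · rfl
  · simp only [bathCollide, Function.update_apply, Real.sin_neg, Real.cos_neg, if_true]
    linear_combination p.2 * this

theorem measurePreserving_bathCollide {N : ℕ} (j : Fin N) (θ : ℝ) :
    MeasurePreserving (bathCollide j θ) volume volume := by
  let L : ℝ → ((Fin N → ℝ) × ℝ) →ₗ[ℝ] ((Fin N → ℝ) × ℝ) := fun θ =>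
    { toFun := bathCollide j θ
      map_add' := fun v w => by
        refine Prod.ext (funext fun l => ?_) ?_
        · simp only [bathCollide, Function.update_apply, Prod.fst_add, Prod.snd_add, Pi.add_apply]
          split_ifs <;> ring
        · simp only [bathCollide, Prod.fst_add, Prod.snd_add, Pi.add_apply]; ring
      map_smul' := fun a v => by
        refine Prod.ext (funext fun l => ?_) ?_
        · simp only [bathCollide, Function.update_apply, Prod.smul_fst, Prod.smul_snd,
            Pi.smul_apply, smul_eq_mul, RingHom.id_apply]
          split_ifs <;> ring
        · simp only [bathCollide, Prod.smul_fst, Prod.smul_snd,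
            Pi.smul_apply, smul_eq_mul, RingHom.id_apply]
          ring }
  let S : ((Fin N → ℝ) × ℝ) →ₗ[ℝ] ((Fin N → ℝ) × ℝ) :=
    { toFun := fun p => (p.1, -p.2)
      map_add' := fun v w => by
        refine Prod.ext rfl ?_
        simp only [Prod.snd_add]; ring
      map_smul' := fun a v => by
        refine Prod.ext rfl ?_
        simp }
  have : (volume : Measure ((Fin N → ℝ) × ℝ)).IsAddHaarMeasure :=
    Measure.prod.instIsAddHaarMeasure volume volume
  refine measurePreserving_of_conj_inverse volume (L θ) (L (-θ)) S ?_ ?_ ?_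
  · refine LinearMap.ext fun v => ?_
    have := bathCollide_neg_bathCollide j (-θ) v
    rwa [neg_neg] at this
  · refine LinearMap.ext fun p => ?_
    change bathCollide j (-θ) p = ((bathCollide j θ (p.1, -p.2)).1, -(bathCollide j θ (p.1, -p.2)).2)
    refine Prod.ext (funext fun l => ?_) ?_
    · simp only [bathCollide, Function.update_apply, Real.sin_neg, Real.cos_neg]
      split_ifs <;> ring
    · simp only [bathCollide, Real.sin_neg, Real.cos_neg]; ring
  · refine LinearMap.ext fun p => ?_
    exact Prod.ext rfl (neg_neg p.2)

/-! ### The jump process and its duality with the generator. -/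

/-- The law of the pair (bath velocity, collision angle). -/
def jumpLaw (β : ℝ) : Measure (ℝ × ℝ) :=
  (ProbabilityTheory.gaussianReal 0 (Real.toNNReal β⁻¹)).prod angleMeas

instance isProbabilityMeasure_jumpLaw (β : ℝ) : IsProbabilityMeasure (jumpLaw β) := by
  unfold jumpLaw; infer_instance

theorem gauss_eq_gaussianPDFReal {β : ℝ} (hβ : 0 < β) (w : ℝ) :
    gauss β w = ProbabilityTheory.gaussianPDFReal 0 (Real.toNNReal β⁻¹) w := by
  have hb : (0 : ℝ) ≤ β⁻¹ := by positivity
  rw [gauss, ProbabilityTheory.gaussianPDFReal, Real.coe_toNNReal _ hb, ← Real.sqrt_inv]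
  congr 2
  · field_simp
  · rw [sub_zero]; field_simp

/-- The types of jumps: an ordered pair of particles, or a particle and the bath. -/
abbrev Jump (N : ℕ) := (Fin N × Fin N) ⊕ Fin N

/-- The velocities after a jump with bath velocity `ω.1` and angle `ω.2`. -/
def jumpMap {N : ℕ} : Jump N → ℝ × ℝ → (Fin N → ℝ) → (Fin N → ℝ)
  | Sum.inl p, ω, v => collide p.1 p.2 ω.2 v
  | Sum.inr j, ω, v => Function.update v j (v j * Real.cos ω.2 + ω.1 * Real.sin ω.2)

/-- The rates of the jumps. -/
def jumpRate (lam mu : ℝ) {N : ℕ} : Jump N → ℝ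
  -- Each unordered pair occurs twice among the ordered ones, hence the factor `1 / 2`.
  | Sum.inl p => if p.1 = p.2 then 0 else lam * N * ((N.choose 2 : ℕ) : ℝ)⁻¹ / 2
  | Sum.inr _ => mu

/-- The backward generator of the jump process, dual to `-generator`. -/
def jumpGen (lam mu β : ℝ) {N : ℕ} {E : Type*} [NormedAddCommGroup E] [NormedSpace ℝ E]
    (Φ : (Fin N → ℝ) → E) (v : Fin N → ℝ) : E :=
  ∑ k : Jump N, jumpRate lam mu k • ((∫ ω, Φ (jumpMap k ω v) ∂jumpLaw β) - Φ v)

theorem measurable_jumpMap {N : ℕ} (k : Jump N) :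
    Measurable fun p : (Fin N → ℝ) × (ℝ × ℝ) => jumpMap k p.2 p.1 := by
  rcases k with p | j
  · exact (measurable_collide p.1 p.2).comp
      ((measurable_snd.comp measurable_snd).prodMk measurable_fst)
  · refine measurable_pi_lambda _ fun l => ?_
    simp only [jumpMap, Function.update_apply]
    split_ifs <;> fun_prop

section

theorem integrable_comp_jumpMap {E : Type*} [NormedAddCommGroup E] {N : ℕ} (β : ℝ) (k : Jump N)
    {Φ : (Fin N → ℝ) → E}
    (hΦ : StronglyMeasurable Φ) {C : ℝ} (hC : ∀ v, ‖Φ v‖ ≤ C) (v : Fin N → ℝ) :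
    Integrable (fun ω => Φ (jumpMap k ω v)) (jumpLaw β) :=
  Integrable.of_bound (C := C)
    (hΦ.comp_measurable
      ((measurable_jumpMap k).comp (measurable_const.prodMk measurable_id))).aestronglyMeasurable
    (ae_of_all _ fun _ => hC _)

variable {E : Type*} [NormedAddCommGroup E] [NormedSpace ℝ E]

theorem stronglyMeasurable_jumpAvg {N : ℕ} (β : ℝ) (k : Jump N) {Φ : (Fin N → ℝ) → E}
    (hΦ : StronglyMeasurable Φ) :
    StronglyMeasurable fun v => ∫ ω, Φ (jumpMap k ω v) ∂jumpLaw β :=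
  StronglyMeasurable.integral_prod_right'
    (f := fun p : (Fin N → ℝ) × (ℝ × ℝ) => Φ (jumpMap k p.2 p.1))
    (hΦ.comp_measurable (measurable_jumpMap k))

theorem norm_jumpAvg_le {N : ℕ} (β : ℝ) (k : Jump N) {Φ : (Fin N → ℝ) → E}
    {C : ℝ} (hC : ∀ v, ‖Φ v‖ ≤ C) (v : Fin N → ℝ) :
    ‖∫ ω, Φ (jumpMap k ω v) ∂jumpLaw β‖ ≤ C := by
  simpa using norm_integral_le_of_norm_le_const (μ := jumpLaw β)
    (ae_of_all _ fun ω => hC (jumpMap k ω v))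

theorem stronglyMeasurable_jumpGen (lam mu β : ℝ) {N : ℕ} {Φ : (Fin N → ℝ) → E}
    (hΦ : StronglyMeasurable Φ) : StronglyMeasurable (jumpGen lam mu β Φ) := by
  unfold jumpGen
  exact Finset.stronglyMeasurable_fun_sum _ fun k _ =>
    ((stronglyMeasurable_jumpAvg β k hΦ).sub hΦ).const_smul _

/-- The self-adjointness of rotation averages, on `ℝ^N`. Pair collisions ignore the bath velocity in
`jumpLaw`, which integrates to 1; sharing one law between both kinds of jumps allows a single sum
over `Jump N`. -/
theorem collideAvg_dual (β : ℝ) {N : ℕ} {i j : Fin N} (hij : i ≠ j) [CompleteSpace E]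
    {f : (Fin N → ℝ) → ℝ} (hf : Integrable f volume) {Φ : (Fin N → ℝ) → E}
    (hΦ : StronglyMeasurable Φ) {C : ℝ} (hC : ∀ v, ‖Φ v‖ ≤ C) :
    Integrable (fun v => angleAvg fun θ => f (collide i j θ v)) volume ∧
      ∫ v, (angleAvg fun θ => f (collide i j θ v)) • Φ v
        = ∫ v, f v • ∫ ω, Φ (jumpMap (Sum.inl (i, j)) ω v) ∂jumpLaw β := by
  have h := integral_rotAvg_smul (measurable_collide i j) (measurePreserving_collide hij)
    (collide_neg_collide hij) (fun v θ => by
      ext l; simp only [collide_apply, Real.cos_add_two_pi, Real.sin_add_two_pi]) hf hΦ hC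
  simp only [angleAvg_eq_integral]
  refine ⟨h.1, h.2.trans ?_⟩
  congr 1; ext v
  rw [jumpLaw]
  simp only [jumpMap]
  rw [integral_fun_snd (fun θ => Φ (collide i j θ v))]
  simp

/-- Exchanging the two particles reverses the angle, which the average does not see. This matches
the sum over `i < j` with half the sum over ordered pairs. -/
theorem jumpAvg_swap (β : ℝ) {N : ℕ} {i j : Fin N} (hij : i ≠ j)
    (Φ : (Fin N → ℝ) → E) (v : Fin N → ℝ) :
    ∫ ω, Φ (jumpMap (Sum.inl (i, j)) ω v) ∂jumpLaw β
      = ∫ ω, Φ (jumpMap (Sum.inl (j, i)) ω v) ∂jumpLaw β := by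
  rw [jumpLaw]
  simp only [jumpMap, collide_swap hij]
  rw [integral_fun_snd (fun θ => Φ (collide i j θ v)),
    integral_fun_snd (fun θ => Φ (collide i j (-θ) v)),
    integral_angleMeas_neg (h := fun θ => Φ (collide i j θ v))]
  intro θ
  dsimp only
  congr 1
  ext l; simp only [collide_apply, Real.cos_add_two_pi, Real.sin_add_two_pi]

/-- `R_j f` is the function `f(v) gauss(w)` on `ℝ^N × ℝ`, averaged over rotations of `(v_j, w)` and
integrated over `w`. Moving the rotation to the test function, which depends on `v` only, leaves `w`
with its Gaussian law. -/
theorem thermR_dual {β : ℝ} (hβ : 0 < β) {N : ℕ} (j : Fin N) [CompleteSpace E]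
    {f : (Fin N → ℝ) → ℝ} (hf : Integrable f volume) {Φ : (Fin N → ℝ) → E}
    (hΦ : StronglyMeasurable Φ) {C : ℝ} (hC : ∀ v, ‖Φ v‖ ≤ C) :
    Integrable (thermR β j f) volume ∧
      ∫ v, thermR β j f v • Φ v
        = ∫ v, f v • ∫ ω, Φ (jumpMap (Sum.inr j) ω v) ∂jumpLaw β := by
  have hb : Real.toNNReal β⁻¹ ≠ 0 := by
    simpa [Real.toNNReal_eq_zero] using hβ
  have hg : Integrable (gauss β) volume := by
    rw [show gauss β = _ from funext (gauss_eq_gaussianPDFReal hβ)]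
    exact ProbabilityTheory.integrable_gaussianPDFReal _ _
  have hH : Integrable (fun p : (Fin N → ℝ) × ℝ => f p.1 * gauss β p.2)
      (volume.prod volume) := hf.mul_prod hg
  have hΨ : StronglyMeasurable fun p : (Fin N → ℝ) × ℝ => Φ p.1 :=
    hΦ.comp_measurable measurable_fst
  have h := integral_rotAvg_smul (measurable_bathCollide j) (measurePreserving_bathCollide j)
    (bathCollide_neg_bathCollide j) (fun v θ => by
      simp only [bathCollide, Real.cos_add_two_pi, Real.sin_add_two_pi]) hH hΨ
      (fun p => hC p.1)
  have hR : ∀ v, thermR β j f v = ∫ w, ∫ θ, f (bathCollide j θ (v, w)).1 *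
      gauss β (bathCollide j θ (v, w)).2 ∂angleMeas := fun v => by
    simp only [thermR, angleAvg_eq_integral, bathCollide, mul_comm]
  have hI := h.1.integral_prod_left
  have hR' : thermR β j f = fun v => ∫ w, ∫ θ, f (bathCollide j θ (v, w)).1 *
      gauss β (bathCollide j θ (v, w)).2 ∂angleMeas := funext hR
  refine ⟨by rw [hR']; exact hI, ?_⟩
  have hB : StronglyMeasurable fun p : (Fin N → ℝ) × ℝ =>
      ∫ θ, Φ (bathCollide j θ p).1 ∂angleMeas := by
    refine StronglyMeasurable.integral_prod_right'
      (f := fun (q : ((Fin N → ℝ) × ℝ) × ℝ) => Φ (bathCollide j q.2 q.1).1) ?_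
    exact hΦ.comp_measurable (measurable_fst.comp ((measurable_bathCollide j).comp
      (measurable_snd.prodMk measurable_fst)))
  have hBC : ∀ p : (Fin N → ℝ) × ℝ, ‖∫ θ, Φ (bathCollide j θ p).1 ∂angleMeas‖ ≤ C := fun p => by
    simpa using norm_integral_le_of_norm_le_const (μ := angleMeas)
      (ae_of_all _ fun θ => hC (bathCollide j θ p).1)
  calc ∫ v, thermR β j f v • Φ v
      = ∫ v, ∫ w, (∫ θ, f (bathCollide j θ (v, w)).1 *
          gauss β (bathCollide j θ (v, w)).2 ∂angleMeas) • Φ v := by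
        congr 1; ext v; rw [integral_smul_const, hR]
    _ = ∫ p, (∫ θ, f (bathCollide j θ p).1 *
          gauss β (bathCollide j θ p).2 ∂angleMeas) • Φ p.1 ∂(volume.prod volume) :=
        (integral_prod _ (integrable_smul_of_bound h.1 hΨ fun p => hC p.1)).symm
    _ = ∫ p, (f p.1 * gauss β p.2) • (∫ θ, Φ (bathCollide j θ p).1 ∂angleMeas)
          ∂(volume.prod volume) := h.2
    _ = ∫ v, ∫ w, (f v * gauss β w) • (∫ θ, Φ (bathCollide j θ (v, w)).1 ∂angleMeas) :=
        integral_prod _ (integrable_smul_of_bound hH hB hBC)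
    _ = ∫ v, f v • ∫ ω, Φ (jumpMap (Sum.inr j) ω v) ∂jumpLaw β := by
        congr 1; ext v
        simp only [mul_smul]
        rw [integral_smul, jumpLaw, integral_prod _ (integrable_comp_jumpMap β _ hΦ hC v),
          ProbabilityTheory.integral_gaussianReal_eq_integral_smul hb]
        simp only [gauss_eq_gaussianPDFReal hβ]
        rfl

end

theorem sum_Ioi_symm {N : ℕ} {E : Type*} [AddCommGroup E] [Module ℝ E] (g : Fin N → Fin N → E)
    (hg : ∀ i j, i ≠ j → g i j = g j i) :
    ∑ i, ∑ j, (if i = j then 0 else g i j) = (2 : ℝ) • ∑ i, ∑ j ∈ Finset.Ioi i, g i j := by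
  have h1 : ∀ i, ∑ j, (if i = j then 0 else g i j)
      = ∑ j ∈ Finset.Ioi i, g i j + ∑ j ∈ Finset.Iio i, g i j := by
    intro i
    have : (Finset.univ : Finset (Fin N)).erase i = Finset.Ioi i ∪ Finset.Iio i := by
      ext j
      simp only [Finset.mem_erase, Finset.mem_univ, and_true, Finset.mem_union, Finset.mem_Ioi,
        Finset.mem_Iio]
      exact ⟨fun h => (lt_or_gt_of_ne h).symm, fun h => h.elim ne_of_gt ne_of_lt⟩
    rw [← Finset.sum_union, ← this, ← Finset.add_sum_erase _ _ (Finset.mem_univ i), if_pos rfl,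
      zero_add]
    · exact Finset.sum_congr rfl fun j hj => if_neg (Finset.ne_of_mem_erase hj).symm
    · exact Finset.disjoint_left.2 fun j h1 h2 =>
        lt_asymm (Finset.mem_Ioi.1 h1) (Finset.mem_Iio.1 h2)
  have h2 : ∑ i, ∑ j ∈ Finset.Iio i, g i j = ∑ i, ∑ j ∈ Finset.Ioi i, g i j := by
    rw [Finset.sum_comm' (t' := Finset.univ) (s' := fun j => Finset.Ioi j)
      (fun i j => by simp)]
    exact Finset.sum_congr rfl fun i _ => Finset.sum_congr rfl fun j hj =>
      hg _ _ (Finset.mem_Ioi.1 hj).ne'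
  rw [Finset.sum_congr rfl fun i _ => h1 i, Finset.sum_add_distrib, h2, two_smul]

theorem sum_Ioi_one (N : ℕ) :
    ∑ i : Fin N, ∑ _j ∈ Finset.Ioi i, (1 : ℝ) = ((N.choose 2 : ℕ) : ℝ) := by
  have h := sum_Ioi_symm (N := N) (fun _ _ => (1 : ℝ)) fun _ _ _ => rfl
  have h2 : ∑ i : Fin N, ∑ j : Fin N, (if i = j then (0 : ℝ) else 1) = N * (N - 1) := by
    have : ∀ i j : Fin N, (if i = j then (0 : ℝ) else 1) = 1 - if i = j then 1 else 0 :=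
      fun i j => by split_ifs <;> simp
    simp [this, mul_sub]
  rw [h2, smul_eq_mul] at h
  rw [Nat.cast_choose_two]
  linarith

theorem generator_dual {lam mu β : ℝ} (hβ : 0 < β) {N : ℕ} {E : Type*} [NormedAddCommGroup E]
    [NormedSpace ℝ E] [CompleteSpace E]
    {f : (Fin N → ℝ) → ℝ} (hf : Integrable f volume) {Φ : (Fin N → ℝ) → E}
    (hΦ : StronglyMeasurable Φ) {C : ℝ} (hC : ∀ v, ‖Φ v‖ ≤ C) :
    Integrable (generator lam mu β f) volume ∧
      ∫ v, generator lam mu β f v • Φ v = -∫ v, f v • jumpGen lam mu β Φ v := by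
  set A : Fin N → Fin N → (Fin N → ℝ) → ℝ := fun i j v => angleAvg fun θ => f (collide i j θ v)
    with hA
  set c : ℝ := ((N.choose 2 : ℕ) : ℝ)⁻¹ with hc
  have hgen : generator lam mu β f = fun v =>
      ∑ i : Fin N, ∑ j ∈ Finset.Ioi i, (lam * N * c) * (f v - A i j v)
        + ∑ j, mu * (f v - thermR β j f v) := by
    ext v
    rw [generator, Finset.mul_sum]
    congr 1
    simp only [← Finset.mul_sum, Finset.sum_sub_distrib]
    have hone : ∑ i : Fin N, ∑ _j ∈ Finset.Ioi i, f v = ((N.choose 2 : ℕ) : ℝ) * f v := by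
      rw [← sum_Ioi_one, Finset.sum_mul]
      simp only [Finset.sum_mul, one_mul]
    rw [hone, kacQ]
    split_ifs with h2
    -- With fewer than two particles `Q = I` makes the left side vanish, and the inverse of the zero
    -- binomial coefficient, read as 0, the right side.
    · rw [hc, Nat.choose_eq_zero_of_lt h2]; simp
    · have h0 : ((N.choose 2 : ℕ) : ℝ) ≠ 0 := by
        have := Nat.choose_pos (not_lt.1 h2)
        positivity
      rw [hc, mul_sub, mul_sub, mul_assoc (lam * N) _ (_ * f v), inv_mul_cancel_left₀ h0]
      ring
  have hpair : ∀ i : Fin N, ∀ j ∈ Finset.Ioi i,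
      Integrable (fun v => (lam * N * c) * (f v - A i j v)) volume := fun i j hj =>
    (hf.sub (collideAvg_dual β (Finset.mem_Ioi.1 hj).ne hf hΦ hC).1).const_mul _
  have hther : ∀ j, Integrable (fun v => mu * (f v - thermR β j f v)) volume := fun j =>
    (hf.sub (thermR_dual hβ j hf hΦ hC).1).const_mul _
  have hsum1 : Integrable (fun v => ∑ i : Fin N, ∑ j ∈ Finset.Ioi i,
      (lam * N * c) * (f v - A i j v)) volume :=
    integrable_finsetSum _ fun i _ => integrable_finsetSum _ fun j hj => hpair i j hj
  have hsum2 : Integrable (fun v => ∑ j, mu * (f v - thermR β j f v)) volume :=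
    integrable_finsetSum _ fun j _ => hther j
  refine ⟨by rw [hgen]; exact hsum1.add hsum2, ?_⟩
  set K : Jump N → (Fin N → ℝ) → E := fun k v => ∫ ω, Φ (jumpMap k ω v) ∂jumpLaw β with hK
  have hKint : ∀ k, Integrable (fun v => f v • K k v) volume := fun k =>
    integrable_smul_of_bound hf (stronglyMeasurable_jumpAvg β k hΦ) (norm_jumpAvg_le β k hC)
  have hΦint : Integrable (fun v => f v • Φ v) volume := integrable_smul_of_bound hf hΦ hC
  have hDint : ∀ k, Integrable (fun v => f v • (K k v - Φ v)) volume := fun k => by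
    simp only [smul_sub]; exact (hKint k).sub hΦint
  have hjump : ∀ v, f v • jumpGen lam mu β Φ v =
      ∑ i : Fin N, ∑ j ∈ Finset.Ioi i, (lam * N * c) • (f v • (K (Sum.inl (i, j)) v - Φ v))
        + ∑ j, mu • (f v • (K (Sum.inr j) v - Φ v)) := by
    intro v
    rw [jumpGen, Fintype.sum_sum_type, Fintype.sum_prod_type, smul_add]
    congr 1
    · have h := sum_Ioi_symm (N := N)
        (fun i j => (lam * N * c / 2) • (f v • (K (Sum.inl (i, j)) v - Φ v)))
        (fun i j hij => by simp only [hK, jumpAvg_swap β hij])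
      simp only [Finset.smul_sum] at h ⊢
      refine Eq.trans ?_ (h.trans ?_)
      · refine Finset.sum_congr rfl fun i _ => Finset.sum_congr rfl fun j _ => ?_
        simp only [jumpRate]
        split_ifs
        · simp
        · rw [smul_comm]
      · refine Finset.sum_congr rfl fun i _ => Finset.sum_congr rfl fun j _ => ?_
        rw [smul_smul]; congr 1; ring
    · rw [Finset.smul_sum]
      refine Finset.sum_congr rfl fun j _ => ?_
      rw [smul_comm]; rfl
  have hdual : ∀ (a : ℝ) (k : Jump N) (h : (Fin N → ℝ) → ℝ), (Integrable h volume ∧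
      ∫ v, h v • Φ v = ∫ v, f v • K k v) →
      ∫ v, (a * (f v - h v)) • Φ v = -∫ v, a • (f v • (K k v - Φ v)) := by
    intro a k h hd
    have h1 : ∫ v, (a * (f v - h v)) • Φ v = a • ∫ v, (f v • Φ v - h v • Φ v) := by
      rw [← integral_smul]; congr 1; ext v; rw [mul_smul, sub_smul]
    have h2 : ∫ v, a • (f v • (K k v - Φ v)) = a • ∫ v, (f v • K k v - f v • Φ v) := by
      rw [← integral_smul]; congr 1; ext v; rw [smul_sub (f v)]
    rw [h1, h2, integral_sub hΦint (integrable_smul_of_bound hd.1 hΦ hC),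
      integral_sub (hKint k) hΦint, hd.2, ← smul_neg, neg_sub]
  have hA1 : ∀ i : Fin N, ∀ j ∈ Finset.Ioi i,
      ∫ v, ((lam * N * c) * (f v - A i j v)) • Φ v
        = -∫ v, (lam * N * c) • (f v • (K (Sum.inl (i, j)) v - Φ v)) := fun i j hj =>
    hdual _ _ _ (collideAvg_dual β (Finset.mem_Ioi.1 hj).ne hf hΦ hC)
  have hA2 : ∀ j, ∫ v, (mu * (f v - thermR β j f v)) • Φ v
        = -∫ v, mu • (f v • (K (Sum.inr j) v - Φ v)) := fun j =>
    hdual _ _ _ (thermR_dual hβ j hf hΦ hC)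
  have hDs : ∀ (a : ℝ) k, Integrable (fun v => a • (f v • (K k v - Φ v))) volume := fun a k =>
    (hDint k).smul a
  have hpS := fun i j hj => integrable_smul_of_bound (hpair i j hj) hΦ hC
  have htS := fun j => integrable_smul_of_bound (hther j) hΦ hC
  simp only [hgen, hjump, add_smul, Finset.sum_smul]
  rw [integral_add
      (integrable_finsetSum _ fun i _ => integrable_finsetSum _ fun j hj => hpS i j hj)
      (integrable_finsetSum _ fun j _ => htS j),
    integral_add
      (integrable_finsetSum _ fun i _ => integrable_finsetSum _ fun j _ => hDs _ _)
      (integrable_finsetSum _ fun j _ => hDs _ _), neg_add]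
  congr 1
  · rw [integral_finsetSum _ fun i _ => integrable_finsetSum _ fun j hj => hpS i j hj,
      integral_finsetSum _ fun i _ => integrable_finsetSum _ fun j _ => hDs _ _,
      ← Finset.sum_neg_distrib]
    refine Finset.sum_congr rfl fun i _ => ?_
    rw [integral_finsetSum _ fun j hj => hpS i j hj,
      integral_finsetSum _ fun j _ => hDs _ _, ← Finset.sum_neg_distrib]
    exact Finset.sum_congr rfl fun j hj => hA1 i j hj
  · rw [integral_finsetSum _ fun j _ => htS j,
      integral_finsetSum _ fun j _ => hDs _ _, ← Finset.sum_neg_distrib]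
    exact Finset.sum_congr rfl fun j _ => hA2 j

/-! ### Grönwall's inequality for families. -/

/-- Grönwall's inequality for the supremum of a family of functions, none of whose regularity
is assumed to be uniform. -/
theorem sup_gronwall {X : Type*} {u u' : X → ℝ → ℝ} {T A B C ε : ℝ} (hA : 0 ≤ A) (hB : 0 ≤ B)
    (hC : 0 ≤ C) (hε : 0 ≤ ε)
    (hu : ∀ x, ∀ t, 0 ≤ t → HasDerivWithinAt (u x) (u' x t) (Set.Ici 0) t)
    (h0 : ∀ x, u x 0 ≤ A) (hbd : ∀ x, ∀ t ∈ Set.Icc 0 T, u x t ≤ B)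
    (hu' : ∀ t ∈ Set.Icc 0 T, ∀ g, 0 ≤ g → (∀ x, u x t ≤ g) → ∀ x, u' x t ≤ C * g + ε)
    {t : ℝ} (ht : t ∈ Set.Icc 0 T) (x : X) : u x t ≤ (A + ε * t) * Real.exp (C * t) := by
  set S : ℕ → ℝ → ℝ := fun n t => ∑ j ∈ Finset.range n, (C * t) ^ j / (j.factorial : ℝ) with hS
  have hS0 : ∀ n t, 0 ≤ t → 0 ≤ S n t := fun n t ht => Finset.sum_nonneg fun j _ => by positivity
  have hP : ∀ (n : ℕ) (t : ℝ), HasDerivAt (fun t => (C * t) ^ (n + 1) / ((n + 1).factorial : ℝ))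
      (C * ((C * t) ^ n / (n.factorial : ℝ))) t := by
    intro n t
    have h := (((hasDerivAt_id t).const_mul C).pow (n + 1)).div_const ((n + 1).factorial : ℝ)
    refine h.congr_deriv ?_
    rw [Nat.factorial_succ]
    push_cast
    have : (n.factorial : ℝ) ≠ 0 := by positivity
    simp only [id]
    field_simp
  have hSd : ∀ (n : ℕ) (t : ℝ), HasDerivAt (S (n + 1)) (C * S n t) t := by
    intro n t
    have h1 : S (n + 1) = fun t => ∑ j ∈ Finset.range n,
        (C * t) ^ (j + 1) / ((j + 1).factorial : ℝ) + 1 := by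
      ext t; simp only [hS]; rw [Finset.sum_range_succ']; simp
    rw [h1]
    simp only [hS, Finset.mul_sum]
    exact (HasDerivAt.fun_sum fun j _ => hP j t).add_const 1
  -- The supremum over `x` need not be differentiable, so it is never differentiated. Starting from
  -- the crude bound `B`, each round inserts the current bound for all members into the derivative
  -- of one member and integrates; `B` survives only with the factor `(C t)^n / n!`.
  have key : ∀ n : ℕ, ∀ t ∈ Set.Icc 0 T, ∀ x,
      u x t ≤ (A + ε * t) * S n t + B * ((C * t) ^ n / (n.factorial : ℝ)) := by
    intro n
    induction n with
    | zero => intro t ht x; simpa [hS] using hbd x t ht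
    | succ n ih =>
      intro t ht x
      set b : ℝ → ℝ := fun t => (A + ε * t) * S (n + 1) t +
        B * ((C * t) ^ (n + 1) / ((n + 1).factorial : ℝ))
      have hb : ∀ t, HasDerivAt b ((ε * 1) * S (n + 1) t + (A + ε * t) * (C * S n t) +
          B * (C * ((C * t) ^ n / (n.factorial : ℝ)))) t := fun t =>
        ((((hasDerivAt_id t).const_mul ε).const_add A).mul (hSd n t)).add ((hP n t).const_mul B)
      refine image_le_of_deriv_right_le_deriv_boundary (f := u x) (f' := u' x) (a := 0) (b := T)
        (B := b) (fun s hs => ((hu x s hs.1).continuousWithinAt).mono fun y hy => hy.1)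
        (fun s hs => (hu x s hs.1).mono fun y hy => le_trans hs.1 hy) ?_
        (fun s _ => (hb s).continuousAt.continuousWithinAt)
        (fun s _ => (hb s).hasDerivWithinAt) ?_ ht
      · have : S (n + 1) 0 = 1 := by simp [hS, Finset.sum_range_succ']
        simpa [b, this] using h0 x
      · intro s hs
        have hs0 : 0 ≤ s := hs.1
        -- The derivative of the barrier contains `ε * S (n + 1) s`, which must dominate the `ε` of
        -- the hypothesis.
        have hS1 : 1 ≤ S (n + 1) s := by
          simp only [hS]
          rw [Finset.sum_range_succ']
          have : 0 ≤ ∑ k ∈ Finset.range n, (C * s) ^ (k + 1) / ((k + 1).factorial : ℝ) :=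
            Finset.sum_nonneg fun j _ => by positivity
          simpa using this
        have h2 := hu' s ⟨hs.1, hs.2.le⟩ _
          (add_nonneg (mul_nonneg (by positivity) (hS0 n s hs0)) (by positivity))
          (ih s ⟨hs.1, hs.2.le⟩) x
        have h3 := mul_le_mul_of_nonneg_left hS1 hε
        linarith
  have hlim : Tendsto (fun n : ℕ => (A + ε * t) * Real.exp (C * t) +
      B * ((C * t) ^ n / (n.factorial : ℝ))) atTop (𝓝 ((A + ε * t) * Real.exp (C * t) + B * 0)) :=
    tendsto_const_nhds.add
      ((FloorSemiring.tendsto_pow_div_factorial_atTop (C * t)).const_mul B)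
  rw [mul_zero, add_zero] at hlim
  refine ge_of_tendsto' hlim fun n => (key n t ht x).trans ?_
  gcongr
  · have := ht.1; positivity
  · exact Real.sum_le_exp_of_nonneg (mul_nonneg hC ht.1) n

/-! ### Solutions in weak form: mass, positivity, symmetry. -/

section Solution

variable {lam mu β : ℝ} {N : ℕ} {f : ℝ → (Fin N → ℝ) → ℝ}

theorem integrable_generator (hβ : 0 < β) {g : (Fin N → ℝ) → ℝ} (hg : Integrable g volume) :
    Integrable (generator lam mu β g) volume :=
  (generator_dual (E := ℝ) (Φ := fun _ => 0) (C := 0) hβ hg stronglyMeasurable_const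
    fun _ => by simp).1

theorem integral_norm_eq_eLpNorm {g : (Fin N → ℝ) → ℝ} (hg : Integrable g volume) :
    ∫ v, ‖g v‖ = (eLpNorm g 1 volume).toReal := by
  rw [eLpNorm_one_eq_lintegral_enorm, integral_norm_eq_lintegral_enorm hg.aestronglyMeasurable]

/-- The master equation, tested against a bounded measurable function. -/
theorem SolvesMaster.hasDerivWithinAt_integral (hf : SolvesMaster lam mu β f) (hβ : 0 < β)
    {E : Type*} [NormedAddCommGroup E] [NormedSpace ℝ E] [CompleteSpace E]
    {Φ : (Fin N → ℝ) → E} (hΦ : StronglyMeasurable Φ) {C : ℝ} (hC : ∀ v, ‖Φ v‖ ≤ C) {t : ℝ}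
    (ht : 0 ≤ t) :
    HasDerivWithinAt (fun s => ∫ v, f s v • Φ v) (∫ v, f t v • jumpGen lam mu β Φ v)
      (Set.Ici 0) t := by
  have hI : ∀ s, 0 ≤ s → Integrable (fun v => f s v • Φ v) volume := fun s hs =>
    integrable_smul_of_bound (hf.1 s hs) hΦ hC
  have hgi := integrable_generator (lam := lam) (mu := mu) hβ (hf.1 t ht)
  have hdual := (generator_dual (lam := lam) (mu := mu) hβ (hf.1 t ht) hΦ hC).2
  rw [hasDerivWithinAt_iff_tendsto_slope, tendsto_iff_norm_sub_tendsto_zero]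
  have hlim := (((ENNReal.tendsto_toReal ENNReal.zero_ne_top).comp (hf.2 t ht)).const_mul C)
  rw [ENNReal.toReal_zero, mul_zero] at hlim
  refine squeeze_zero' (Eventually.of_forall fun _ => norm_nonneg _) ?_ hlim
  filter_upwards [self_mem_nhdsWithin] with s hs
  have hs0 : 0 ≤ s := hs.1
  have hq : Integrable (fun v => (f s v - f t v) / (s - t) + generator lam mu β (f t) v) volume :=
    (((hf.1 s hs0).sub (hf.1 t ht)).div_const _).add hgi
  have heq : slope (fun s => ∫ v, f s v • Φ v) t s - ∫ v, f t v • jumpGen lam mu β Φ v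
      = ∫ v, ((f s v - f t v) / (s - t) + generator lam mu β (f t) v) • Φ v := by
    have h1 : ∫ v, f t v • jumpGen lam mu β Φ v = -∫ v, generator lam mu β (f t) v • Φ v := by
      rw [hdual, neg_neg]
    have h2 : Integrable (fun v => (s - t)⁻¹ • (f s v • Φ v - f t v • Φ v)) volume :=
      ((hI s hs0).sub (hI t ht)).smul _
    rw [slope_def_module, h1, sub_neg_eq_add, ← integral_sub (hI s hs0) (hI t ht),
      ← integral_smul, ← integral_add h2 (integrable_smul_of_bound hgi hΦ hC)]
    congr 1; ext v
    rw [add_smul, div_eq_inv_mul, mul_smul, sub_smul]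
  rw [heq]
  calc _ ≤ ∫ v, C * ‖(f s v - f t v) / (s - t) + generator lam mu β (f t) v‖ := by
        refine norm_integral_le_of_norm_le (hq.norm.const_mul C) (ae_of_all _ fun v => ?_)
        rw [norm_smul, mul_comm]
        gcongr
        exact hC v
    _ = _ := by
        rw [integral_const_mul, integral_norm_eq_eLpNorm hq]; rfl

theorem SolvesMaster.continuousOn_integral_norm (hf : SolvesMaster lam mu β f) (hβ : 0 < β) :
    ContinuousOn (fun t => ∫ v, ‖f t v‖) (Set.Ici 0) := by
  intro t ht
  have ht0 : (0 : ℝ) ≤ t := ht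
  have hgi := integrable_generator (lam := lam) (mu := mu) hβ (hf.1 t ht)
  rw [← continuousWithinAt_sdiff_self, ContinuousWithinAt, tendsto_iff_norm_sub_tendsto_zero]
  have h1 := (ENNReal.tendsto_toReal ENNReal.zero_ne_top).comp (hf.2 t ht)
  rw [ENNReal.toReal_zero] at h1
  have h2 : Tendsto (fun s : ℝ => |s - t|) (𝓝[Set.Ici 0 \ {t}] t) (𝓝 0) := by
    have : Tendsto (fun s : ℝ => |s - t|) (𝓝 t) (𝓝 |t - t|) := by
      apply Continuous.tendsto; fun_prop
    rw [sub_self, abs_zero] at this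
    exact this.mono_left nhdsWithin_le_nhds
  have h3 := h2.mul (h1.add_const (∫ v, ‖generator lam mu β (f t) v‖))
  rw [zero_mul] at h3
  refine squeeze_zero' (Eventually.of_forall fun _ => norm_nonneg _) ?_ h3
  filter_upwards [self_mem_nhdsWithin] with s hs
  have hs0 : 0 ≤ s := hs.1
  have hst : s - t ≠ 0 := sub_ne_zero.2 hs.2
  have hq : Integrable (fun v => (f s v - f t v) / (s - t) + generator lam mu β (f t) v) volume :=
    (((hf.1 s hs0).sub (hf.1 t ht)).div_const _).add hgi
  have hsub := integral_sub (hf.1 s hs0).norm (hf.1 t ht).norm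
  have hqn := (integral_norm_eq_eLpNorm hq).symm
  simp only [Function.comp_apply]
  rw [hqn, ← hsub, ← integral_add hq.norm hgi.norm, ← integral_const_mul]
  refine norm_integral_le_of_norm_le ((hq.norm.add hgi.norm).const_mul _)
    (ae_of_all _ fun v => ?_)
  refine (abs_norm_sub_norm_le (f s v) (f t v)).trans ?_
  have : f s v - f t v = (s - t) * (((f s v - f t v) / (s - t) + generator lam mu β (f t) v)
      - generator lam mu β (f t) v) := by
    field_simp; ring
  refine (congrArg norm this).trans_le ?_
  rw [norm_mul, Real.norm_eq_abs (s - t)]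
  gcongr
  exact norm_sub_le _ _

/-- Differentiability in `L¹` makes the `L¹` norm continuous in time. This supplies the crude bound
in `sup_gronwall` while positivity, and with it norm 1, is still unknown. -/
theorem SolvesMaster.exists_bound (hf : SolvesMaster lam mu β f) (hβ : 0 < β) (T : ℝ) :
    ∃ B, 0 ≤ B ∧ ∀ t ∈ Set.Icc 0 T, ∫ v, ‖f t v‖ ≤ B := by
  obtain ⟨B, hB⟩ := (isCompact_Icc (a := (0 : ℝ)) (b := T)).bddAbove_image
    ((hf.continuousOn_integral_norm hβ).mono fun x hx => hx.1)
  exact ⟨max B 0, le_max_right _ _, fun t ht =>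
    (hB (Set.mem_image_of_mem _ ht)).trans (le_max_left _ _)⟩

theorem norm_integral_smul_le {E : Type*} [NormedAddCommGroup E] [NormedSpace ℝ E]
    {g : (Fin N → ℝ) → ℝ} (hg : Integrable g volume) {Φ : (Fin N → ℝ) → E} {C : ℝ}
    (hC : ∀ v, ‖Φ v‖ ≤ C) : ‖∫ v, g v • Φ v‖ ≤ C * ∫ v, ‖g v‖ := by
  rw [← integral_const_mul]
  refine norm_integral_le_of_norm_le (hg.norm.const_mul C) (ae_of_all _ fun v => ?_)
  rw [norm_smul, mul_comm]
  gcongr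
  exact hC v

theorem jumpRate_nonneg (hlam : 0 ≤ lam) (hmu : 0 ≤ mu) (k : Jump N) :
    0 ≤ jumpRate lam mu k := by
  rcases k with p | j
  · simp only [jumpRate]; split_ifs <;> positivity
  · exact hmu

theorem integral_smul_jumpGen {E : Type*} [NormedAddCommGroup E] [NormedSpace ℝ E]
    {g : (Fin N → ℝ) → ℝ} (hg : Integrable g volume)
    {Φ : (Fin N → ℝ) → E} (hΦ : StronglyMeasurable Φ) {C : ℝ} (hC : ∀ v, ‖Φ v‖ ≤ C) :
    ∫ v, g v • jumpGen lam mu β Φ v = ∑ k : Jump N, jumpRate lam mu k •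
      ((∫ v, g v • ∫ ω, Φ (jumpMap k ω v) ∂jumpLaw β) - ∫ v, g v • Φ v) := by
  have hK := fun k => integrable_smul_of_bound hg (stronglyMeasurable_jumpAvg β k hΦ)
    (norm_jumpAvg_le β k hC)
  have hI := integrable_smul_of_bound hg hΦ hC
  simp only [jumpGen, Finset.smul_sum]
  rw [integral_finsetSum]
  · refine Finset.sum_congr rfl fun k _ => ?_
    rw [← integral_sub (hK k) hI, ← integral_smul]
    congr 1; ext v; rw [smul_comm, smul_sub (g v)]
  · intro k _
    have := ((hK k).sub hI).smul (jumpRate lam mu k)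
    refine this.congr (ae_of_all _ fun v => ?_)
    simp only [Pi.smul_apply, Pi.sub_apply]
    rw [smul_comm, smul_sub (g v)]

theorem jumpGen_const {E : Type*} [NormedAddCommGroup E] [NormedSpace ℝ E] [CompleteSpace E]
    (c : E) (v : Fin N → ℝ) : jumpGen lam mu β (fun _ => c) v = 0 := by
  simp [jumpGen]

theorem SolvesMaster.integral_eq (hf : SolvesMaster lam mu β f) (hβ : 0 < β) {t : ℝ}
    (ht : 0 ≤ t) : ∫ v, f t v = ∫ v, f 0 v := by
  have h : ∀ s, 0 ≤ s → HasDerivWithinAt (fun s => ∫ v, f s v) 0 (Set.Ici 0) s := fun s hs => by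
    have := hf.hasDerivWithinAt_integral hβ (E := ℝ) (Φ := fun _ => 1) (C := 1)
      stronglyMeasurable_const (fun _ => by simp) hs
    simpa [jumpGen_const] using this
  exact constant_of_has_deriv_right_zero (a := 0) (b := t)
    (fun s hs => ((h s hs.1).continuousWithinAt).mono fun y hy => hy.1)
    (fun s hs => (h s hs.1).mono fun y hy => le_trans hs.1 hy) t ⟨ht, le_rfl⟩

/-- The dual generator is a positive operator minus the total rate `c`. With the integrating factor
`exp (c t)` removed, the negatives of the pairings with `[0, 1]`-valued test functions form a family
whose derivatives are nonnegative combinations of its own members. It starts below 0, and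
`sup_gronwall` keeps it there. -/
theorem SolvesMaster.nonneg (hf : SolvesMaster lam mu β f) (hlam : 0 ≤ lam) (hmu : 0 ≤ mu)
    (hβ : 0 < β) (h0 : ∀ᵐ v, 0 ≤ f 0 v) {t : ℝ} (ht : 0 ≤ t) : ∀ᵐ v, 0 ≤ f t v := by
  set c : ℝ := ∑ k : Jump N, jumpRate lam mu k with hc
  have hc0 : 0 ≤ c := Finset.sum_nonneg fun k _ => jumpRate_nonneg hlam hmu k
  let X := {Φ : (Fin N → ℝ) → ℝ // StronglyMeasurable Φ ∧ ∀ v, Φ v ∈ Set.Icc (0 : ℝ) 1}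
  have hX : ∀ Φ : X, ∀ v, ‖Φ.1 v‖ ≤ 1 := fun Φ v => by
    rw [Real.norm_of_nonneg (Φ.2.2 v).1]; exact (Φ.2.2 v).2
  let K : Jump N → X → X := fun k Φ => ⟨fun v => ∫ ω, Φ.1 (jumpMap k ω v) ∂jumpLaw β,
    stronglyMeasurable_jumpAvg β k Φ.2.1, fun v =>
      ⟨integral_nonneg fun ω => (Φ.2.2 _).1, (le_abs_self _).trans (norm_jumpAvg_le β k (hX Φ) v)⟩⟩
  let I : X → ℝ → ℝ := fun Φ s => ∫ v, f s v • Φ.1 v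
  obtain ⟨B, hB0, hB⟩ := hf.exists_bound hβ t
  have key : ∀ Φ : X, -Real.exp (c * t) * I Φ t ≤ (0 + 0 * t) * Real.exp (c * t) := by
    refine sup_gronwall (X := X) (u := fun Φ s => -Real.exp (c * s) * I Φ s)
      (u' := fun Φ s => ∑ k, jumpRate lam mu k * (-Real.exp (c * s) * I (K k Φ) s))
      (B := Real.exp (c * t) * B) le_rfl (by positivity) hc0 le_rfl ?_ ?_ ?_ ?_ ⟨ht, le_rfl⟩
    · intro Φ s hs
      have h1 := hf.hasDerivWithinAt_integral hβ Φ.2.1 (hX Φ) hs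
      rw [integral_smul_jumpGen (hf.1 s hs) Φ.2.1 (hX Φ)] at h1
      have h2 : HasDerivAt (fun s => -Real.exp (c * s)) (-(Real.exp (c * s) * (c * 1))) s :=
        (((hasDerivAt_id s).const_mul c).exp).neg
      refine (h2.hasDerivWithinAt.mul h1).congr_deriv ?_
      have h3 : ∑ k, jumpRate lam mu k * (-Real.exp (c * s) * I (K k Φ) s)
          = -Real.exp (c * s) * ∑ k, jumpRate lam mu k * I (K k Φ) s := by
        rw [Finset.mul_sum]
        exact Finset.sum_congr rfl fun k _ => by ring
      have h4 : ∑ k, jumpRate lam mu k • (I (K k Φ) s - I Φ s)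
          = ∑ k, jumpRate lam mu k * I (K k Φ) s - c * I Φ s := by
        simp only [smul_eq_mul, mul_sub, Finset.sum_sub_distrib, ← Finset.sum_mul, ← hc]
      rw [h3]
      refine (congrArg₂ _ rfl (congrArg₂ _ rfl h4)).trans ?_
      simp only [I]
      ring
    · intro Φ
      have : 0 ≤ I Φ 0 := integral_nonneg_of_ae (by
        filter_upwards [h0] with v hv using mul_nonneg hv (Φ.2.2 v).1)
      simpa using this
    · intro Φ s hs
      have h1 := norm_integral_smul_le (hf.1 s hs.1) (hX Φ)
      rw [one_mul] at h1
      have h2 : -I Φ s ≤ B := (neg_le_abs _).trans (h1.trans (hB s hs))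
      calc -Real.exp (c * s) * I Φ s = Real.exp (c * s) * (-I Φ s) := by ring
        _ ≤ Real.exp (c * s) * B := by gcongr
        _ ≤ Real.exp (c * t) * B := by gcongr; exact hs.2
    · intro s _ g _ hg Φ
      rw [add_zero, show c * g = ∑ k : Jump N, jumpRate lam mu k * g by rw [hc, Finset.sum_mul]]
      exact Finset.sum_le_sum fun k _ =>
        mul_le_mul_of_nonneg_left (hg (K k Φ)) (jumpRate_nonneg hlam hmu k)
  refine ae_nonneg_of_forall_setIntegral_nonneg (hf.1 t ht) fun s hs _ => ?_
  have h1 := key ⟨s.indicator 1, stronglyMeasurable_one.indicator hs, fun v => by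
    by_cases h : v ∈ s <;> simp [h]⟩
  have h2 : ∫ v, f t v • s.indicator (1 : (Fin N → ℝ) → ℝ) v = ∫ v in s, f t v := by
    rw [← integral_indicator hs]
    congr 1; ext v
    by_cases h : v ∈ s <;> simp [h]
  have h3 := Real.exp_pos (c * t)
  simp only [I, h2] at h1
  by_contra hneg
  push Not at hneg
  nlinarith [mul_pos_of_neg_of_neg (neg_lt_zero.2 h3) hneg]

/-- The action of a permutation of the particles on the types of jumps. -/
def permJump (σ : Equiv.Perm (Fin N)) : Equiv.Perm (Jump N) :=
  Equiv.sumCongr (Equiv.prodCongr σ σ) σ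

theorem jumpRate_permJump (σ : Equiv.Perm (Fin N)) (k : Jump N) :
    jumpRate lam mu (permJump σ k) = jumpRate lam mu k := by
  rcases k with p | j
  · simp [permJump, jumpRate]
  · rfl

theorem jumpMap_permJump (σ : Equiv.Perm (Fin N)) (k : Jump N) (ω : ℝ × ℝ) (v : Fin N → ℝ) :
    (fun i => jumpMap (permJump σ k) ω v (σ i)) = jumpMap k ω (fun i => v (σ i)) := by
  rcases k with p | j
  · ext l; simp [permJump, jumpMap, collide_apply]
  · ext l; simp [permJump, jumpMap, Function.update_apply]

theorem measurable_comp_perm (σ : Equiv.Perm (Fin N)) :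
    Measurable fun (v : Fin N → ℝ) i => v (σ i) :=
  measurable_pi_lambda _ fun i => measurable_pi_apply (σ i)

theorem measurePreserving_comp_perm (σ : Equiv.Perm (Fin N)) :
    MeasurePreserving (fun (v : Fin N → ℝ) i => v (σ i)) volume volume := by
  have h := volume_measurePreserving_piCongrLeft (fun _ : Fin N => ℝ) σ.symm
  convert h using 1
  funext v i
  have := MeasurableEquiv.piCongrLeft_apply_apply (β := fun _ : Fin N => ℝ) σ.symm v (σ i)
  simpa using this.symm

/-- Symmetry of an integrable function is symmetry of its pairings with test functions. -/
theorem integral_smul_comp_perm {E : Type*} [NormedAddCommGroup E] [NormedSpace ℝ E]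
    (σ : Equiv.Perm (Fin N)) (g : (Fin N → ℝ) → ℝ) (Φ : (Fin N → ℝ) → E) :
    ∫ v : Fin N → ℝ, g (fun i => v (σ i)) • Φ (fun i => v (σ i)) = ∫ v, g v • Φ v := by
  let e : (Fin N → ℝ) ≃ᵐ (Fin N → ℝ) :=
    { toFun := fun v i => v (σ i), invFun := fun v i => v (σ.symm i)
      left_inv := fun v => by funext i; simp
      right_inv := fun v => by funext i; simp
      measurable_toFun := measurable_comp_perm σ
      measurable_invFun := measurable_comp_perm σ.symm }
  exact (show MeasurePreserving e volume volume from
    measurePreserving_comp_perm σ).integral_comp' (fun v => g v • Φ v)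

/-- Relabelling particles permutes the jumps and preserves their rates. Hence the asymmetries `∫ f
(Φ ∘ σ - Φ)`, indexed by bounded test functions `Φ`, solve a closed linear system with zero initial
data. Closure under `Φ ↦ -Φ` turns upper bounds into two-sided ones. -/
theorem SolvesMaster.symm (hf : SolvesMaster lam mu β f) (hlam : 0 ≤ lam) (hmu : 0 ≤ mu)
    (hβ : 0 < β) (σ : Equiv.Perm (Fin N)) (h0 : ∀ᵐ v, f 0 (fun i => v (σ i)) = f 0 v) {t : ℝ}
    (ht : 0 ≤ t) : ∀ᵐ v, f t (fun i => v (σ i)) = f t v := by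
  set c : ℝ := ∑ k : Jump N, jumpRate lam mu k with hc
  have hc0 : 0 ≤ c := Finset.sum_nonneg fun k _ => jumpRate_nonneg hlam hmu k
  let X := {Φ : (Fin N → ℝ) → ℝ // StronglyMeasurable Φ ∧ ∀ v, ‖Φ v‖ ≤ 1}
  let K : Jump N → X → X := fun k Φ => ⟨fun v => ∫ ω, Φ.1 (jumpMap k ω v) ∂jumpLaw β,
    stronglyMeasurable_jumpAvg β k Φ.2.1, norm_jumpAvg_le β k Φ.2.2⟩
  let n : X → X := fun Φ => ⟨fun v => -Φ.1 v, Φ.2.1.neg, fun v => by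
    rw [norm_neg]; exact Φ.2.2 v⟩
  let τ : X → X := fun Φ => ⟨fun v => Φ.1 fun i => v (σ i),
    Φ.2.1.comp_measurable (measurable_comp_perm σ), fun v => Φ.2.2 _⟩
  let I : X → ℝ → ℝ := fun Φ s => ∫ v, f s v • Φ.1 v
  let u : X → ℝ → ℝ := fun Φ s => I (τ Φ) s - I Φ s
  obtain ⟨B, hB0, hB⟩ := hf.exists_bound hβ t
  have hI : ∀ Φ : X, ∀ s ∈ Set.Icc 0 t, |I Φ s| ≤ B := fun Φ s hs => by
    have h1 := norm_integral_smul_le (hf.1 s hs.1) Φ.2.2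
    rw [one_mul] at h1
    exact h1.trans (hB s hs)
  have hun : ∀ Φ s, u (n Φ) s = -u Φ s := fun Φ s => by
    simp only [u, I, n, τ, smul_neg, integral_neg]; ring
  have hder : ∀ Φ : X, ∀ s, 0 ≤ s → HasDerivWithinAt (I Φ)
      (∑ k, jumpRate lam mu k * (I (K k Φ) s - I Φ s)) (Set.Ici 0) s := fun Φ s hs => by
    have h1 := hf.hasDerivWithinAt_integral hβ Φ.2.1 Φ.2.2 hs
    rwa [integral_smul_jumpGen (hf.1 s hs) Φ.2.1 Φ.2.2] at h1
  have hτK : ∀ (k : Jump N) (Φ : X), K (permJump σ k) (τ Φ) = τ (K k Φ) := fun k Φ => by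
    refine Subtype.ext (funext fun v => ?_)
    simp only [K, τ, jumpMap_permJump]
  have key : ∀ Φ : X, u Φ t ≤ (0 + 0 * t) * Real.exp (2 * c * t) := by
    refine sup_gronwall (X := X) (u := u)
      (u' := fun Φ s => ∑ k, jumpRate lam mu k * (u (K k Φ) s - u Φ s))
      (B := B + B) le_rfl (by positivity) (by positivity) le_rfl ?_ ?_ ?_ ?_ ⟨ht, le_rfl⟩
    · intro Φ s hs
      refine ((hder (τ Φ) s hs).sub (hder Φ s hs)).congr_deriv ?_
      rw [← Equiv.sum_comp (permJump σ)]
      simp only [jumpRate_permJump, hτK, ← Finset.sum_sub_distrib, u]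
      exact Finset.sum_congr rfl fun k _ => by ring
    · intro Φ
      have h1 := integral_smul_comp_perm σ (f 0) Φ.1
      have h2 : I (τ Φ) 0 = ∫ v : Fin N → ℝ, f 0 (fun i => v (σ i)) • Φ.1 (fun i => v (σ i)) :=
        integral_congr_ae (by filter_upwards [h0] with v hv; simp only [hv, τ])
      simp only [u, h2, h1, I, sub_self, le_refl]
    · intro Φ s hs
      have h1 := abs_le.1 (hI Φ s hs)
      have h2 := abs_le.1 (hI (τ Φ) s hs)
      simp only [u]
      linarith
    · intro s _ g _ hg Φ
      rw [add_zero, show 2 * c * g = ∑ k : Jump N, jumpRate lam mu k * (2 * g) by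
        rw [← Finset.sum_mul]; ring]
      refine Finset.sum_le_sum fun k _ =>
        mul_le_mul_of_nonneg_left ?_ (jumpRate_nonneg hlam hmu k)
      have h1 := hg (n Φ)
      rw [hun] at h1
      linarith [hg (K k Φ)]
  have key2 : ∀ Φ : X, u Φ t = 0 := fun Φ => by
    have h1 := key Φ
    have h2 := key (n Φ)
    rw [hun] at h2
    linarith
  have hint : Integrable (fun v : Fin N → ℝ => f t fun i => v (σ i)) volume :=
    ((measurePreserving_comp_perm σ).integrable_comp (hf.1 t ht).aestronglyMeasurable).2 (hf.1 t ht)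
  refine hint.ae_eq_of_forall_setIntegral_eq _ _ (hf.1 t ht) fun s hs _ => ?_
  have h2 : ∀ g : (Fin N → ℝ) → ℝ,
      ∫ v, g v • s.indicator (1 : (Fin N → ℝ) → ℝ) v = ∫ v in s, g v := fun g => by
    rw [← integral_indicator hs]
    congr 1; ext v
    by_cases h : v ∈ s <;> simp [h]
  rw [← h2, ← h2]
  let Φ : X := ⟨fun v => s.indicator 1 fun i => v (σ.symm i),
    (stronglyMeasurable_one.indicator hs).comp_measurable (measurable_comp_perm σ.symm),
    fun v => by by_cases h : (fun i => v (σ.symm i)) ∈ s <;> simp [h]⟩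
  have h3 := key2 Φ
  have h4 := integral_smul_comp_perm σ (f t) Φ.1
  simp only [u, I, τ, Φ, Equiv.apply_symm_apply, sub_eq_zero] at h3 h4
  rw [h4, ← h3]

theorem SolvesMaster.isSymmDensity (hf : SolvesMaster lam mu β f) (hlam : 0 ≤ lam) (hmu : 0 ≤ mu)
    (hβ : 0 < β) (h0 : IsSymmDensity (f 0)) {t : ℝ} (ht : 0 ≤ t) : IsSymmDensity (f t) where
  integrable := hf.1 t ht
  nonneg := hf.nonneg hlam hmu hβ h0.nonneg ht
  integral_eq_one := (hf.integral_eq hβ ht).trans h0.integral_eq_one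
  symm σ := hf.symm hlam hmu hβ σ (h0.symm σ) ht

end Solution

/-! ### Empirical characteristic functions and the limiting equation. -/

/-- The character `x ↦ exp (i ξ x)`. -/
def character (ξ x : ℝ) : ℂ := Complex.exp ((ξ * x : ℝ) * Complex.I)

theorem norm_character (ξ x : ℝ) : ‖character ξ x‖ = 1 := Complex.norm_exp_ofReal_mul_I _

theorem continuous_character : Continuous (Function.uncurry character) := by
  unfold character Function.uncurry
  fun_prop

theorem character_add (ξ x y : ℝ) : character ξ (x + y) = character ξ x * character ξ y := by
  rw [character, character, character, ← Complex.exp_add]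
  congr 1; push_cast; ring

theorem character_mul (ξ a x : ℝ) : character ξ (x * a) = character (ξ * a) x := by
  rw [character, character]; congr 2; push_cast; ring

theorem character_neg (ξ x : ℝ) : character ξ (-x) = character (-ξ) x := by
  rw [character, character]; congr 2; push_cast; ring

/-- The empirical characteristic function of a configuration. -/
def empChar {N : ℕ} (ξ : ℝ) (v : Fin N → ℝ) : ℂ := (N : ℂ)⁻¹ * ∑ j, character ξ (v j)

theorem norm_empChar_le {N : ℕ} (ξ : ℝ) (v : Fin N → ℝ) : ‖empChar ξ v‖ ≤ 1 := by
  rw [empChar, norm_mul, norm_inv, Complex.norm_natCast]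
  have h : ‖∑ j, character ξ (v j)‖ ≤ N :=
    (norm_sum_le _ _).trans (by simp [norm_character])
  rcases Nat.eq_zero_or_pos N with h0 | h0
  · subst h0; simp
  · have : (0 : ℝ) < N := by exact_mod_cast h0
    rw [inv_mul_le_iff₀ this, mul_one]
    exact h

theorem continuous_empChar {N : ℕ} :
    Continuous fun p : ℝ × (Fin N → ℝ) => empChar p.1 p.2 := by
  unfold empChar
  refine continuous_const.mul (continuous_finsetSum _ fun j _ => ?_)
  exact continuous_character.comp (continuous_fst.prodMk ((continuous_apply j).comp continuous_snd))

theorem stronglyMeasurable_empChar {N : ℕ} (ξ : ℝ) :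
    StronglyMeasurable fun v : Fin N → ℝ => empChar ξ v :=
  (continuous_empChar.comp (continuous_const.prodMk continuous_id)).stronglyMeasurable

theorem empChar_update_sub {N : ℕ} (ξ : ℝ) (v : Fin N → ℝ) (j : Fin N) (x : ℝ) :
    empChar ξ (Function.update v j x) - empChar ξ v
      = (N : ℂ)⁻¹ * (character ξ x - character ξ (v j)) := by
  rw [empChar, empChar, ← mul_sub, ← Finset.sum_sub_distrib, Finset.sum_eq_single j]
  · simp
  · intro l _ hl; simp [Function.update_of_ne hl]
  · simp

/-- The change of `N * empChar ξ` in a collision of particles with velocities `x` and `y`. -/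
def pairIncrement (ξ θ x y : ℝ) : ℂ :=
  character (ξ * Real.cos θ) x * character (ξ * Real.sin θ) y
    + character (-(ξ * Real.sin θ)) x * character (ξ * Real.cos θ) y
    - character ξ x - character ξ y

theorem norm_pairIncrement_le (ξ θ x y : ℝ) : ‖pairIncrement ξ θ x y‖ ≤ 4 := by
  unfold pairIncrement
  refine (norm_sub_le _ _).trans ?_
  have h1 := norm_sub_le (character (ξ * Real.cos θ) x * character (ξ * Real.sin θ) y
    + character (-(ξ * Real.sin θ)) x * character (ξ * Real.cos θ) y) (character ξ x)
  have h2 := norm_add_le (character (ξ * Real.cos θ) x * character (ξ * Real.sin θ) y)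
    (character (-(ξ * Real.sin θ)) x * character (ξ * Real.cos θ) y)
  simp only [norm_mul, norm_character] at h1 h2 ⊢
  linarith

theorem empChar_collide_sub {N : ℕ} (ξ θ : ℝ) (v : Fin N → ℝ) {i j : Fin N} (h : i ≠ j) :
    empChar ξ (collide i j θ v) - empChar ξ v
      = (N : ℂ)⁻¹ * pairIncrement ξ θ (v i) (v j) := by
  rw [empChar, empChar, ← mul_sub, ← Finset.sum_sub_distrib,
    Finset.sum_eq_add i j h]
  · simp only [collide_apply, h, if_true, if_false, character_add, character_mul]
    rw [character_neg, pairIncrement]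
    ring
  · intro l _ hl; simp [collide_apply, hl.1, hl.2]
  · simp
  · simp

/-- A jump of nonzero rate changes at most two velocities, hence at most two unimodular summands,
each by at most 2. -/
theorem norm_empChar_jumpMap_sub_le (lam mu : ℝ) {N : ℕ} (ξ : ℝ) (v : Fin N → ℝ) (k : Jump N)
    (ω : ℝ × ℝ) (hk : jumpRate lam mu k ≠ 0) :
    ‖empChar ξ (jumpMap k ω v) - empChar ξ v‖ ≤ 4 / N := by
  have h4 : ∀ z : ℂ, ‖z‖ ≤ 4 → ‖(N : ℂ)⁻¹ * z‖ ≤ 4 / N := fun z hz => by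
    rw [norm_mul, norm_inv, Complex.norm_natCast, div_eq_inv_mul]
    gcongr
  rcases k with ⟨i, j⟩ | j
  · have hij : i ≠ j := fun h => hk (by simp [jumpRate, h])
    simp only [jumpMap]
    rw [empChar_collide_sub ξ _ v hij]
    exact h4 _ (norm_pairIncrement_le _ _ _ _)
  · simp only [jumpMap]
    rw [empChar_update_sub]
    refine h4 _ ((norm_sub_le _ _).trans ?_)
    simp only [norm_character]
    norm_num

/-- The collision integrand of the limiting equation for the characteristic function. -/
def limitKernel (lam mu : ℝ) (h : ℝ → ℂ) (ξ : ℝ) (ω : ℝ × ℝ) : ℂ :=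
  lam * (h (ξ * Real.cos ω.2) * h (ξ * Real.sin ω.2)
      + h (-(ξ * Real.sin ω.2)) * h (ξ * Real.cos ω.2))
    + mu * (h (ξ * Real.cos ω.2) * character (ξ * Real.sin ω.2) ω.1)

/-- The right-hand side of the limiting equation for the characteristic function. -/
def limitGen (lam mu β : ℝ) (h : ℝ → ℂ) (ξ : ℝ) : ℂ :=
  (∫ ω, limitKernel lam mu h ξ ω ∂jumpLaw β) - (2 * lam + mu : ℝ) * h ξ

theorem pairRate_eq (lam : ℝ) {N : ℕ} (hN : 2 ≤ N) :
    lam * N * ((N.choose 2 : ℕ) : ℝ)⁻¹ / 2 = lam / (N - 1) := by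
  have h1 : (0 : ℝ) < N := by positivity
  have h2 : (0 : ℝ) < (N : ℝ) - 1 := by
    have : (2 : ℝ) ≤ N := by exact_mod_cast hN
    linarith
  rw [Nat.cast_choose_two]
  field_simp

theorem sum_jumpRate (lam mu : ℝ) {N : ℕ} (hN : 2 ≤ N) :
    ∑ k : Jump N, jumpRate lam mu k = (lam + mu) * N := by
  have h2 : (N : ℝ) - 1 ≠ 0 := by
    have : (2 : ℝ) ≤ N := by exact_mod_cast hN
    linarith
  have : ∀ i j : Fin N, (if i = j then (0 : ℝ) else lam / (N - 1))
      = lam / (N - 1) - if i = j then lam / (N - 1) else 0 :=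
    fun i j => by split_ifs <;> simp
  rw [Fintype.sum_sum_type, Fintype.sum_prod_type]
  simp only [jumpRate, pairRate_eq lam hN, this, Finset.sum_sub_distrib]
  simp
  field_simp

/-- Summed over all pairs, diagonal included, the pair increments factor into products of empirical
characteristic functions. The error comes from the missing diagonal and from the rate `lam / (N -
1)` in place of `lam / N`; each contributes at most `4 * lam / (N - 1)`. The bath term is exact. -/
theorem norm_jumpSum_empChar_sub_le {lam : ℝ} (mu : ℝ) (hlam : 0 ≤ lam) {N : ℕ} (hN : 2 ≤ N)
    (ξ : ℝ) (v : Fin N → ℝ) (ω : ℝ × ℝ) :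
    ‖(∑ k : Jump N, jumpRate lam mu k • (empChar ξ (jumpMap k ω v) - empChar ξ v))
      - (limitKernel lam mu (fun η => empChar η v) ξ ω - (2 * lam + mu : ℝ) * empChar ξ v)‖
      ≤ 8 * lam / (N - 1) := by
  have hN0 : (N : ℂ) ≠ 0 := by
    have : N ≠ 0 := by omega
    exact_mod_cast this
  have hN1 : (0 : ℝ) < (N : ℝ) - 1 := by
    have : (2 : ℝ) ≤ N := by exact_mod_cast hN
    linarith
  have hN1' : (N : ℂ) - 1 ≠ 0 := by
    have h := hN1.ne'
    exact_mod_cast h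
  set b : Fin N → Fin N → ℂ := fun i j => pairIncrement ξ ω.2 (v i) (v j) with hb
  set S : ℝ → ℂ := fun η => ∑ j, character η (v j) with hS
  have hSe : ∀ η, empChar η v = (N : ℂ)⁻¹ * S η := fun η => rfl
  set g : ℂ := empChar (ξ * Real.cos ω.2) v * empChar (ξ * Real.sin ω.2) v
      + empChar (-(ξ * Real.sin ω.2)) v * empChar (ξ * Real.cos ω.2) v - 2 * empChar ξ v with hg
  have hbsum : ∑ i, ∑ j, b i j = (N : ℂ) ^ 2 * g := by
    have : ∑ i, ∑ j, b i j = S (ξ * Real.cos ω.2) * S (ξ * Real.sin ω.2)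
        + S (-(ξ * Real.sin ω.2)) * S (ξ * Real.cos ω.2) - N * S ξ - N * S ξ := by
      simp only [hb, pairIncrement, Finset.sum_sub_distrib, Finset.sum_add_distrib, hS,
        Finset.sum_mul_sum]
      simp [Finset.mul_sum]
    rw [this, hg]
    simp only [hSe]
    field_simp
    ring
  have hpairs : ∑ p : Fin N × Fin N, jumpRate lam mu (Sum.inl p : Jump N) •
        (empChar ξ (jumpMap (Sum.inl p) ω v) - empChar ξ v)
      = (lam / (N - 1) : ℝ) * ((N : ℂ)⁻¹ * ((N : ℂ) ^ 2 * g - ∑ i, b i i)) := by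
    rw [Fintype.sum_prod_type, ← hbsum, ← Finset.sum_sub_distrib, Finset.mul_sum, Finset.mul_sum]
    refine Finset.sum_congr rfl fun i _ => ?_
    have : ∑ j, b i j - b i i = ∑ j, if i = j then 0 else b i j := by
      have h : ∀ j, (if i = j then (0 : ℂ) else b i j) = b i j - if i = j then b i j else 0 :=
        fun j => by split_ifs <;> simp
      simp only [h, Finset.sum_sub_distrib]
      simp
    rw [this, Finset.mul_sum, Finset.mul_sum]
    refine Finset.sum_congr rfl fun j _ => ?_
    simp only [jumpRate, jumpMap, pairRate_eq lam hN]
    split_ifs with h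
    · simp
    · rw [empChar_collide_sub ξ _ v h, Complex.real_smul]
  have hbath : ∑ j : Fin N, jumpRate lam mu (Sum.inr j : Jump N) •
        (empChar ξ (jumpMap (Sum.inr j) ω v) - empChar ξ v)
      = mu * (empChar (ξ * Real.cos ω.2) v * character (ξ * Real.sin ω.2) ω.1
        - empChar ξ v) := by
    have : ∀ j, jumpRate lam mu (Sum.inr j : Jump N) •
        (empChar ξ (jumpMap (Sum.inr j) ω v) - empChar ξ v)
        = mu * ((N : ℂ)⁻¹ * (character (ξ * Real.cos ω.2) (v j)
          * character (ξ * Real.sin ω.2) ω.1 - character ξ (v j))) := fun j => by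
      simp only [jumpRate, jumpMap]
      rw [empChar_update_sub, character_add, character_mul, character_mul, Complex.real_smul]
    rw [Finset.sum_congr rfl fun j _ => this j]
    simp only [← Finset.mul_sum, Finset.sum_sub_distrib, hSe, hS, ← Finset.sum_mul]
    ring
  -- With both sums evaluated, the error is an identity, before any estimate.
  have hkey : (∑ k : Jump N, jumpRate lam mu k • (empChar ξ (jumpMap k ω v) - empChar ξ v))
      - (limitKernel lam mu (fun η => empChar η v) ξ ω - (2 * lam + mu : ℝ) * empChar ξ v)
      = (lam / (N - 1) : ℝ) * (g - (N : ℂ)⁻¹ * ∑ i, b i i) := by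
    rw [Fintype.sum_sum_type, hpairs, hbath, limitKernel, hg]
    push_cast
    field_simp
    ring
  rw [hkey, norm_mul, Complex.norm_real, Real.norm_of_nonneg (by positivity)]
  have h1 : ‖g‖ ≤ 4 := by
    have e := fun η => norm_empChar_le η v
    have hm : ∀ a b : ℂ, ‖a‖ ≤ 1 → ‖b‖ ≤ 1 → ‖a * b‖ ≤ 1 := fun a b ha hb => by
      rw [norm_mul]; exact mul_le_one₀ ha (norm_nonneg _) hb
    rw [hg]
    refine (norm_sub_le _ _).trans ?_
    have h2 : ‖2 * empChar ξ v‖ ≤ 2 := by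
      rw [norm_mul]; simpa using mul_le_mul_of_nonneg_left (e ξ) (by norm_num : (0 : ℝ) ≤ 2)
    have h3 := (norm_add_le _ _).trans (add_le_add (hm _ _ (e (ξ * Real.cos ω.2))
      (e (ξ * Real.sin ω.2))) (hm _ _ (e (-(ξ * Real.sin ω.2))) (e (ξ * Real.cos ω.2))))
    linarith
  have h2 : ‖(N : ℂ)⁻¹ * ∑ i, b i i‖ ≤ 4 := by
    rw [norm_mul, norm_inv, Complex.norm_natCast, inv_mul_le_iff₀ (by positivity)]
    refine (norm_sum_le _ _).trans ((Finset.sum_le_sum fun i _ =>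
      norm_pairIncrement_le _ _ _ _).trans ?_)
    simp
  have h3 := (norm_sub_le g ((N : ℂ)⁻¹ * ∑ i, b i i)).trans (add_le_add h1 h2)
  calc _ ≤ lam / (N - 1) * (4 + 4) := by gcongr
    _ = _ := by ring

theorem integrable_limitKernel (lam mu β : ℝ) {h : ℝ → ℂ} (hm : Measurable h)
    (h1 : ∀ η, ‖h η‖ ≤ 1) (ξ : ℝ) : Integrable (limitKernel lam mu h ξ) (jumpLaw β) := by
  have hb : ∀ ω, ‖limitKernel lam mu h ξ ω‖ ≤ |lam| * (1 + 1) + |mu| * 1 := fun ω => by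
    have hmul : ∀ a b : ℂ, ‖a‖ ≤ 1 → ‖b‖ ≤ 1 → ‖a * b‖ ≤ 1 := fun a b ha hb => by
      rw [norm_mul]; exact mul_le_one₀ ha (norm_nonneg _) hb
    unfold limitKernel
    refine (norm_add_le _ _).trans ?_
    rw [norm_mul, norm_mul (mu : ℂ), Complex.norm_real, Complex.norm_real, Real.norm_eq_abs,
      Real.norm_eq_abs]
    gcongr
    · exact (norm_add_le _ _).trans (add_le_add (hmul _ _ (h1 _) (h1 _)) (hmul _ _ (h1 _) (h1 _)))
    · exact hmul _ _ (h1 _) (norm_character _ _).le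
  refine Integrable.of_bound (C := |lam| * (1 + 1) + |mu| * 1) ?_ (ae_of_all _ hb)
  refine Measurable.aestronglyMeasurable ?_
  have hc : Measurable fun ω : ℝ × ℝ => character (ξ * Real.sin ω.2) ω.1 :=
    (continuous_character.comp (f := fun ω : ℝ × ℝ => (ξ * Real.sin ω.2, ω.1))
      (by fun_prop)).measurable
  unfold limitKernel
  fun_prop

theorem jumpGen_empChar_sub_le {lam mu : ℝ} (β : ℝ) (hlam : 0 ≤ lam) {N : ℕ} (hN : 2 ≤ N)
    (ξ : ℝ) (v : Fin N → ℝ) :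
    ‖jumpGen lam mu β (empChar ξ) v - limitGen lam mu β (fun η => empChar η v) ξ‖
      ≤ 8 * lam / (N - 1) := by
  have hI : ∀ k : Jump N, Integrable (fun ω => empChar ξ (jumpMap k ω v)) (jumpLaw β) := fun k =>
    integrable_comp_jumpMap β k (stronglyMeasurable_empChar ξ) (norm_empChar_le ξ) v
  have hI2 : ∀ k : Jump N, Integrable (fun ω => jumpRate lam mu k •
      (empChar ξ (jumpMap k ω v) - empChar ξ v)) (jumpLaw β) := fun k =>
    ((hI k).sub (integrable_const _)).smul (jumpRate lam mu k)
  have h1 : jumpGen lam mu β (empChar ξ) v = ∫ ω, (∑ k : Jump N, jumpRate lam mu k •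
      (empChar ξ (jumpMap k ω v) - empChar ξ v)) ∂jumpLaw β := by
    rw [integral_finsetSum _ fun k _ => hI2 k, jumpGen]
    refine Finset.sum_congr rfl fun k _ => ?_
    rw [integral_smul, integral_sub (hI k) (integrable_const _)]
    simp
  have hm : Measurable fun η => empChar η v :=
    (continuous_empChar.comp (continuous_id.prodMk continuous_const)).measurable
  have hK := integrable_limitKernel lam mu β hm (fun η => norm_empChar_le η v) ξ
  have h2 : limitGen lam mu β (fun η => empChar η v) ξ
      = ∫ ω, (limitKernel lam mu (fun η => empChar η v) ξ ω
        - (2 * lam + mu : ℝ) * empChar ξ v) ∂jumpLaw β := by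
    rw [integral_sub hK (integrable_const _), limitGen]
    simp
  have hK2 : Integrable (fun ω => limitKernel lam mu (fun η => empChar η v) ξ ω
        - (2 * lam + mu : ℝ) * empChar ξ v) (jumpLaw β) := hK.sub (integrable_const _)
  rw [h1, h2, ← integral_sub (integrable_finsetSum _ fun k _ => hI2 k) hK2]
  have := norm_integral_le_of_norm_le_const (μ := jumpLaw β)
    (ae_of_all _ fun ω => norm_jumpSum_empChar_sub_le mu hlam hN ξ v ω)
  simpa using this

/-- The bound on the difference of `limitGen` at two functions at distance `d`. -/
def limitGenDist (lam mu β : ℝ) (d : ℝ → ℝ) (ξ : ℝ) : ℝ :=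
  lam * (2 * (∫ ω : ℝ × ℝ, d (ξ * Real.cos ω.2) ∂jumpLaw β)
      + (∫ ω : ℝ × ℝ, d (ξ * Real.sin ω.2) ∂jumpLaw β)
      + ∫ ω : ℝ × ℝ, d (-(ξ * Real.sin ω.2)) ∂jumpLaw β)
    + mu * (∫ ω : ℝ × ℝ, d (ξ * Real.cos ω.2) ∂jumpLaw β) + (2 * lam + mu) * d ξ

/-- The quadratic term is Lipschitz because both functions are bounded by 1: a difference of
products is at most the sum of the differences of the factors. -/
theorem norm_limitGen_sub_le {lam mu : ℝ} (β : ℝ) (hlam : 0 ≤ lam) (hmu : 0 ≤ mu) {h k : ℝ → ℂ}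
    (hm : Measurable h) (km : Measurable k) (h1 : ∀ η, ‖h η‖ ≤ 1) (k1 : ∀ η, ‖k η‖ ≤ 1) (ξ : ℝ) :
    ‖limitGen lam mu β h ξ - limitGen lam mu β k ξ‖
      ≤ limitGenDist lam mu β (fun η => ‖h η - k η‖) ξ := by
  set d : ℝ → ℝ := fun η => ‖h η - k η‖ with hd
  have hdm : Measurable d := (hm.sub km).norm
  have hI : ∀ η : ℝ × ℝ → ℝ, Measurable η → Integrable (fun ω => d (η ω)) (jumpLaw β) :=
    fun η hη => Integrable.of_bound (C := 1 + 1) (hdm.comp hη).aestronglyMeasurable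
      (ae_of_all _ fun ω => by
        rw [Real.norm_of_nonneg (norm_nonneg _)]
        exact (norm_sub_le _ _).trans (add_le_add (h1 _) (k1 _)))
  have hc := hI (fun ω => ξ * Real.cos ω.2) (by fun_prop)
  have hs := hI (fun ω => ξ * Real.sin ω.2) (by fun_prop)
  have hn := hI (fun ω => -(ξ * Real.sin ω.2)) (by fun_prop)
  have hprod : ∀ a b : ℝ, ‖h a * h b - k a * k b‖ ≤ d a + d b := fun a b => by
    have : h a * h b - k a * k b = (h a - k a) * h b + k a * (h b - k b) := by ring
    rw [this]
    refine (norm_add_le _ _).trans ?_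
    rw [norm_mul, norm_mul]
    exact add_le_add (mul_le_of_le_one_right (norm_nonneg _) (h1 b))
      (mul_le_of_le_one_left (norm_nonneg _) (k1 a))
  have hker : ∀ ω, ‖limitKernel lam mu h ξ ω - limitKernel lam mu k ξ ω‖
      ≤ lam * (2 * d (ξ * Real.cos ω.2) + d (ξ * Real.sin ω.2) + d (-(ξ * Real.sin ω.2)))
        + mu * d (ξ * Real.cos ω.2) := fun ω => by
    have : limitKernel lam mu h ξ ω - limitKernel lam mu k ξ ω
        = lam * ((h (ξ * Real.cos ω.2) * h (ξ * Real.sin ω.2)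
            - k (ξ * Real.cos ω.2) * k (ξ * Real.sin ω.2))
          + (h (-(ξ * Real.sin ω.2)) * h (ξ * Real.cos ω.2)
            - k (-(ξ * Real.sin ω.2)) * k (ξ * Real.cos ω.2)))
        + mu * ((h (ξ * Real.cos ω.2) - k (ξ * Real.cos ω.2))
          * character (ξ * Real.sin ω.2) ω.1) := by
      simp only [limitKernel]; ring
    rw [this]
    refine (norm_add_le _ _).trans ?_
    rw [norm_mul, norm_mul (mu : ℂ), norm_mul (h (ξ * Real.cos ω.2) - k (ξ * Real.cos ω.2)),
      norm_character, mul_one, Complex.norm_real, Complex.norm_real,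
      Real.norm_of_nonneg hlam, Real.norm_of_nonneg hmu]
    gcongr
    refine (norm_add_le _ _).trans ?_
    linarith [hprod (ξ * Real.cos ω.2) (ξ * Real.sin ω.2),
      hprod (-(ξ * Real.sin ω.2)) (ξ * Real.cos ω.2)]
  have hhI := integrable_limitKernel lam mu β hm h1 ξ
  have hkI := integrable_limitKernel lam mu β km k1 ξ
  have hint : ‖(∫ ω, limitKernel lam mu h ξ ω ∂jumpLaw β) - ∫ ω, limitKernel lam mu k ξ ω ∂jumpLaw β‖
      ≤ lam * (2 * (∫ ω : ℝ × ℝ, d (ξ * Real.cos ω.2) ∂jumpLaw β)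
      + (∫ ω : ℝ × ℝ, d (ξ * Real.sin ω.2) ∂jumpLaw β)
      + ∫ ω : ℝ × ℝ, d (-(ξ * Real.sin ω.2)) ∂jumpLaw β)
    + mu * (∫ ω : ℝ × ℝ, d (ξ * Real.cos ω.2) ∂jumpLaw β) := by
    have hA := hc.const_mul 2
    have hB : Integrable (fun ω : ℝ × ℝ => 2 * d (ξ * Real.cos ω.2) + d (ξ * Real.sin ω.2))
      (jumpLaw β) := hA.add hs
    have hC : Integrable (fun ω : ℝ × ℝ => 2 * d (ξ * Real.cos ω.2) + d (ξ * Real.sin ω.2)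
      + d (-(ξ * Real.sin ω.2))) (jumpLaw β) := hB.add hn
    rw [← integral_sub hhI hkI]
    refine (norm_integral_le_of_norm_le ((hC.const_mul lam).add (hc.const_mul mu))
      (ae_of_all _ hker)).trans (le_of_eq ?_)
    refine (integral_add (hC.const_mul lam) (hc.const_mul mu)).trans ?_
    rw [integral_const_mul, integral_const_mul,
      integral_add hB hn, integral_add hA hs, integral_const_mul]
  have hlast : ‖((2 * lam + mu : ℝ) : ℂ) * h ξ - ((2 * lam + mu : ℝ) : ℂ) * k ξ‖
      = (2 * lam + mu) * d ξ := by
    rw [← mul_sub, norm_mul, Complex.norm_real, Real.norm_of_nonneg (by positivity)]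
  unfold limitGen limitGenDist
  rw [sub_sub_sub_comm]
  refine (norm_sub_le _ _).trans ?_
  rw [hlast]
  gcongr

/-- The frequencies `ξ cos θ` and `± ξ sin θ` are no larger than `ξ`, so the window `|η| ≤ ρ` is
closed under the equation. This is what lets Grönwall run on one fixed window. -/
theorem limitGenDist_le {lam mu : ℝ} (β : ℝ) (hlam : 0 ≤ lam) (hmu : 0 ≤ mu) {d : ℝ → ℝ}
    {ρ g ξ : ℝ} (hξ : |ξ| ≤ ρ) (hd0 : ∀ η, 0 ≤ d η) (hd : ∀ η, |η| ≤ ρ → d η ≤ g) :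
    limitGenDist lam mu β d ξ ≤ (6 * lam + 2 * mu) * g := by
  have h : ∀ η : ℝ × ℝ → ℝ, (∀ ω, |η ω| ≤ |ξ|) → ∫ ω, d (η ω) ∂jumpLaw β ≤ g := fun η hη => by
    have := norm_integral_le_of_norm_le_const (μ := jumpLaw β) (f := fun ω => d (η ω)) (C := g)
      (ae_of_all _ fun ω => by
        rw [Real.norm_of_nonneg (hd0 _)]; exact hd _ ((hη ω).trans hξ))
    simp only [probReal_univ, mul_one] at this
    exact (le_abs_self _).trans this
  have hc := h (fun ω => ξ * Real.cos ω.2) fun ω => by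
    rw [abs_mul]; exact mul_le_of_le_one_right (abs_nonneg _) (Real.abs_cos_le_one _)
  have hs := h (fun ω => ξ * Real.sin ω.2) fun ω => by
    rw [abs_mul]; exact mul_le_of_le_one_right (abs_nonneg _) (Real.abs_sin_le_one _)
  have hn := h (fun ω => -(ξ * Real.sin ω.2)) fun ω => by
    rw [abs_neg, abs_mul]; exact mul_le_of_le_one_right (abs_nonneg _) (Real.abs_sin_le_one _)
  unfold limitGenDist
  calc _ ≤ lam * (2 * g + g + g) + mu * g + (2 * lam + mu) * g := by
        gcongr
        exact hd _ hξ
    _ = _ := by ring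

/-! ### Means and deviations under a probability law. -/

/-- The mean of the empirical characteristic function. -/
def meanChar {N : ℕ} (P : Measure (Fin N → ℝ)) (ξ : ℝ) : ℂ := ∫ v, empChar ξ v ∂P

/-- The mean square deviation of the empirical characteristic function from its mean. -/
def devChar {N : ℕ} (P : Measure (Fin N → ℝ)) (ξ : ℝ) : ℝ :=
  ∫ v, ‖empChar ξ v - meanChar P ξ‖ ^ 2 ∂P

/-- Curves of probability measures which solve the weak form of the master equation. -/
structure IsJumpFlow (lam mu β : ℝ) {N : ℕ} (P : ℝ → Measure (Fin N → ℝ)) : Prop where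
  prob : ∀ t, 0 ≤ t → IsProbabilityMeasure (P t)
  deriv : ∀ {E : Type} [NormedAddCommGroup E] [NormedSpace ℝ E] [CompleteSpace E]
    {Φ : (Fin N → ℝ) → E} (_ : StronglyMeasurable Φ) {C : ℝ} (_ : ∀ v, ‖Φ v‖ ≤ C) {t : ℝ}
    (_ : 0 ≤ t), HasDerivWithinAt (fun s => ∫ v, Φ v ∂P s) (∫ v, jumpGen lam mu β Φ v ∂P t)
      (Set.Ici 0) t

section Statistics

variable {N : ℕ} (P : Measure (Fin N → ℝ)) [IsProbabilityMeasure P]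

theorem integrable_of_norm_le {X E : Type*} [MeasurableSpace X] {μ : Measure X}
    [IsFiniteMeasure μ] [NormedAddCommGroup E] {Φ : X → E} (hΦ : StronglyMeasurable Φ) {C : ℝ}
    (hC : ∀ v, ‖Φ v‖ ≤ C) : Integrable Φ μ :=
  Integrable.of_bound (C := C) hΦ.aestronglyMeasurable (ae_of_all _ hC)

theorem integrable_empChar (ξ : ℝ) : Integrable (empChar ξ) P :=
  integrable_of_norm_le (stronglyMeasurable_empChar ξ) (norm_empChar_le ξ)

theorem norm_meanChar_le (ξ : ℝ) : ‖meanChar P ξ‖ ≤ 1 := by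
  simpa [meanChar] using
    norm_integral_le_of_norm_le_const (μ := P) (ae_of_all _ (norm_empChar_le ξ))

theorem measurable_meanChar : Measurable (meanChar P) :=
  (StronglyMeasurable.integral_prod_right'
    (f := fun p : ℝ × (Fin N → ℝ) => empChar p.1 p.2)
      continuous_empChar.stronglyMeasurable).measurable

theorem norm_empChar_sub_meanChar_le (ξ : ℝ) (v : Fin N → ℝ) :
    ‖empChar ξ v - meanChar P ξ‖ ≤ 2 :=
  (norm_sub_le _ _).trans (by linarith [norm_empChar_le ξ v, norm_meanChar_le P ξ])

theorem stronglyMeasurable_norm_empChar_sub :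
    StronglyMeasurable fun p : ℝ × (Fin N → ℝ) => ‖empChar p.1 p.2 - meanChar P p.1‖ :=
  (continuous_empChar.stronglyMeasurable.sub
    ((measurable_meanChar P).stronglyMeasurable.comp_measurable measurable_fst)).norm

theorem stronglyMeasurable_norm_empChar_sub_apply {N : ℕ} (P : Measure (Fin N → ℝ)) (ξ : ℝ) :
    StronglyMeasurable fun v : Fin N → ℝ => ‖empChar ξ v - meanChar P ξ‖ :=
  ((stronglyMeasurable_empChar ξ).sub stronglyMeasurable_const).norm

theorem integrable_norm_empChar_sub (ξ : ℝ) :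
    Integrable (fun v => ‖empChar ξ v - meanChar P ξ‖) P :=
  integrable_of_norm_le (stronglyMeasurable_norm_empChar_sub_apply P ξ) (C := 2) fun v => by
    rw [norm_norm]; exact norm_empChar_sub_meanChar_le P ξ v

theorem integrable_norm_empChar_sub_mul (ξ η : ℝ) :
    Integrable (fun v => ‖empChar ξ v - meanChar P ξ‖ * ‖empChar η v - meanChar P η‖) P :=
  integrable_of_norm_le ((stronglyMeasurable_norm_empChar_sub_apply P ξ).mul
    (stronglyMeasurable_norm_empChar_sub_apply P η)) (C := 2 * 2) fun v => by
    rw [norm_mul, norm_norm, norm_norm]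
    gcongr <;> exact norm_empChar_sub_meanChar_le P _ v

theorem integrable_norm_empChar_sub_sq (ξ : ℝ) :
    Integrable (fun v => ‖empChar ξ v - meanChar P ξ‖ ^ 2) P := by
  simpa only [sq] using integrable_norm_empChar_sub_mul P ξ ξ

theorem devChar_le (ξ : ℝ) : devChar P ξ ≤ 4 := by
  have h := norm_integral_le_of_norm_le_const (μ := P)
    (f := fun v => ‖empChar ξ v - meanChar P ξ‖ ^ 2) (C := 4) (ae_of_all _ fun v => by
      rw [norm_pow, norm_norm]
      have := norm_empChar_sub_meanChar_le P ξ v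
      nlinarith [norm_nonneg (empChar ξ v - meanChar P ξ)])
  simp only [probReal_univ, mul_one] at h
  exact (le_abs_self _).trans h

/-- From `2 a b ≤ a² + b²`. Products of deviations at different frequencies are thus controlled
linearly by the largest variance, so that its differential inequality is linear. -/
theorem integral_norm_empChar_sub_mul_le {g ξ η : ℝ} (hξ : devChar P ξ ≤ g)
    (hη : devChar P η ≤ g) :
    ∫ v, ‖empChar ξ v - meanChar P ξ‖ * ‖empChar η v - meanChar P η‖ ∂P ≤ g := by
  have h : ∫ v, ‖empChar ξ v - meanChar P ξ‖ * ‖empChar η v - meanChar P η‖ ∂P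
      ≤ ∫ v, (2⁻¹ * ‖empChar ξ v - meanChar P ξ‖ ^ 2
        + 2⁻¹ * ‖empChar η v - meanChar P η‖ ^ 2) ∂P := by
    refine integral_mono (integrable_norm_empChar_sub_mul P ξ η)
      (((integrable_norm_empChar_sub_sq P ξ).const_mul _).add
        ((integrable_norm_empChar_sub_sq P η).const_mul _)) fun v => ?_
    dsimp only
    nlinarith [sq_nonneg (‖empChar ξ v - meanChar P ξ‖ - ‖empChar η v - meanChar P η‖)]
  rw [integral_add ((integrable_norm_empChar_sub_sq P ξ).const_mul _)
        ((integrable_norm_empChar_sub_sq P η).const_mul _), integral_const_mul,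
    integral_const_mul] at h
  unfold devChar at hξ hη
  linarith

/-- The variance of the modulus of the deviation is nonnegative. -/
theorem integral_norm_empChar_sub_le {g ξ : ℝ} (hξ : devChar P ξ ≤ g) :
    ∫ v, ‖empChar ξ v - meanChar P ξ‖ ∂P ≤ √g := by
  set a := ∫ v, ‖empChar ξ v - meanChar P ξ‖ ∂P with ha
  have h1 : 0 ≤ ∫ v, (‖empChar ξ v - meanChar P ξ‖ - a) ^ 2 ∂P :=
    integral_nonneg fun _ => by positivity
  have h2 : ∫ v, (‖empChar ξ v - meanChar P ξ‖ - a) ^ 2 ∂P = devChar P ξ - a ^ 2 := by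
    have e1 : ∀ v : Fin N → ℝ, (‖empChar ξ v - meanChar P ξ‖ - a) ^ 2
        = ‖empChar ξ v - meanChar P ξ‖ ^ 2 - (2 * a) * ‖empChar ξ v - meanChar P ξ‖ + a ^ 2 :=
      fun v => by ring
    have e2 := (integrable_norm_empChar_sub P ξ).const_mul (2 * a)
    simp only [e1]
    have e3 : Integrable (fun v => ‖empChar ξ v - meanChar P ξ‖ ^ 2
        - (2 * a) * ‖empChar ξ v - meanChar P ξ‖) P := (integrable_norm_empChar_sub_sq P ξ).sub e2
    rw [integral_add e3 (integrable_const _),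
      integral_sub (integrable_norm_empChar_sub_sq P ξ) e2, integral_const_mul, ← ha, devChar]
    simp
    ring
  exact Real.le_sqrt_of_sq_le (by linarith)

theorem devChar_eq (ξ : ℝ) :
    devChar P ξ = (∫ v, ‖empChar ξ v‖ ^ 2 ∂P) - ‖meanChar P ξ‖ ^ 2 := by
  have hsq : Integrable (fun v => ‖empChar ξ v‖ ^ 2) P :=
    integrable_of_norm_le ((stronglyMeasurable_empChar ξ).norm.pow 2) (C := 1) fun v => by
      rw [norm_pow, norm_norm]; exact pow_le_one₀ (norm_nonneg _) (norm_empChar_le ξ v)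
  have hin : Integrable (fun v => inner ℝ (meanChar P ξ) (empChar ξ v)) P :=
    (integrable_empChar P ξ).const_inner _
  have e : ∀ v : Fin N → ℝ, ‖empChar ξ v - meanChar P ξ‖ ^ 2
      = ‖empChar ξ v‖ ^ 2 - 2 * inner ℝ (meanChar P ξ) (empChar ξ v) + ‖meanChar P ξ‖ ^ 2 :=
    fun v => by rw [norm_sub_sq_real, real_inner_comm]
  unfold devChar
  simp only [e]
  have e3 : Integrable (fun v => ‖empChar ξ v‖ ^ 2
      - 2 * inner ℝ (meanChar P ξ) (empChar ξ v)) P := hsq.sub (hin.const_mul 2)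
  rw [integral_add e3 (integrable_const _),
    integral_sub hsq (hin.const_mul 2), integral_const_mul,
    integral_inner (integrable_empChar P ξ), ← meanChar, real_inner_self_eq_norm_sq]
  simp
  ring

/-- Fubini: an upper bound on weighted mean deviations, uniform over frequencies in `[-ρ, ρ]`,
bounds the weighted mean of `limitGenDist`. -/
theorem integral_mul_limitGenDist_le {lam mu : ℝ} (β : ℝ) (hlam : 0 ≤ lam) (hmu : 0 ≤ mu)
    {w : (Fin N → ℝ) → ℝ} (hw : StronglyMeasurable w) {C : ℝ} (hC : ∀ v, ‖w v‖ ≤ C)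
    {ρ g ξ : ℝ} (hξ : |ξ| ≤ ρ)
    (hg : ∀ η, |η| ≤ ρ → ∫ v, w v * ‖empChar η v - meanChar P η‖ ∂P ≤ g) :
    Integrable (fun v => w v *
      limitGenDist lam mu β (fun η => ‖empChar η v - meanChar P η‖) ξ) P ∧
    ∫ v, w v * limitGenDist lam mu β (fun η => ‖empChar η v - meanChar P η‖) ξ ∂P
      ≤ (6 * lam + 2 * mu) * g := by
  set d : (Fin N → ℝ) → ℝ → ℝ := fun v η => ‖empChar η v - meanChar P η‖ with hd
  have hC0 : 0 ≤ C := (norm_nonneg _).trans (hC 0)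
  have hI : ∀ η : ℝ × ℝ → ℝ, Measurable η →
      Integrable (fun p : (Fin N → ℝ) × (ℝ × ℝ) => w p.1 * d p.1 (η p.2))
        (P.prod (jumpLaw β)) := fun η hη => by
    have h1 : StronglyMeasurable fun p : (Fin N → ℝ) × (ℝ × ℝ) => d p.1 (η p.2) :=
      StronglyMeasurable.comp_measurable
        (f := fun p : ℝ × (Fin N → ℝ) => ‖empChar p.1 p.2 - meanChar P p.1‖)
        (g := fun p : (Fin N → ℝ) × (ℝ × ℝ) => (η p.2, p.1))
        (stronglyMeasurable_norm_empChar_sub P)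
        ((hη.comp measurable_snd).prodMk measurable_fst)
    have h2 : StronglyMeasurable fun p : (Fin N → ℝ) × (ℝ × ℝ) => w p.1 :=
      StronglyMeasurable.comp_measurable (f := w)
        (g := fun p : (Fin N → ℝ) × (ℝ × ℝ) => p.1) hw measurable_fst
    have h3 : ∀ p : (Fin N → ℝ) × (ℝ × ℝ), ‖w p.1 * d p.1 (η p.2)‖ ≤ C * 2 := fun p => by
      rw [norm_mul, norm_norm]
      gcongr
      · exact hC _
      · exact norm_empChar_sub_meanChar_le P _ _
    exact integrable_of_norm_le (h2.mul h1) h3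
  have hswap : ∀ η : ℝ × ℝ → ℝ, Measurable η → (∀ ω, |η ω| ≤ |ξ|) →
      Integrable (fun v => w v * ∫ ω, d v (η ω) ∂jumpLaw β) P ∧
      ∫ v, w v * ∫ ω, d v (η ω) ∂jumpLaw β ∂P ≤ g := fun η hη hle => by
    have hJ : Integrable (Function.uncurry fun v ω => w v * d v (η ω)) (P.prod (jumpLaw β)) :=
      hI η hη
    have h1 : Integrable (fun v => ∫ ω, w v * d v (η ω) ∂jumpLaw β) P := hJ.integral_prod_left
    have h2 : ∫ v, ∫ ω, w v * d v (η ω) ∂jumpLaw β ∂P = ∫ ω, ∫ v, w v * d v (η ω) ∂P ∂jumpLaw β :=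
      integral_integral_swap hJ
    have h3 : Integrable (fun ω => ∫ v, w v * d v (η ω) ∂P) (jumpLaw β) := hJ.integral_prod_right
    have h4 : ∀ v, ∫ ω, w v * d v (η ω) ∂jumpLaw β = w v * ∫ ω, d v (η ω) ∂jumpLaw β :=
      fun v => integral_const_mul _ _
    have h5 : ∫ ω, ∫ v, w v * d v (η ω) ∂P ∂jumpLaw β ≤ ∫ _ω : ℝ × ℝ, g ∂jumpLaw β :=
      integral_mono h3 (integrable_const _) fun ω => hg _ ((hle ω).trans hξ)
    simp only [h4] at h1 h2
    rw [integral_const, probReal_univ, one_smul] at h5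
    exact ⟨h1, h2.trans_le h5⟩
  have hc := hswap (fun ω => ξ * Real.cos ω.2) (by fun_prop) fun ω => by
    rw [abs_mul]; exact mul_le_of_le_one_right (abs_nonneg _) (Real.abs_cos_le_one _)
  have hs := hswap (fun ω => ξ * Real.sin ω.2) (by fun_prop) fun ω => by
    rw [abs_mul]; exact mul_le_of_le_one_right (abs_nonneg _) (Real.abs_sin_le_one _)
  have hn := hswap (fun ω => -(ξ * Real.sin ω.2)) (by fun_prop) fun ω => by
    rw [abs_neg, abs_mul]; exact mul_le_of_le_one_right (abs_nonneg _) (Real.abs_sin_le_one _)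
  have hid : Integrable (fun v => w v * d v ξ) P :=
    integrable_of_norm_le (hw.mul (stronglyMeasurable_norm_empChar_sub_apply P ξ)) (C := C * 2)
      fun v => by
        rw [norm_mul, norm_norm]
        gcongr
        · exact hC _
        · exact norm_empChar_sub_meanChar_le P _ _
  have e : (fun v => w v * limitGenDist lam mu β (d v) ξ) = fun v =>
      (2 * lam + mu) * (w v * ∫ ω, d v (ξ * Real.cos ω.2) ∂jumpLaw β)
      + lam * (w v * ∫ ω, d v (ξ * Real.sin ω.2) ∂jumpLaw β)
      + lam * (w v * ∫ ω, d v (-(ξ * Real.sin ω.2)) ∂jumpLaw β)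
      + (2 * lam + mu) * (w v * d v ξ) := by
    ext v; unfold limitGenDist; ring
  have i1 := hc.1.const_mul (2 * lam + mu)
  have i2 : Integrable (fun v => (2 * lam + mu) * (w v * ∫ ω, d v (ξ * Real.cos ω.2) ∂jumpLaw β)
      + lam * (w v * ∫ ω, d v (ξ * Real.sin ω.2) ∂jumpLaw β)) P := i1.add (hs.1.const_mul lam)
  have i3 : Integrable (fun v => (2 * lam + mu) * (w v * ∫ ω, d v (ξ * Real.cos ω.2) ∂jumpLaw β)
      + lam * (w v * ∫ ω, d v (ξ * Real.sin ω.2) ∂jumpLaw β)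
      + lam * (w v * ∫ ω, d v (-(ξ * Real.sin ω.2)) ∂jumpLaw β)) P := i2.add (hn.1.const_mul lam)
  have i4 := hid.const_mul (2 * lam + mu)
  rw [e]
  refine ⟨i3.add i4, ?_⟩
  rw [integral_add i3 i4, integral_add i2 (hn.1.const_mul lam),
    integral_add i1 (hs.1.const_mul lam), integral_const_mul, integral_const_mul,
    integral_const_mul, integral_const_mul]
  have h1 := hc.2
  have h2 := hs.2
  have h3 := hn.2
  have h4 := hg ξ hξ
  calc _ ≤ (2 * lam + mu) * g + lam * g + lam * g + (2 * lam + mu) * g := by gcongr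
    _ = _ := by ring

end Statistics

/-! ### Differential inequalities for variances and means along the flow. -/

section Flow

variable {lam mu β : ℝ} {N : ℕ} {P : ℝ → Measure (Fin N → ℝ)}

theorem stronglyMeasurable_jumpGen_empChar (ξ : ℝ) :
    StronglyMeasurable (jumpGen (N := N) lam mu β (empChar ξ)) :=
  stronglyMeasurable_jumpGen lam mu β (stronglyMeasurable_empChar ξ)

theorem norm_jumpGen_le {E : Type*} [NormedAddCommGroup E] [NormedSpace ℝ E]
    {Φ : (Fin N → ℝ) → E} {C : ℝ} (hC : ∀ v, ‖Φ v‖ ≤ C) (v : Fin N → ℝ) :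
    ‖jumpGen lam mu β Φ v‖ ≤ ∑ k : Jump N, |jumpRate lam mu k| * (C + C) := by
  unfold jumpGen
  refine (norm_sum_le _ _).trans (Finset.sum_le_sum fun k _ => ?_)
  rw [norm_smul, Real.norm_eq_abs]
  gcongr
  exact (norm_sub_le _ _).trans (add_le_add (norm_jumpAvg_le β k hC v) (hC v))

theorem IsJumpFlow.hasDerivWithinAt_meanChar (hP : IsJumpFlow lam mu β P) (ξ : ℝ) {t : ℝ}
    (ht : 0 ≤ t) : HasDerivWithinAt (fun s => meanChar (P s) ξ)
      (∫ v, jumpGen lam mu β (empChar ξ) v ∂P t) (Set.Ici 0) t :=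
  hP.deriv (stronglyMeasurable_empChar ξ) (norm_empChar_le ξ) ht

/-- The mean of the empirical characteristic function solves the limiting equation up to the
deviations of the empirical characteristic function and an error of order `1 / N`. -/
theorem norm_integral_jumpGen_empChar_sub_le (hlam : 0 ≤ lam) (hmu : 0 ≤ mu)
    (hN : 2 ≤ N) (Q : Measure (Fin N → ℝ)) [IsProbabilityMeasure Q] {ρ g ξ : ℝ} (hξ : |ξ| ≤ ρ)
    (hg : ∀ η, |η| ≤ ρ → devChar Q η ≤ g) :
    ‖(∫ v, jumpGen lam mu β (empChar ξ) v ∂Q) - limitGen lam mu β (meanChar Q) ξ‖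
      ≤ 8 * lam / (N - 1) + (6 * lam + 2 * mu) * √g := by
  have h1 := integral_mul_limitGenDist_le Q β hlam hmu (w := fun _ => 1) (C := 1)
    stronglyMeasurable_const (fun v => by simp) hξ (g := √g)
    (fun η hη => by simpa using integral_norm_empChar_sub_le Q (hg η hη))
  simp only [one_mul] at h1
  have hI : Integrable (jumpGen lam mu β (empChar ξ)) Q :=
    integrable_of_norm_le (stronglyMeasurable_jumpGen_empChar ξ)
      (norm_jumpGen_le (norm_empChar_le ξ))
  have h2 : (∫ v, jumpGen lam mu β (empChar ξ) v ∂Q) - limitGen lam mu β (meanChar Q) ξ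
      = ∫ v, (jumpGen lam mu β (empChar ξ) v - limitGen lam mu β (meanChar Q) ξ) ∂Q := by
    rw [integral_sub hI (integrable_const _)]; simp
  rw [h2]
  refine (norm_integral_le_of_norm_le ((integrable_const (8 * lam / (N - 1))).add h1.1)
    (ae_of_all _ fun v => ?_)).trans ?_
  · have h3 := jumpGen_empChar_sub_le (mu := mu) β hlam hN ξ v
    have h4 := norm_limitGen_sub_le β hlam hmu (h := fun η => empChar η v) (k := meanChar Q)
      (continuous_empChar.comp (continuous_id.prodMk continuous_const)).measurable
      (measurable_meanChar Q) (fun η => norm_empChar_le η v) (norm_meanChar_le Q) ξ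
    exact (norm_sub_le_norm_sub_add_norm_sub _ _ _).trans (add_le_add h3 h4)
  · refine (integral_add (integrable_const _) h1.1).trans_le ?_
    simpa using h1.2

/-- Expansion of `|a + (b - a)|²` under each jump. The last sum is the carré du champ: total rate of
order `N` times squared jumps of order `1 / N²`. -/
theorem jumpGen_norm_sq_empChar (ξ : ℝ) (v : Fin N → ℝ) :
    jumpGen lam mu β (fun v => ‖empChar ξ v‖ ^ 2) v
      = 2 * inner ℝ (empChar ξ v) (jumpGen lam mu β (empChar ξ) v)
        + ∑ k : Jump N, jumpRate lam mu k *
          ∫ ω, ‖empChar ξ (jumpMap k ω v) - empChar ξ v‖ ^ 2 ∂jumpLaw β := by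
  have hI : ∀ k : Jump N, Integrable (fun ω => empChar ξ (jumpMap k ω v)) (jumpLaw β) := fun k =>
    integrable_comp_jumpMap β k (stronglyMeasurable_empChar ξ) (norm_empChar_le ξ) v
  have hm : ∀ k : Jump N, StronglyMeasurable fun ω => empChar ξ (jumpMap k ω v) := fun k =>
    (stronglyMeasurable_empChar ξ).comp_measurable
      ((measurable_jumpMap k).comp (measurable_const.prodMk measurable_id))
  have hI2 : ∀ k : Jump N, Integrable (fun ω => ‖empChar ξ (jumpMap k ω v) - empChar ξ v‖ ^ 2)
      (jumpLaw β) := fun k =>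
    integrable_of_norm_le (((hm k).sub stronglyMeasurable_const).norm.pow 2) (C := 4) fun ω => by
      rw [norm_pow, norm_norm]
      have := (norm_sub_le (empChar ξ (jumpMap k ω v)) (empChar ξ v)).trans
        (add_le_add (norm_empChar_le ξ _) (norm_empChar_le ξ v))
      nlinarith [norm_nonneg (empChar ξ (jumpMap k ω v) - empChar ξ v)]
  unfold jumpGen
  rw [inner_sum, Finset.mul_sum, ← Finset.sum_add_distrib]
  refine Finset.sum_congr rfl fun k _ => ?_
  have e : ∀ ω, ‖empChar ξ (jumpMap k ω v)‖ ^ 2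
      = ‖empChar ξ v‖ ^ 2 + 2 * inner ℝ (empChar ξ v) (empChar ξ (jumpMap k ω v) - empChar ξ v)
        + ‖empChar ξ (jumpMap k ω v) - empChar ξ v‖ ^ 2 := fun ω => by
    rw [← norm_add_sq_real]; congr 2; ring
  have hs := (hI k).sub (integrable_const (empChar ξ v))
  have hin : Integrable (fun ω => 2 * inner ℝ (empChar ξ v)
      (empChar ξ (jumpMap k ω v) - empChar ξ v)) (jumpLaw β) := (hs.const_inner _).const_mul 2
  have hin2 : Integrable (fun ω => ‖empChar ξ v‖ ^ 2 + 2 * inner ℝ (empChar ξ v)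
      (empChar ξ (jumpMap k ω v) - empChar ξ v)) (jumpLaw β) := (integrable_const _).add hin
  have hval : ∫ ω, inner ℝ (empChar ξ v) (empChar ξ (jumpMap k ω v) - empChar ξ v) ∂jumpLaw β
      = inner ℝ (empChar ξ v) ((∫ ω, empChar ξ (jumpMap k ω v) ∂jumpLaw β) - empChar ξ v) := by
    refine (integral_inner hs _).trans ?_
    congr 1
    refine (integral_sub (hI k) (integrable_const _)).trans ?_
    simp
  simp only [e]
  rw [integral_add hin2 (hI2 k), integral_add (integrable_const _) hin, integral_const_mul,
    hval, real_inner_smul_right]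
  simp only [integral_const, probReal_univ, smul_eq_mul]
  ring

theorem hasDerivWithinAt_devChar (hP : IsJumpFlow lam mu β P) (ξ : ℝ) {t : ℝ} (ht : 0 ≤ t) :
    HasDerivWithinAt (fun s => devChar (P s) ξ)
      ((∫ v, jumpGen lam mu β (fun v => ‖empChar ξ v‖ ^ 2) v ∂P t)
        - 2 * inner ℝ (meanChar (P t) ξ) (∫ v, jumpGen lam mu β (empChar ξ) v ∂P t))
      (Set.Ici 0) t := by
  have h1 := hP.deriv (Φ := fun v => ‖empChar ξ v‖ ^ 2)
    ((stronglyMeasurable_empChar ξ).norm.pow 2) (C := 1) (fun v => by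
      rw [norm_pow, norm_norm]; exact pow_le_one₀ (norm_nonneg _) (norm_empChar_le ξ v)) ht
  have h2 := (hP.hasDerivWithinAt_meanChar ξ ht).norm_sq
  refine (h1.sub h2).congr (fun s hs => ?_) ?_
  · have := hP.prob s hs
    exact devChar_eq (P s) ξ
  · have := hP.prob t ht
    exact devChar_eq (P t) ξ

/-- Up to the carré du champ, the derivative of the variance is `2 E⟨u - E u, L u⟩`, where `L u` is
`jumpGen` of `u`. Subtracting from `L u` the constant `G`, `limitGen` of the mean, changes nothing,
and `L u - G` is bounded by `O(1/N)` plus an average of deviations inside the window. -/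
theorem deriv_devChar_le (hlam : 0 ≤ lam) (hmu : 0 ≤ mu)
    (hN : 2 ≤ N) (Q : Measure (Fin N → ℝ)) [IsProbabilityMeasure Q] {ρ g ξ : ℝ} (hξ : |ξ| ≤ ρ)
    (hg : ∀ η, |η| ≤ ρ → devChar Q η ≤ g) :
    (∫ v, jumpGen lam mu β (fun v => ‖empChar ξ v‖ ^ 2) v ∂Q)
        - 2 * inner ℝ (meanChar Q ξ) (∫ v, jumpGen lam mu β (empChar ξ) v ∂Q)
      ≤ (12 * lam + 4 * mu) * g + (32 * lam / (N - 1) + 16 * (lam + mu) / N) := by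
  set c := meanChar Q ξ with hc
  set L := jumpGen (N := N) lam mu β (empChar ξ) with hL
  set G := limitGen lam mu β (meanChar Q) ξ with hG
  have hN0 : (0 : ℝ) < N := by positivity
  have hN1 : (0 : ℝ) < (N : ℝ) - 1 := by
    have : (2 : ℝ) ≤ N := by exact_mod_cast hN
    linarith
  have hLI : Integrable L Q :=
    integrable_of_norm_le (stronglyMeasurable_jumpGen_empChar ξ)
      (norm_jumpGen_le (norm_empChar_le ξ))
  have hdist := integral_mul_limitGenDist_le Q β hlam hmu
    (w := fun v => ‖empChar ξ v - meanChar Q ξ‖) (C := 2)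
    (stronglyMeasurable_norm_empChar_sub_apply Q ξ)
    (fun v => by rw [norm_norm]; exact norm_empChar_sub_meanChar_le Q ξ v) hξ (g := g)
    (fun η hη => integral_norm_empChar_sub_mul_le Q (hg ξ hξ) (hg η hη))
  -- Total rate `(lam + mu) * N` times the squared jump size `(4 / N)²`.
  have hcarre : ∀ v : Fin N → ℝ, ∑ k : Jump N, jumpRate lam mu k *
      ∫ ω, ‖empChar ξ (jumpMap k ω v) - empChar ξ v‖ ^ 2 ∂jumpLaw β
        ≤ 16 * (lam + mu) / N := fun v => by
    calc _ ≤ ∑ k : Jump N, jumpRate lam mu k * (4 / N) ^ 2 := by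
          refine Finset.sum_le_sum fun k _ => ?_
          rcases eq_or_ne (jumpRate lam mu k) 0 with h | h
          · simp [h]
          · refine mul_le_mul_of_nonneg_left ?_ (jumpRate_nonneg hlam hmu k)
            have := norm_integral_le_of_norm_le_const (μ := jumpLaw β)
              (f := fun ω => ‖empChar ξ (jumpMap k ω v) - empChar ξ v‖ ^ 2) (C := (4 / N) ^ 2)
              (ae_of_all _ fun ω => by
                rw [norm_pow, norm_norm]
                gcongr
                exact norm_empChar_jumpMap_sub_le lam mu ξ v k ω h)
            simp only [probReal_univ, mul_one] at this
            exact (le_abs_self _).trans this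
      _ = (lam + mu) * N * (4 / N) ^ 2 := by rw [← Finset.sum_mul, sum_jumpRate lam mu hN]
      _ = _ := by field_simp; ring
  have hsqI : Integrable (jumpGen lam mu β fun v : Fin N → ℝ => ‖empChar ξ v‖ ^ 2) Q :=
    integrable_of_norm_le (stronglyMeasurable_jumpGen lam mu β
      ((stronglyMeasurable_empChar ξ).norm.pow 2)) (norm_jumpGen_le (C := 1) fun v => by
      rw [norm_pow, norm_norm]; exact pow_le_one₀ (norm_nonneg _) (norm_empChar_le ξ v))
  have hinI : Integrable (fun v => 2 * inner ℝ c (L v)) Q := (hLI.const_inner c).const_mul 2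
  have hzero : ∫ v, inner ℝ (empChar ξ v - c) G ∂Q = 0 := by
    have h1 : ∀ v : Fin N → ℝ, inner ℝ (empChar ξ v - c) G = inner ℝ G (empChar ξ v - c) :=
      fun v => real_inner_comm _ _
    simp only [h1]
    refine (integral_inner ((integrable_empChar Q ξ).sub (integrable_const c)) G).trans ?_
    have h2 : ∫ v, (empChar ξ v - c) ∂Q = 0 := by
      rw [integral_sub (integrable_empChar Q ξ) (integrable_const c), ← meanChar, ← hc]
      simp
    exact (congrArg _ h2).trans (inner_zero_right _)
  have hzI : Integrable (fun v => 2 * inner ℝ (empChar ξ v - c) G) Q := by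
    have := ((integrable_empChar Q ξ).sub (integrable_const c)).const_inner G (𝕜 := ℝ)
    refine (this.const_mul 2).congr (ae_of_all _ fun v => ?_)
    simp only [Pi.sub_apply]
    rw [real_inner_comm]
  have hstep : (∫ v, jumpGen lam mu β (fun v => ‖empChar ξ v‖ ^ 2) v ∂Q)
        - 2 * inner ℝ c (∫ v, L v ∂Q)
      = ∫ v, (jumpGen lam mu β (fun v => ‖empChar ξ v‖ ^ 2) v - 2 * inner ℝ c (L v)
          - 2 * inner ℝ (empChar ξ v - c) G) ∂Q := by
    have hsub : Integrable (fun v => jumpGen lam mu β (fun v => ‖empChar ξ v‖ ^ 2) v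
      - 2 * inner ℝ c (L v)) Q := hsqI.sub hinI
    rw [integral_sub hsub hzI, integral_sub hsqI hinI, integral_const_mul, integral_const_mul,
      hzero, integral_inner hLI]
    ring
  rw [hstep]
  have hbound : ∀ v : Fin N → ℝ, jumpGen lam mu β (fun v => ‖empChar ξ v‖ ^ 2) v - 2 * inner ℝ c (L v)
          - 2 * inner ℝ (empChar ξ v - c) G
      ≤ 2 * (‖empChar ξ v - meanChar Q ξ‖ *
          limitGenDist lam mu β (fun η => ‖empChar η v - meanChar Q η‖) ξ)
        + (32 * lam / (N - 1) + 16 * (lam + mu) / N) := fun v => by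
    rw [jumpGen_norm_sq_empChar]
    have h1 : 2 * inner ℝ (empChar ξ v) (L v) - 2 * inner ℝ c (L v)
        - 2 * inner ℝ (empChar ξ v - c) G = 2 * inner ℝ (empChar ξ v - c) (L v - G) := by
      simp only [inner_sub_left, inner_sub_right]; ring
    have h2 : inner ℝ (empChar ξ v - c) (L v - G) ≤ ‖empChar ξ v - c‖ * ‖L v - G‖ :=
      real_inner_le_norm _ _
    have h3 := jumpGen_empChar_sub_le (mu := mu) β hlam hN ξ v
    have h4 := norm_limitGen_sub_le β hlam hmu (h := fun η => empChar η v) (k := meanChar Q)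
      (continuous_empChar.comp (continuous_id.prodMk continuous_const)).measurable
      (measurable_meanChar Q) (fun η => norm_empChar_le η v) (norm_meanChar_le Q) ξ
    have h5 := (norm_sub_le_norm_sub_add_norm_sub (L v) _ G).trans (add_le_add h3 h4)
    have h6 := mul_le_mul_of_nonneg_left h5 (norm_nonneg (empChar ξ v - c))
    have h7 : ‖empChar ξ v - c‖ * (8 * lam / (N - 1)) ≤ 2 * (8 * lam / (N - 1)) := by
      gcongr
      exact norm_empChar_sub_meanChar_le Q ξ v
    have h8 := hcarre v
    have h9 : 32 * lam / ((N : ℝ) - 1) = 2 * (2 * (8 * lam / (N - 1))) := by ring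
    rw [mul_add] at h6
    linarith
  have hRI := (hdist.1.const_mul 2)
  refine (integral_mono ((hsqI.sub hinI).sub hzI) (hRI.add (integrable_const _)) hbound).trans ?_
  refine (integral_add hRI (integrable_const _)).trans_le ?_
  rw [integral_const_mul]
  simp only [integral_const, probReal_univ, one_smul]
  linarith [hdist.2]

/-- Propagation of the smallness of the deviations. -/
theorem IsJumpFlow.devChar_le (hP : IsJumpFlow lam mu β P) (hlam : 0 ≤ lam) (hmu : 0 ≤ mu)
    (hN : 2 ≤ N) {ρ A : ℝ} (hA : 0 ≤ A) (h0 : ∀ ξ, |ξ| ≤ ρ → devChar (P 0) ξ ≤ A) {t : ℝ}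
    (ht : 0 ≤ t) {ξ : ℝ} (hξ : |ξ| ≤ ρ) :
    devChar (P t) ξ ≤ (A + (32 * lam / (N - 1) + 16 * (lam + mu) / N) * t)
      * Real.exp ((12 * lam + 4 * mu) * t) := by
  have hN0 : (0 : ℝ) < N := by positivity
  have hN1 : (0 : ℝ) < (N : ℝ) - 1 := by
    have : (2 : ℝ) ≤ N := by exact_mod_cast hN
    linarith
  refine sup_gronwall (X := {ξ : ℝ // |ξ| ≤ ρ}) (u := fun ξ s => devChar (P s) ξ)
    (u' := fun ξ s => _) (T := t) (B := 4) hA (by norm_num) (by positivity) (by positivity)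
    (fun ξ s hs => hasDerivWithinAt_devChar hP ξ hs) (fun ξ => h0 ξ ξ.2) (fun ξ s hs => ?_)
    (fun s hs g _ hg ξ => ?_) ⟨ht, le_rfl⟩ ⟨ξ, hξ⟩
  · have := hP.prob s hs.1
    exact KacThermostat.devChar_le (P s) ξ
  · have := hP.prob s hs.1
    exact deriv_devChar_le hlam hmu hN (P s) ξ.2 fun η hη => hg ⟨η, hη⟩

/-- Propagation of the closeness of the means of two systems. -/
theorem IsJumpFlow.norm_meanChar_sub_le (hP : IsJumpFlow lam mu β P) {M : ℕ}
    {R : ℝ → Measure (Fin M → ℝ)} (hR : IsJumpFlow lam mu β R) (hlam : 0 ≤ lam) (hmu : 0 ≤ mu)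
    (hN : 2 ≤ N) (hM : 2 ≤ M) {ρ A g T : ℝ} (hA : 0 ≤ A)
    (h0 : ∀ ξ, |ξ| ≤ ρ → ‖meanChar (P 0) ξ - meanChar (R 0) ξ‖ ≤ A)
    (hPg : ∀ s ∈ Set.Icc 0 T, ∀ ξ, |ξ| ≤ ρ → devChar (P s) ξ ≤ g)
    (hRg : ∀ s ∈ Set.Icc 0 T, ∀ ξ, |ξ| ≤ ρ → devChar (R s) ξ ≤ g)
    (hT : 0 ≤ T) {ξ : ℝ} (hξ : |ξ| ≤ ρ) :
    ‖meanChar (P T) ξ - meanChar (R T) ξ‖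
      ≤ (A + (8 * lam / (N - 1) + 8 * lam / (M - 1) + 2 * ((6 * lam + 2 * mu) * √g)) * T)
        * Real.exp ((6 * lam + 2 * mu) * T) := by
  have hN1 : (0 : ℝ) < (N : ℝ) - 1 := by
    have : (2 : ℝ) ≤ N := by exact_mod_cast hN
    linarith
  have hM1 : (0 : ℝ) < (M : ℝ) - 1 := by
    have : (2 : ℝ) ≤ M := by exact_mod_cast hM
    linarith
  -- The norm of the difference may fail to be differentiable where it vanishes. It is replaced by
  -- its real inner products with vectors of the unit disc, whose supremum is attained and equals
  -- the norm.
  let X := {ξ : ℝ // |ξ| ≤ ρ} × {c : ℂ // ‖c‖ ≤ 1}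
  let z : ℝ → ℝ → ℂ := fun s ξ => meanChar (P s) ξ - meanChar (R s) ξ
  have hin : ∀ (c : {c : ℂ // ‖c‖ ≤ 1}) (w : ℂ), inner ℝ c.1 w ≤ ‖w‖ := fun c w =>
    (real_inner_le_norm _ _).trans (mul_le_of_le_one_left (norm_nonneg _) c.2)
  have hattain : ∀ w : ℂ, ∃ c : {c : ℂ // ‖c‖ ≤ 1}, inner ℝ c.1 w = ‖w‖ := fun w => by
    refine ⟨⟨(‖w‖⁻¹ : ℝ) • w, ?_⟩, ?_⟩
    · rw [norm_smul, norm_inv, norm_norm]; exact inv_mul_le_one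
    · rw [real_inner_smul_left, real_inner_self_eq_norm_sq]
      rcases eq_or_ne ‖w‖ 0 with h | h
      · simp [h]
      · field_simp
  have key : ∀ x : X, inner ℝ x.2.1 (z T x.1) ≤
      (A + (8 * lam / (N - 1) + 8 * lam / (M - 1) + 2 * ((6 * lam + 2 * mu) * √g)) * T)
        * Real.exp ((6 * lam + 2 * mu) * T) := by
    refine fun x => sup_gronwall (X := X) (u := fun x s => inner ℝ x.2.1 (z s x.1))
      (u' := fun x s => inner ℝ x.2.1 ((∫ v, jumpGen lam mu β (empChar x.1.1) v ∂(P s))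
        - ∫ v, jumpGen lam mu β (empChar x.1.1) v ∂(R s))) (T := T) (B := 2) hA (by norm_num)
      (by positivity) (by positivity) (fun x s hs => ?_) (fun x => ?_) (fun x s hs => ?_)
      (fun s hs b _ hb x => ?_) ⟨hT, le_rfl⟩ x
    · have h := (hasDerivWithinAt_const s (Set.Ici 0) x.2.1).inner ℝ
        ((hP.hasDerivWithinAt_meanChar x.1.1 hs).sub (hR.hasDerivWithinAt_meanChar x.1.1 hs))
      exact h.congr_deriv (by rw [inner_zero_left, add_zero])
    · exact (hin _ _).trans (h0 _ x.1.2)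
    · have := hP.prob s hs.1
      have := hR.prob s hs.1
      refine (hin _ _).trans ((norm_sub_le _ _).trans ?_)
      linarith [norm_meanChar_le (P s) x.1, norm_meanChar_le (R s) x.1]
    · have := hP.prob s hs.1
      have := hR.prob s hs.1
      refine (hin _ _).trans ?_
      have h1 := norm_integral_jumpGen_empChar_sub_le (β := β) hlam hmu hN (P s) x.1.2 (hPg s hs)
      have h2 := norm_integral_jumpGen_empChar_sub_le (β := β) hlam hmu hM (R s) x.1.2 (hRg s hs)
      have h3 := (norm_limitGen_sub_le β hlam hmu (measurable_meanChar (P s))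
        (measurable_meanChar (R s)) (norm_meanChar_le (P s)) (norm_meanChar_le (R s)) x.1).trans
        (limitGenDist_le β hlam hmu x.1.2 (g := b) (fun _ => norm_nonneg _) fun η hη => by
          obtain ⟨c, hc⟩ := hattain (z s η)
          exact hc.symm.trans_le (hb (⟨η, hη⟩, c)))
      rw [norm_sub_rev] at h2
      have h4 := dist_triangle4 (∫ v, jumpGen lam mu β (empChar x.1.1) v ∂(P s))
        (limitGen lam mu β (meanChar (P s)) x.1) (limitGen lam mu β (meanChar (R s)) x.1)
        (∫ v, jumpGen lam mu β (empChar x.1.1) v ∂(R s))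
      simp only [dist_eq_norm] at h4
      linarith
  obtain ⟨c, hc⟩ := hattain (z T ξ)
  exact hc.symm.trans_le (key (⟨ξ, hξ⟩, c))

end Flow

/-! ### Densities as laws, and propagation of chaos for characteristic functions. -/

/-- The measure with density `f`. -/
def densityLaw {N : ℕ} (f : (Fin N → ℝ) → ℝ) : Measure (Fin N → ℝ) :=
  volume.withDensity fun v => ENNReal.ofReal (f v)

namespace IsSymmDensity

variable {N : ℕ} {f : (Fin N → ℝ) → ℝ}

theorem isProbabilityMeasure (hf : IsSymmDensity f) : IsProbabilityMeasure (densityLaw f) := by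
  constructor
  rw [densityLaw, withDensity_apply _ MeasurableSet.univ, Measure.restrict_univ,
    ← ofReal_integral_eq_lintegral_ofReal hf.integrable hf.nonneg, hf.integral_eq_one,
    ENNReal.ofReal_one]

theorem integral_densityLaw (hf : IsSymmDensity f) {E : Type*} [NormedAddCommGroup E]
    [NormedSpace ℝ E] (Φ : (Fin N → ℝ) → E) : ∫ v, Φ v ∂densityLaw f = ∫ v, f v • Φ v := by
  rw [densityLaw, integral_withDensity_eq_integral_toReal_smul₀
    hf.integrable.aestronglyMeasurable.aemeasurable.ennreal_ofReal
    (ae_of_all _ fun _ => ENNReal.ofReal_lt_top)]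
  refine integral_congr_ae ?_
  filter_upwards [hf.nonneg] with v hv
  rw [ENNReal.toReal_ofReal hv]

theorem integral_comp_perm (hf : IsSymmDensity f) {E : Type*} [NormedAddCommGroup E]
    [NormedSpace ℝ E] (σ : Equiv.Perm (Fin N)) (Φ : (Fin N → ℝ) → E) :
    ∫ v, Φ (fun i => v (σ i)) ∂densityLaw f = ∫ v, Φ v ∂densityLaw f := by
  rw [hf.integral_densityLaw, hf.integral_densityLaw, ← integral_smul_comp_perm σ f Φ]
  refine integral_congr_ae ?_
  filter_upwards [hf.symm σ] with v hv
  rw [hv]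

end IsSymmDensity

theorem SolvesMaster.isJumpFlow {lam mu β : ℝ} {N : ℕ} {f : ℝ → (Fin N → ℝ) → ℝ}
    (hf : SolvesMaster lam mu β f) (hlam : 0 ≤ lam) (hmu : 0 ≤ mu) (hβ : 0 < β)
    (h0 : IsSymmDensity (f 0)) : IsJumpFlow lam mu β fun t => densityLaw (f t) where
  prob t ht := (hf.isSymmDensity hlam hmu hβ h0 ht).isProbabilityMeasure
  deriv {E} _ _ _ {Φ} hΦ {C} hC {t} ht := by
    have hs : ∀ s, 0 ≤ s → IsSymmDensity (f s) := fun s hs =>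
      hf.isSymmDensity hlam hmu hβ h0 hs
    rw [(hs t ht).integral_densityLaw]
    exact (hf.hasDerivWithinAt_integral hβ hΦ hC ht).congr
      (fun s h => (hs s h).integral_densityLaw Φ) ((hs t ht).integral_densityLaw Φ)

/-- Chaos in terms of empirical characteristic functions: these concentrate around their means,
and the means form a Cauchy sequence, locally uniformly in the frequency. -/
structure IsCharChaotic (P : ∀ N : ℕ, Measure (Fin N → ℝ)) : Prop where
  dev : ∀ ρ ε : ℝ, 0 < ε → ∀ᶠ N in atTop, ∀ ξ, |ξ| ≤ ρ → devChar (P N) ξ ≤ ε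
  cauchy : ∀ ρ ε : ℝ, 0 < ε → ∃ N₀, ∀ N ≥ N₀, ∀ M ≥ N₀, ∀ ξ, |ξ| ≤ ρ →
    ‖meanChar (P N) ξ - meanChar (P M) ξ‖ ≤ ε

section Propagation

variable {lam mu β : ℝ} {P : ∀ N : ℕ, ℝ → Measure (Fin N → ℝ)}

theorem tendsto_const_div_sub_one (c : ℝ) :
    Tendsto (fun N : ℕ => c / ((N : ℝ) - 1)) atTop (𝓝 0) :=
  tendsto_const_nhds.div_atTop
    (tendsto_atTop_add_const_right _ (-1) tendsto_natCast_atTop_atTop)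

theorem IsCharChaotic.eventually_devChar_le (hP : ∀ N, IsJumpFlow lam mu β (P N)) (hlam : 0 ≤ lam)
    (hmu : 0 ≤ mu) (h0 : IsCharChaotic fun N => P N 0) (T ρ : ℝ) {ε : ℝ} (hε : 0 < ε) :
    ∀ᶠ N in atTop, ∀ s ∈ Set.Icc 0 T, ∀ ξ, |ξ| ≤ ρ → devChar (P N s) ξ ≤ ε := by
  set K := Real.exp ((12 * lam + 4 * mu) * T) with hK
  have hK0 : 0 < K := Real.exp_pos _
  -- One half is for the initial variance, the other for the accumulated `1 / N` error; `K` is the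
  -- Grönwall factor.
  set A := ε / (2 * K) with hA
  have hA0 : 0 < A := by positivity
  have hlim : Tendsto (fun N : ℕ => (32 * lam / ((N : ℝ) - 1) + 16 * (lam + mu) / N) * T) atTop
      (𝓝 0) := by
    have := ((tendsto_const_div_sub_one (32 * lam)).add
      (tendsto_const_div_atTop_nhds_zero_nat (16 * (lam + mu)))).mul_const T
    simpa using this
  filter_upwards [h0.dev ρ A hA0, hlim.eventually_le_const hA0, eventually_ge_atTop 2]
    with N h1 h2 hN s hs ξ hξ
  have hN1 : (0 : ℝ) < (N : ℝ) - 1 := by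
    have : (2 : ℝ) ≤ N := by exact_mod_cast hN
    linarith
  refine ((hP N).devChar_le hlam hmu hN hA0.le h1 hs.1 hξ).trans ?_
  have hsT : (32 * lam / ((N : ℝ) - 1) + 16 * (lam + mu) / N) * s ≤ A :=
    (mul_le_mul_of_nonneg_left hs.2 (by positivity)).trans h2
  calc _ ≤ (A + A) * K := by
        gcongr
        exact Real.exp_le_exp.2 (mul_le_mul_of_nonneg_left hs.2 (by positivity))
    _ = ε := by rw [hA]; field_simp; ring

theorem IsCharChaotic.propagates (hP : ∀ N, IsJumpFlow lam mu β (P N)) (hlam : 0 ≤ lam)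
    (hmu : 0 ≤ mu) (h0 : IsCharChaotic fun N => P N 0) {T : ℝ} (hT : 0 ≤ T) :
    IsCharChaotic fun N => P N T where
  dev ρ ε hε := by
    filter_upwards [h0.eventually_devChar_le hP hlam hmu T ρ hε] with N h
    exact h T ⟨hT, le_rfl⟩
  cauchy ρ ε hε := by
    set K := Real.exp ((6 * lam + 2 * mu) * T) with hK
    have hK0 : 0 < K := Real.exp_pos _
    -- Four contributions of at most `δ`: the initial difference of the means, the `1 / N` and `1 /
    -- M` errors, and the deviations through `√g`.
    set δ := ε / (4 * K) with hδ
    have hδ0 : 0 < δ := by positivity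
    set c := 2 * (6 * lam + 2 * mu) * T with hc
    have hc0 : 0 ≤ c := by positivity
    -- Chosen so that `c * √g ≤ δ`; the `+ 1` covers `c = 0`.
    set g := (δ / (c + 1)) ^ 2 with hg
    have hg0 : 0 < g := by positivity
    have hlim : Tendsto (fun N : ℕ => 8 * lam / ((N : ℝ) - 1) * T) atTop (𝓝 0) := by
      simpa using (tendsto_const_div_sub_one (8 * lam)).mul_const T
    obtain ⟨N₁, h1⟩ := h0.cauchy ρ δ hδ0
    obtain ⟨N₂, h2⟩ := eventually_atTop.1 (h0.eventually_devChar_le hP hlam hmu T ρ hg0)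
    obtain ⟨N₃, h3⟩ := eventually_atTop.1 (hlim.eventually_le_const hδ0)
    refine ⟨max (max N₁ N₂) (max N₃ 2), fun N hN M hM ξ hξ => ?_⟩
    simp only [ge_iff_le, max_le_iff] at hN hM
    refine ((hP N).norm_meanChar_sub_le (hP M) hlam hmu hN.2.2 hM.2.2 hδ0.le
      (h1 N hN.1.1 M hM.1.1) (h2 N hN.1.2) (h2 M hM.1.2) hT hξ).trans ?_
    have h4 := h3 N hN.2.1
    have h5 := h3 M hM.2.1
    have h6 : 2 * ((6 * lam + 2 * mu) * √g) * T ≤ δ := by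
      rw [hg, Real.sqrt_sq (by positivity)]
      calc 2 * ((6 * lam + 2 * mu) * (δ / (c + 1))) * T = δ * (c / (c + 1)) := by
            rw [hc]; ring
        _ ≤ δ * 1 := by
            gcongr
            rw [div_le_one (by positivity)]; linarith
        _ = δ := mul_one δ
    calc _ ≤ (4 * δ) * K := by
          gcongr
          linarith
      _ = ε := by rw [hδ]; field_simp

end Propagation

/-! ### Factorization of the marginals of an exchangeable law. -/

section Marginals

variable {N : ℕ} {f : (Fin N → ℝ) → ℝ}

theorem IsSymmDensity.integral_apply_eq (hf : IsSymmDensity f) {E : Type*} [NormedAddCommGroup E]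
    [NormedSpace ℝ E] (h : ℝ → E) (i j : Fin N) :
    ∫ v, h (v i) ∂densityLaw f = ∫ v, h (v j) ∂densityLaw f := by
  have := hf.integral_comp_perm (Equiv.swap i j) fun v => h (v j)
  simpa using this

theorem continuous_character_apply (ξ : ℝ) (i : Fin N) :
    Continuous fun v : Fin N → ℝ => character ξ (v i) :=
  continuous_character.comp (continuous_const.prodMk (continuous_apply i))

theorem IsSymmDensity.integral_character (hf : IsSymmDensity f) (ξ : ℝ) (i : Fin N) :
    ∫ v, character ξ (v i) ∂densityLaw f = meanChar (densityLaw f) ξ := by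
  have := hf.isProbabilityMeasure
  have hN : (N : ℂ) ≠ 0 := by
    have := i.pos.ne'
    exact_mod_cast this
  unfold meanChar empChar
  rw [integral_const_mul, integral_finsetSum, Finset.sum_congr rfl fun j _ =>
    hf.integral_apply_eq (character ξ) j i]
  · simp [hN]
  · exact fun j _ => integrable_of_norm_le (continuous_character_apply ξ j).stronglyMeasurable
      fun v => (norm_character ξ (v j)).le

/-- Quantitative factorization of the characteristic functions of the marginals of a symmetric
density. -/
theorem IsSymmDensity.norm_integral_prod_character_sub_le (hf : IsSymmDensity f) (ξ : Fin N → ℝ)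
    {δ : ℝ} (S : Finset (Fin N)) (hδ : ∀ i ∈ S, √(devChar (densityLaw f) (ξ i)) ≤ δ) :
    ‖(∫ v, ∏ i ∈ S, character (ξ i) (v i) ∂densityLaw f)
        - ∏ i ∈ S, meanChar (densityLaw f) (ξ i)‖ ≤ S.card * (2 * S.card / N + δ) := by
  have := hf.isProbabilityMeasure
  set P := densityLaw f with hP
  induction S using Finset.induction_on with
  | empty => simp
  | insert l S hl ih =>
    have hS := ih fun i hi => hδ i (Finset.mem_insert_of_mem hi)
    have hδl := hδ l (Finset.mem_insert_self l S)
    have hδ0 : 0 ≤ δ := (Real.sqrt_nonneg _).trans hδl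
    have hN0 : (0 : ℝ) < N := by exact_mod_cast l.pos
    set g : (Fin N → ℝ) → ℂ := fun v => ∏ i ∈ S, character (ξ i) (v i) with hg
    have hg1 : ∀ v, ‖g v‖ = 1 := fun v => by
      rw [hg, norm_prod]; exact Finset.prod_eq_one fun i _ => norm_character _ _
    have hgc : Continuous g := continuous_finsetProd _ fun i _ => continuous_character_apply _ i
    have hgI : Integrable g P := integrable_of_norm_le hgc.stronglyMeasurable fun v => (hg1 v).le
    have heI : ∀ j, Integrable (fun v => g v * character (ξ l) (v j)) P := fun j =>
      integrable_of_norm_le (hgc.mul (continuous_character_apply _ j)).stronglyMeasurable (C := 1)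
        fun v => by rw [norm_mul, hg1, norm_character, mul_one]
    have he1 : ∀ j, ‖∫ v, g v * character (ξ l) (v j) ∂P‖ ≤ 1 := fun j => by
      simpa using norm_integral_le_of_norm_le_const (μ := P)
        (f := fun v => g v * character (ξ l) (v j)) (C := 1) (ae_of_all _ fun v => by
          rw [norm_mul, hg1, norm_character, mul_one])
    have huI : Integrable (fun v => g v * empChar (ξ l) v) P :=
      integrable_of_norm_le (hgc.stronglyMeasurable.mul (stronglyMeasurable_empChar _)) (C := 1)
        fun v => by rw [norm_mul, hg1, one_mul]; exact norm_empChar_le _ v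
    -- The transposition of `j` and `l` leaves the factors indexed by `S` alone.
    have hsym : ∀ j, j ∉ S → ∫ v, g v * character (ξ l) (v j) ∂P
        = ∫ v, g v * character (ξ l) (v l) ∂P := fun j hj => by
      rw [← hf.integral_comp_perm (Equiv.swap j l)]
      congr 1; ext v
      simp only [hg, Equiv.swap_apply_left]
      congr 1
      refine Finset.prod_congr rfl fun i hi => ?_
      rw [Equiv.swap_apply_of_ne_of_ne (ne_of_mem_of_not_mem hi hj)
        (ne_of_mem_of_not_mem hi hl)]
    -- The new factor may be replaced by its average over all particles: only the indices in `S`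
    -- contribute an error, at most `2 / N` each.
    have h1 : ‖(∫ v, g v * empChar (ξ l) v ∂P) - ∫ v, g v * character (ξ l) (v l) ∂P‖
        ≤ 2 * S.card / N := by
      have e1 : ∫ v, g v * empChar (ξ l) v ∂P
          = (N : ℂ)⁻¹ * ∑ j, ∫ v, g v * character (ξ l) (v j) ∂P := by
        rw [← integral_finsetSum _ fun j _ => heI j, ← integral_const_mul]
        congr 1; ext v
        rw [empChar, ← Finset.mul_sum]; ring
      have e2 : ∫ v, g v * character (ξ l) (v l) ∂P
          = (N : ℂ)⁻¹ * ∑ _j : Fin N, ∫ v, g v * character (ξ l) (v l) ∂P := by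
        have : (N : ℂ) ≠ 0 := by exact_mod_cast hN0.ne'
        simp [this]
      rw [e1, e2, ← mul_sub, ← Finset.sum_sub_distrib, norm_mul, norm_inv, Complex.norm_natCast,
        div_eq_inv_mul]
      gcongr
      refine (norm_sum_le _ _).trans ?_
      calc _ ≤ ∑ j : Fin N, if j ∈ S then (2 : ℝ) else 0 := by
            refine Finset.sum_le_sum fun j _ => ?_
            split_ifs with h
            · exact (norm_sub_le _ _).trans (by linarith [he1 j, he1 l])
            · rw [hsym j h, sub_self, norm_zero]
        _ = 2 * S.card := by simp [mul_comm]
    -- Concentration now pulls that average out of the integral as a constant.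
    have h2 : ‖(∫ v, g v * empChar (ξ l) v ∂P) - meanChar P (ξ l) * ∫ v, g v ∂P‖ ≤ δ := by
      rw [← integral_const_mul, ← integral_sub huI (hgI.const_mul _)]
      refine (norm_integral_le_of_norm_le (integrable_norm_empChar_sub P (ξ l))
        (ae_of_all _ fun v => ?_)).trans
        ((integral_norm_empChar_sub_le P le_rfl).trans hδl)
      rw [show g v * empChar (ξ l) v - meanChar P (ξ l) * g v
        = g v * (empChar (ξ l) v - meanChar P (ξ l)) by ring, norm_mul, hg1, one_mul]
    have h3 : ‖meanChar P (ξ l) * (∫ v, g v ∂P)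
        - meanChar P (ξ l) * ∏ i ∈ S, meanChar P (ξ i)‖ ≤ S.card * (2 * S.card / N + δ) := by
      rw [← mul_sub, norm_mul]
      exact (mul_le_of_le_one_left (norm_nonneg _) (norm_meanChar_le P _)).trans hS
    have h4 : ∫ v, ∏ i ∈ insert l S, character (ξ i) (v i) ∂P
        = ∫ v, g v * character (ξ l) (v l) ∂P := by
      congr 1; ext v
      rw [Finset.prod_insert hl, mul_comm]
    rw [h4, Finset.prod_insert hl, Finset.card_insert_of_notMem hl]
    rw [norm_sub_rev] at h1
    have h5 := dist_triangle4 (∫ v, g v * character (ξ l) (v l) ∂P)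
      (∫ v, g v * empChar (ξ l) v ∂P) (meanChar P (ξ l) * ∫ v, g v ∂P)
      (meanChar P (ξ l) * ∏ i ∈ S, meanChar P (ξ i))
    simp only [dist_eq_norm] at h5
    refine h5.trans ?_
    have h6 : (0 : ℝ) ≤ S.card := Nat.cast_nonneg _
    have h7 : 2 * (S.card : ℝ) / N ≤ 2 * (S.card + 1 : ℝ) / N := by
      gcongr; linarith
    push_cast
    nlinarith [mul_le_mul_of_nonneg_left h7 h6]

end Marginals

/-! ### From characteristic functions back to chaos. -/

section Chaos

variable {f : ∀ N : ℕ, (Fin N → ℝ) → ℝ}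

theorem continuous_meanChar {N : ℕ} (P : Measure (Fin N → ℝ)) [IsProbabilityMeasure P] :
    Continuous (meanChar P) := by
  refine continuous_of_dominated (bound := fun _ => 1)
    (fun ξ => (stronglyMeasurable_empChar ξ).aestronglyMeasurable)
    (fun ξ => ae_of_all _ fun v => norm_empChar_le ξ v) (integrable_const _)
    (ae_of_all _ fun v => ?_)
  exact continuous_empChar.comp (continuous_id.prodMk continuous_const)

/-- The Cauchy property is uniform near 0, so the limit is continuous there. That is the hypothesis
of Lévy's theorem which rules out loss of mass. -/
theorem IsCharChaotic.exists_limit (hs : ∀ N, IsSymmDensity (f N))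
    (hc : IsCharChaotic fun N => densityLaw (f N)) :
    ∃ F : ℝ → ℂ, ContinuousAt F 0 ∧
      ∀ ξ, Tendsto (fun N => meanChar (densityLaw (f N)) ξ) atTop (𝓝 (F ξ)) := by
  have hcauchy : ∀ ξ, CauchySeq fun N => meanChar (densityLaw (f N)) ξ := fun ξ => by
    refine Metric.cauchySeq_iff.2 fun ε hε => ?_
    obtain ⟨N₀, h⟩ := hc.cauchy |ξ| (ε / 2) (half_pos hε)
    refine ⟨N₀, fun m hm n hn => ?_⟩
    rw [dist_eq_norm]
    exact (h m hm n hn ξ le_rfl).trans_lt (half_lt_self hε)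
  choose F hF using fun ξ => cauchySeq_tendsto_of_complete (hcauchy ξ)
  refine ⟨F, ?_, hF⟩
  have hunif : TendstoUniformlyOn (fun N => meanChar (densityLaw (f N))) F atTop
      (Set.Icc (-1) 1) := by
    refine UniformCauchySeqOn.tendstoUniformlyOn_of_tendsto ?_ fun ξ _ => hF ξ
    refine Metric.uniformCauchySeqOn_iff.2 fun ε hε => ?_
    obtain ⟨N₀, h⟩ := hc.cauchy 1 (ε / 2) (half_pos hε)
    refine ⟨N₀, fun m hm n hn ξ hξ => ?_⟩
    rw [dist_eq_norm]
    exact (h m hm n hn ξ (abs_le.2 hξ)).trans_lt (half_lt_self hε)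
  refine (hunif.continuousOn (Frequently.of_forall fun N => ?_)).continuousAt
    (Icc_mem_nhds (by norm_num) (by norm_num))
  have := (hs N).isProbabilityMeasure
  exact (continuous_meanChar _).continuousOn

/-- The mean is the characteristic function of the one-particle marginal. Continuity of the limit at
0 makes the marginals tight; a weak limit along a subsequence then identifies the limit of the whole
sequence. -/
theorem IsCharChaotic.exists_limit_measure (hs : ∀ N, IsSymmDensity (f N))
    (hc : IsCharChaotic fun N => densityLaw (f N)) :
    ∃ μ : ProbabilityMeasure ℝ,
      ∀ ξ, Tendsto (fun N => meanChar (densityLaw (f N)) ξ) atTop (𝓝 (charFun (μ : Measure ℝ) ξ)) := by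
  obtain ⟨F, hF0, hF⟩ := hc.exists_limit hs
  have hprob := fun N => (hs N).isProbabilityMeasure
  have hmeas : ∀ n : ℕ, Measurable fun v : Fin (n + 1) → ℝ => v 0 := fun n => measurable_pi_apply 0
  let ν : ℕ → ProbabilityMeasure ℝ := fun n =>
    ⟨(densityLaw (f (n + 1))).map fun v => v 0,
      Measure.isProbabilityMeasure_map (hmeas n).aemeasurable⟩
  have hν : ∀ n ξ, charFun (ν n : Measure ℝ) ξ = meanChar (densityLaw (f (n + 1))) ξ := fun n ξ => by
    rw [← (hs (n + 1)).integral_character ξ 0, charFun_apply_real]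
    refine (integral_map (hmeas n).aemeasurable
      (Continuous.aestronglyMeasurable (by fun_prop))).trans ?_
    simp only [character]
    push_cast
    rfl
  have hνF : ∀ ξ, Tendsto (fun n => charFun (ν n : Measure ℝ) ξ) atTop (𝓝 (F ξ)) := fun ξ => by
    simp only [hν]
    exact (hF ξ).comp (tendsto_add_atTop_nat 1)
  have htight : IsTightMeasureSet {((μ : ProbabilityMeasure ℝ) : Measure ℝ) | μ ∈ Set.range ν} := by
    have h := isTightMeasureSet_of_tendsto_charFun hF0 hνF
    convert h using 1
    ext m
    simp
  have hcomp := isCompact_closure_of_isTightMeasureSet htight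
  obtain ⟨μ, -, φ, hφ, hlim⟩ := hcomp.tendsto_subseq fun n => subset_closure (Set.mem_range_self n)
  refine ⟨μ, fun ξ => ?_⟩
  have h1 := ProbabilityMeasure.tendsto_iff_tendsto_charFun.1 hlim ξ
  have h2 := (hνF ξ).comp hφ.tendsto_atTop
  rw [tendsto_nhds_unique h1 h2]
  exact hF ξ

theorem IsCharChaotic.tendsto_integral_prod_character (hs : ∀ N, IsSymmDensity (f N))
    (hc : IsCharChaotic fun N => densityLaw (f N)) {F : ℝ → ℂ}
    (hF : ∀ ξ, Tendsto (fun N => meanChar (densityLaw (f N)) ξ) atTop (𝓝 (F ξ))) {k : ℕ}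
    (ξ : Fin k → ℝ) :
    Tendsto (fun n : ℕ => ∫ v, ∏ j, character (ξ j) (v (Fin.castAdd n j)) ∂densityLaw (f (k + n)))
      atTop (𝓝 (∏ j, F (ξ j))) := by
  have hshift : Tendsto (fun n : ℕ => k + n) atTop atTop := tendsto_atTop_mono (fun n => Nat.le_add_left n k)
    tendsto_id
  have hprod : Tendsto (fun n : ℕ => ∏ j, meanChar (densityLaw (f (k + n))) (ξ j)) atTop
      (𝓝 (∏ j, F (ξ j))) := tendsto_finsetProd _ fun j _ => (hF (ξ j)).comp hshift
  have hdiff : Tendsto (fun n : ℕ =>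
      (∫ v, ∏ j, character (ξ j) (v (Fin.castAdd n j)) ∂densityLaw (f (k + n)))
        - ∏ j, meanChar (densityLaw (f (k + n))) (ξ j)) atTop (𝓝 0) := by
    refine Metric.tendsto_nhds.2 fun ε hε => ?_
    set δ := ε / (2 * (k + 1)) with hδ
    have hδ0 : 0 < δ := by positivity
    have hlim : Tendsto (fun n : ℕ => (k : ℝ) * (2 * k / ((k + n : ℕ) : ℝ) + δ)) atTop
        (𝓝 (k * (0 + δ))) :=
      (((tendsto_const_div_atTop_nhds_zero_nat (2 * (k : ℝ))).comp hshift).add_const δ).const_mul _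
    have hlt : (k : ℝ) * (0 + δ) < ε := by
      have hk : (k : ℝ) < 2 * (k + 1) := by
        have : (0 : ℝ) ≤ k := Nat.cast_nonneg k
        linarith
      rw [zero_add, hδ, mul_div_assoc', div_lt_iff₀ (by positivity), mul_comm]
      gcongr
    filter_upwards [hshift.eventually (hc.dev (∑ j, |ξ j|) (δ ^ 2) (by positivity)),
      hlim.eventually_lt_const hlt] with n h1 h2
    rw [dist_eq_norm, sub_zero]
    refine lt_of_le_of_lt ?_ h2
    -- The values at the last `n` particles are irrelevant: the product runs over the image of `Fin
    -- k` only.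
    let ξ' : Fin (k + n) → ℝ := Fin.addCases ξ fun _ => 0
    have hξ' : ∀ j, ξ' (Fin.castAdd n j) = ξ j := fun j => Fin.addCases_left j
    have h3 := (hs (k + n)).norm_integral_prod_character_sub_le ξ' (δ := δ)
      (Finset.univ.map (Fin.castAddEmb n)) (fun i hi => by
        obtain ⟨j, -, rfl⟩ := Finset.mem_map.1 hi
        rw [Fin.castAddEmb_apply, hξ', Real.sqrt_le_left hδ0.le]
        exact h1 _ (Finset.single_le_sum (f := fun j => |ξ j|) (fun j _ => abs_nonneg _)
          (Finset.mem_univ j)))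
    simpa only [Finset.prod_map, Fin.castAddEmb_apply, hξ', Finset.card_map, Finset.card_univ,
      Fintype.card_fin] using h3
  simpa using hdiff.add hprod

/-- The `k`-particle characteristic functions converge to those of the `k`-fold product of the limit
law, so the marginals converge weakly to it. `EuclideanSpace` supplies the inner product for
`charFun`. -/
theorem IsCharChaotic.isChaotic (hs : ∀ N, IsSymmDensity (f N))
    (hc : IsCharChaotic fun N => densityLaw (f N)) : IsChaotic f := by
  refine ⟨hs, fun k φ => ?_⟩
  obtain ⟨μ, hμ⟩ := hc.exists_limit_measure hs
  have hprob := fun N => (hs N).isProbabilityMeasure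
  have hm : ∀ n : ℕ, Measurable fun v : Fin (k + n) → ℝ =>
      (WithLp.toLp 2 fun j => v (Fin.castAdd n j) : EuclideanSpace ℝ (Fin k)) := fun n =>
    (MeasurableEquiv.toLp 2 (Fin k → ℝ)).measurable.comp
      (measurable_pi_lambda _ fun j => measurable_pi_apply _)
  let ν : ℕ → ProbabilityMeasure (EuclideanSpace ℝ (Fin k)) := fun n =>
    ⟨(densityLaw (f (k + n))).map fun v => WithLp.toLp 2 fun j => v (Fin.castAdd n j),
      Measure.isProbabilityMeasure_map (hm n).aemeasurable⟩
  have hm' : Measurable fun x : Fin k → ℝ => (WithLp.toLp 2 x : EuclideanSpace ℝ (Fin k)) :=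
    (MeasurableEquiv.toLp 2 (Fin k → ℝ)).measurable
  let ν' : ProbabilityMeasure (EuclideanSpace ℝ (Fin k)) :=
    ⟨(Measure.pi fun _ : Fin k => (μ : Measure ℝ)).map (WithLp.toLp 2),
      Measure.isProbabilityMeasure_map hm'.aemeasurable⟩
  have hconv : Tendsto ν atTop (𝓝 ν') := by
    refine ProbabilityMeasure.tendsto_of_tendsto_charFun fun t => ?_
    have h1 := hc.tendsto_integral_prod_character hs hμ fun j => t j
    have h2 : charFun (ν' : Measure (EuclideanSpace ℝ (Fin k))) t
        = ∏ j, charFun (μ : Measure ℝ) (t j) := charFun_pi t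
    rw [h2]
    refine h1.congr fun n => ?_
    rw [charFun_apply]
    refine Eq.symm ((integral_map (hm n).aemeasurable
      (Continuous.aestronglyMeasurable (by fun_prop))).trans ?_)
    congr 1; ext v
    simp only [character]
    rw [← Complex.exp_sum, PiLp.inner_apply, ← Finset.sum_mul]
    simp
  have htest : ∀ G : EuclideanSpace ℝ (Fin k) →ᵇ ℝ,
      Tendsto (fun n => ∫ v, f (k + n) v • G (WithLp.toLp 2 fun j => v (Fin.castAdd n j))) atTop
        (𝓝 (∫ x, G (WithLp.toLp 2 x) ∂Measure.pi fun _ : Fin k => (μ : Measure ℝ))) := fun G => by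
    have h1 := ProbabilityMeasure.tendsto_iff_forall_integral_tendsto.1 hconv G
    have h2 : ∫ x, G x ∂(ν' : Measure (EuclideanSpace ℝ (Fin k)))
        = ∫ x, G (WithLp.toLp 2 x) ∂Measure.pi fun _ : Fin k => (μ : Measure ℝ) :=
      integral_map hm'.aemeasurable G.continuous.aestronglyMeasurable
    rw [h2] at h1
    refine h1.congr fun n => ?_
    rw [← (hs (k + n)).integral_densityLaw]
    exact integral_map (hm n).aemeasurable G.continuous.aestronglyMeasurable
  let ev : Fin k → C(EuclideanSpace ℝ (Fin k), ℝ) := fun j => ⟨fun x => x j, by fun_prop⟩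
  refine ⟨fun j => ∫ x, φ j x ∂(μ : Measure ℝ), fun j => ?_, ?_⟩
  · have h := htest ((φ j).compContinuous (ev j))
    have hev := (measurePreserving_eval (fun _ : Fin k => (μ : Measure ℝ)) j)
    have h2 : ∫ x, φ j (x j) ∂Measure.pi (fun _ : Fin k => (μ : Measure ℝ))
        = ∫ x, φ j x ∂(μ : Measure ℝ) := by
      conv_rhs => rw [← hev.map_eq]
      exact (integral_map hev.measurable.aemeasurable
        (φ j).continuous.aestronglyMeasurable).symm
    simp only [BoundedContinuousFunction.compContinuous_apply, ev, ContinuousMap.coe_mk, h2] at h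
    simpa only [smul_eq_mul, mul_comm] using h
  · have h := htest (∏ j, (φ j).compContinuous (ev j))
    have h2 : ∫ x, ∏ j, φ j (x j) ∂Measure.pi (fun _ : Fin k => (μ : Measure ℝ))
        = ∏ j, ∫ x, φ j x ∂(μ : Measure ℝ) :=
      integral_fintype_prod_eq_prod (μ := fun _ : Fin k => (μ : Measure ℝ)) fun j x => φ j x
    have h3 : ∀ x, (∏ j, (φ j).compContinuous (ev j)) x = ∏ j, φ j (x j) := fun x => by
      rw [BoundedContinuousFunction.coe_prod]
      simp [ev]
    simp only [h3, h2] at h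
    simpa only [smul_eq_mul, mul_comm] using h

end Chaos

/-! ### Tightness from convergence of integrals. -/

section Tail

theorem integrable_unitInterval_comp (μ : Measure ℝ) [IsProbabilityMeasure μ]
    (φ : C(ℝ, unitInterval)) : Integrable (fun x => (φ x : ℝ)) μ :=
  integrable_of_norm_le (C := 1) (by fun_prop : Continuous fun x => (φ x : ℝ)).stronglyMeasurable
    fun x => by rw [Real.norm_of_nonneg (φ x).2.1]; exact (φ x).2.2

theorem continuous_integral_unitInterval (μ : Measure ℝ) [IsProbabilityMeasure μ] :
    Continuous fun φ : C(ℝ, unitInterval) => ∫ x, (φ x : ℝ) ∂μ := by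
  refine continuous_of_dominated (bound := fun _ => 1)
    (fun φ => (integrable_unitInterval_comp μ φ).aestronglyMeasurable)
    (fun φ => ae_of_all _ fun x => ?_) (integrable_const _) (ae_of_all _ fun x => ?_)
  · rw [Real.norm_of_nonneg (φ x).2.1]; exact (φ x).2.2
  · exact continuous_subtype_val.comp (continuous_eval_const x)

/-- A continuous function with values in `[0, 1]` which vanishes on `[-K, K]` and equals `1`
outside `[-(K + 1), K + 1]`. -/
def tailRamp (K : ℝ) : C(ℝ, unitInterval) :=
  ⟨fun x => Set.projIcc 0 1 zero_le_one (|x| - K), continuous_projIcc.comp (by fun_prop)⟩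

theorem tailRamp_eq_zero {K x : ℝ} (h : |x| ≤ K) : tailRamp K x = 0 :=
  Set.projIcc_of_le_left zero_le_one (by linarith)

theorem tailRamp_eq_one {K x : ℝ} (h : K + 1 ≤ |x|) : tailRamp K x = 1 :=
  Set.projIcc_of_right_le zero_le_one (by linarith)

/-- The compact-open topology sees only bounded sets: changes far out are small perturbations,
however large in value. -/
theorem tendsto_of_eqOn_ball {F : ℕ → C(ℝ, unitInterval)} {φ : C(ℝ, unitInterval)}
    (h : ∀ (n : ℕ) (x : ℝ), |x| ≤ n → F n x = φ x) : Tendsto F atTop (𝓝 φ) := by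
  rw [ContinuousMap.tendsto_iff_forall_isCompact_tendstoUniformlyOn]
  intro S hS
  obtain ⟨C, hC⟩ := hS.isBounded.exists_norm_le
  intro u hu
  filter_upwards [eventually_ge_atTop ⌈C⌉₊] with n hn x hx
  rw [h n x ((hC x hx).trans ((Nat.le_ceil C).trans (by exact_mod_cast hn)))]
  exact refl_mem_uniformity hu

theorem tendsto_measureReal_tail (μ : Measure ℝ) [IsProbabilityMeasure μ] :
    Tendsto (fun n : ℕ => μ.real {x | (n : ℝ) ≤ |x|}) atTop (𝓝 0) := by
  have h := tendsto_measure_iInter_atTop (μ := μ) (s := fun n : ℕ => {x : ℝ | (n : ℝ) ≤ |x|})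
    (fun n => (measurableSet_le measurable_const measurable_norm).nullMeasurableSet)
    (fun m n hmn x (hx : (n : ℝ) ≤ |x|) =>
      show (m : ℝ) ≤ |x| from le_trans (by exact_mod_cast hmn) hx) ⟨0, measure_ne_top _ _⟩
  have he : ⋂ n : ℕ, {x : ℝ | (n : ℝ) ≤ |x|} = ∅ := by
    ext x
    obtain ⟨n, hn⟩ := exists_nat_gt |x|
    simp only [Set.mem_iInter, Set.mem_ofPred_eq, Set.mem_empty_iff_false, iff_false, not_forall,
      not_le]
    exact ⟨n, hn⟩
  rw [he, measure_empty] at h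
  exact (ENNReal.tendsto_toReal ENNReal.zero_ne_top).comp h

/-- If the integrals of every bounded continuous function form a Cauchy sequence, then no mass
escapes to infinity. -/
theorem exists_eventually_measureReal_tail_le (μ : ℕ → Measure ℝ)
    [hμ : ∀ n, IsProbabilityMeasure (μ n)]
    (h : ∀ φ : ℝ →ᵇ ℝ, CauchySeq fun n => ∫ x, φ x ∂μ n) {ε : ℝ} (hε : 0 < ε) :
    ∃ K : ℝ, ∀ᶠ n in atTop, (μ n).real {x | K ≤ |x|} ≤ ε := by
  -- The functions whose integrals have settled to within `ε / 3` from time `m` on. These sets are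
  -- closed and cover the space, so by Baire one of them has an interior point `φ`.
  let A : ℕ → Set C(ℝ, unitInterval) := fun m =>
    {φ | ∀ n ≥ m, |(∫ x, (φ x : ℝ) ∂μ n) - ∫ x, (φ x : ℝ) ∂μ m| ≤ ε / 3}
  have hA : ∀ m, IsClosed (A m) := fun m => by
    simp only [A, Set.ofPred_forall]
    exact isClosed_iInter fun n => isClosed_iInter fun _ => isClosed_le
      ((continuous_integral_unitInterval _).sub (continuous_integral_unitInterval _)).abs
      continuous_const
  have hU : ⋃ m, A m = Set.univ := Set.eq_univ_of_forall fun φ => by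
    have hc := h (BoundedContinuousFunction.ofNormedAddCommGroup (fun x => (φ x : ℝ))
      (by fun_prop) 1 fun x => by rw [Real.norm_of_nonneg (φ x).2.1]; exact (φ x).2.2)
    obtain ⟨m, hm⟩ := Metric.cauchySeq_iff'.1 hc (ε / 3) (by positivity)
    exact Set.mem_iUnion.2 ⟨m, fun n hn => (hm n hn).le⟩
  obtain ⟨m, φ, hφ⟩ := nonempty_interior_of_iUnion_of_closed hA hU
  have hnhds : A m ∈ 𝓝 φ := mem_interior_iff_mem_nhds.1 hφ
  -- Two perturbations of `φ`, raised to 1 and lowered to 0 far out, both enter `A m`. Their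
  -- difference dominates the indicator of a tail, so the mass there is within `2 ε / 3` of its
  -- value at time `m`, itself at most `ε / 3`.
  have h1 : Tendsto (fun n : ℕ => φ ⊔ tailRamp n) atTop (𝓝 φ) :=
    tendsto_of_eqOn_ball fun n x hx => by
      rw [ContinuousMap.sup_apply, tailRamp_eq_zero hx]; exact sup_of_le_left (φ x).2.1
  have h0 : Tendsto (fun n : ℕ => φ ⊓ (ContinuousMap.mk unitInterval.symm).comp (tailRamp n)) atTop
      (𝓝 φ) :=
    tendsto_of_eqOn_ball fun n x hx => by
      rw [ContinuousMap.inf_apply, ContinuousMap.comp_apply, tailRamp_eq_zero hx,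
        show (⟨unitInterval.symm, by fun_prop⟩ : C(unitInterval, unitInterval)) 0 = 1 from
          unitInterval.symm_zero]
      exact inf_of_le_left unitInterval.le_one'
  obtain ⟨k, hk1, hk0, hkt⟩ := ((h1.eventually hnhds).and ((h0.eventually hnhds).and
    ((tendsto_measureReal_tail (μ m)).eventually_le_const
      (show (0 : ℝ) < ε / 3 by positivity)))).exists
  set ψ := φ ⊔ tailRamp k
  set χ := φ ⊓ (ContinuousMap.mk unitInterval.symm).comp (tailRamp k)
  have hle : ∀ x, (χ x : ℝ) ≤ ψ x := fun x => le_trans (b := φ x) inf_le_left le_sup_left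
  have hin : ∀ x : ℝ, |x| ≤ k → χ x = ψ x := fun x hx => by
    simp only [ψ, χ, ContinuousMap.sup_apply, ContinuousMap.inf_apply, ContinuousMap.comp_apply,
      tailRamp_eq_zero hx, ContinuousMap.coe_mk, unitInterval.symm_zero]
    rw [sup_of_le_left unitInterval.nonneg', inf_of_le_left unitInterval.le_one']
  have hout : ∀ x : ℝ, (k : ℝ) + 1 ≤ |x| → χ x = 0 ∧ ψ x = 1 := fun x hx => by
    simp only [ψ, χ, ContinuousMap.sup_apply, ContinuousMap.inf_apply, ContinuousMap.comp_apply,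
      tailRamp_eq_one hx, ContinuousMap.coe_mk, unitInterval.symm_one]
    exact ⟨inf_of_le_right (φ x).2.1, sup_of_le_right (φ x).2.2⟩
  have hms : ∀ K : ℝ, MeasurableSet {x : ℝ | K ≤ |x|} := fun K =>
    measurableSet_le measurable_const measurable_norm
  have hI : ∀ n, Integrable (fun x => (ψ x : ℝ) - χ x) (μ n) := fun n =>
    (integrable_unitInterval_comp _ ψ).sub (integrable_unitInterval_comp _ χ)
  have hsub : ∀ n, ∫ x, ((ψ x : ℝ) - χ x) ∂μ n = (∫ x, (ψ x : ℝ) ∂μ n) - ∫ x, (χ x : ℝ) ∂μ n :=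
    fun n => integral_sub (integrable_unitInterval_comp _ ψ) (integrable_unitInterval_comp _ χ)
  refine ⟨k + 1, (eventually_ge_atTop m).mono fun n hn => ?_⟩
  have e1 : (μ n).real {x : ℝ | (k : ℝ) + 1 ≤ |x|} ≤ ∫ x, ((ψ x : ℝ) - χ x) ∂μ n := by
    rw [← integral_indicator_one (hms _)]
    refine integral_mono ((integrable_const 1).indicator (hms _)) (hI n) fun x => ?_
    dsimp only
    by_cases hx : x ∈ {x : ℝ | (k : ℝ) + 1 ≤ |x|}
    · rw [Set.indicator_of_mem hx, (hout x hx).1, (hout x hx).2]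
      simp
    · rw [Set.indicator_of_notMem hx]
      exact sub_nonneg.2 (hle x)
  have e2 : ∫ x, ((ψ x : ℝ) - χ x) ∂μ m ≤ (μ m).real {x : ℝ | (k : ℝ) ≤ |x|} := by
    rw [← integral_indicator_one (hms _)]
    refine integral_mono (hI m) ((integrable_const 1).indicator (hms _)) fun x => ?_
    dsimp only
    by_cases hx : x ∈ {x : ℝ | (k : ℝ) ≤ |x|}
    · rw [Set.indicator_of_mem hx]
      have := (ψ x).2.2
      have := (χ x).2.1
      simp only [Pi.one_apply]
      linarith
    · rw [Set.indicator_of_notMem hx, hin x (le_of_not_ge hx), sub_self]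
  have e3 := abs_le.1 (hk1 n hn)
  have e4 := abs_le.1 (hk0 n hn)
  rw [hsub] at e1 e2
  linarith [e3.1, e3.2, e4.1, e4.2]

end Tail

/-! ### Equicontinuity in the frequency. -/

/-- A locally uniform upper bound follows from pointwise bounds and equicontinuity. -/
theorem eventually_le_of_equicontinuous {ι : Type*} {l : Filter ι} {g : ι → ℝ → ℝ}
    (hg : ∀ ξ ε : ℝ, 0 < ε → ∀ᶠ i in l, g i ξ ≤ ε)
    (he : ∀ ε : ℝ, 0 < ε → ∃ δ > 0, ∀ᶠ i in l, ∀ ξ η : ℝ, |ξ - η| ≤ δ → g i ξ ≤ g i η + ε)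
    (ρ : ℝ) {ε : ℝ} (hε : 0 < ε) : ∀ᶠ i in l, ∀ ξ, |ξ| ≤ ρ → g i ξ ≤ ε := by
  obtain ⟨δ, hδ, hδe⟩ := he (ε / 2) (half_pos hε)
  obtain ⟨S, -, hS⟩ := (isCompact_Icc (a := -ρ) (b := ρ)).elim_nhds_subcover
    (fun η => Metric.ball η δ) fun η _ => Metric.ball_mem_nhds η hδ
  filter_upwards [hδe, (Filter.eventually_all_finset S).2 fun η _ => hg η (ε / 2) (half_pos hε)]
    with i hi hiS ξ hξ
  obtain ⟨η, hη, hd⟩ := Set.mem_iUnion₂.1 (hS (abs_le.1 hξ))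
  have h1 := hi ξ η (by rw [← Real.dist_eq]; exact (Metric.mem_ball.1 hd).le)
  linarith [hiS η hη]

theorem norm_character_sub_le (ξ η x : ℝ) :
    ‖character ξ x - character η x‖ ≤ |ξ - η| * |x| := by
  have h : character ξ x - character η x
      = character η x * (Complex.exp (Complex.I * ((ξ - η) * x : ℝ)) - 1) := by
    simp only [character]
    rw [mul_sub, mul_one, ← Complex.exp_add]
    congr 2
    push_cast
    ring
  rw [h, norm_mul, norm_character, one_mul, ← abs_mul]
  exact Real.norm_exp_I_mul_ofReal_sub_one_le

theorem norm_character_sub_le_indicator {K : ℝ} (hK : 0 ≤ K) (ξ η x : ℝ) :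
    ‖character ξ x - character η x‖
      ≤ |ξ - η| * K + 2 * {y : ℝ | K ≤ |y|}.indicator (fun _ => 1) x := by
  by_cases hx : x ∈ {y : ℝ | K ≤ |y|}
  · rw [Set.indicator_of_mem hx]
    have := (norm_sub_le (character ξ x) (character η x)).trans_eq
      (by rw [norm_character, norm_character])
    have : 0 ≤ |ξ - η| * K := by positivity
    linarith
  · rw [Set.indicator_of_notMem hx]
    have h2 : |x| ≤ K := le_of_not_ge hx
    have := norm_character_sub_le ξ η x
    nlinarith [abs_nonneg (ξ - η)]

namespace IsSymmDensity

variable {N : ℕ} {f : (Fin N → ℝ) → ℝ}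

/-- Symmetry reduces the average over particles to particle `i`. Where its velocity is below `K` the
character is `K`-Lipschitz in the frequency; elsewhere two characters differ by at most 2. -/
theorem integral_norm_empChar_sub_le (hf : IsSymmDensity f) (i : Fin N) {K δ : ℝ} (hK : 0 ≤ K)
    (hδ : (densityLaw f).real {v | K ≤ |v i|} ≤ δ) (ξ η : ℝ) :
    ∫ v, ‖empChar ξ v - empChar η v‖ ∂densityLaw f ≤ |ξ - η| * K + 2 * δ := by
  have := hf.isProbabilityMeasure
  set P := densityLaw f
  have hN : (N : ℝ) ≠ 0 := by exact_mod_cast i.pos.ne'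
  have hI : ∀ j, Integrable (fun v : Fin N → ℝ => ‖character ξ (v j) - character η (v j)‖) P :=
    fun j => integrable_of_norm_le (C := 2) ((continuous_character_apply ξ j).sub
      (continuous_character_apply η j)).norm.stronglyMeasurable fun v => by
        rw [norm_norm]
        refine (norm_sub_le _ _).trans_eq ?_
        rw [norm_character, norm_character]; norm_num
  have hms' : MeasurableSet {v : Fin N → ℝ | K ≤ |v i|} :=
    measurableSet_le measurable_const (continuous_apply i).abs.measurable
  have h1 : ∫ v, ‖empChar ξ v - empChar η v‖ ∂P
      ≤ ∫ v, (N : ℝ)⁻¹ * ∑ j, ‖character ξ (v j) - character η (v j)‖ ∂P := by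
    refine integral_mono ((integrable_empChar P ξ).sub (integrable_empChar P η)).norm
      ((integrable_finsetSum _ fun j _ => hI j).const_mul _) fun v => ?_
    dsimp only
    rw [empChar, empChar, ← mul_sub, ← Finset.sum_sub_distrib, norm_mul, norm_inv,
      Complex.norm_natCast]
    gcongr
    exact norm_sum_le _ _
  have h2 : ∫ v, (N : ℝ)⁻¹ * ∑ j, ‖character ξ (v j) - character η (v j)‖ ∂P
      = ∫ v, ‖character ξ (v i) - character η (v i)‖ ∂P := by
    rw [integral_const_mul, integral_finsetSum _ fun j _ => hI j, Finset.sum_congr rfl fun j _ =>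
      hf.integral_apply_eq (fun x => ‖character ξ x - character η x‖) j i]
    simp [hN, P]
  have h3 : ∫ v, ‖character ξ (v i) - character η (v i)‖ ∂P
      ≤ ∫ v, (|ξ - η| * K + 2 * {w : Fin N → ℝ | K ≤ |w i|}.indicator (fun _ => (1 : ℝ)) v) ∂P :=
    integral_mono (hI i) ((integrable_const _).add
      (((integrable_const 1).indicator hms').const_mul 2)) fun v =>
        norm_character_sub_le_indicator hK ξ η (v i)
  have h4 : ∫ v, {w : Fin N → ℝ | K ≤ |w i|}.indicator (fun _ => (1 : ℝ)) v ∂P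
      = P.real {v | K ≤ |v i|} := integral_indicator_one hms'
  rw [integral_add (integrable_const _) (((integrable_const 1).indicator hms').const_mul 2),
    integral_const_mul 2, h4] at h3
  simp only [integral_const, probReal_univ, one_smul] at h3
  linarith

end IsSymmDensity

section Equicontinuity

variable {N : ℕ} (P : Measure (Fin N → ℝ)) [IsProbabilityMeasure P]

theorem norm_meanChar_sub_le (ξ η : ℝ) :
    ‖meanChar P ξ - meanChar P η‖ ≤ ∫ v, ‖empChar ξ v - empChar η v‖ ∂P := by
  unfold meanChar
  rw [← integral_sub (integrable_empChar P ξ) (integrable_empChar P η)]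
  exact norm_integral_le_integral_norm _

theorem sq_norm_le_sq_norm_add {z w : ℂ} (hz : ‖z‖ ≤ 1) (hw : ‖w‖ ≤ 1) :
    ‖z‖ ^ 2 ≤ ‖w‖ ^ 2 + 2 * ‖z - w‖ := by
  have := norm_sub_norm_le z w
  nlinarith [norm_nonneg z, norm_nonneg w, norm_nonneg (z - w)]

/-- The squared modulus is 2-Lipschitz on the unit disc; it is used once for the second moment and
once for the mean. -/
theorem devChar_le_add (ξ η : ℝ) :
    devChar P ξ ≤ devChar P η + 4 * ∫ v, ‖empChar ξ v - empChar η v‖ ∂P := by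
  rw [devChar_eq, devChar_eq]
  have h1 := sq_norm_le_sq_norm_add (norm_meanChar_le P η) (norm_meanChar_le P ξ)
  have h2 := norm_meanChar_sub_le P ξ η
  rw [norm_sub_rev] at h2
  have hsq : ∀ ζ, Integrable (fun v : Fin N → ℝ => ‖empChar ζ v‖ ^ 2) P := fun ζ =>
    integrable_of_norm_le (C := 1) ((stronglyMeasurable_empChar ζ).norm.pow 2) fun v => by
      rw [norm_pow, norm_norm]
      exact pow_le_one₀ (norm_nonneg _) (norm_empChar_le ζ v)
  have hd : Integrable (fun v : Fin N → ℝ => 2 * ‖empChar ξ v - empChar η v‖) P :=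
    ((integrable_empChar P ξ).sub (integrable_empChar P η)).norm.const_mul 2
  have h3 : ∫ v, ‖empChar ξ v‖ ^ 2 ∂P
      ≤ ∫ v, (‖empChar η v‖ ^ 2 + 2 * ‖empChar ξ v - empChar η v‖) ∂P :=
    integral_mono (hsq ξ) ((hsq η).add hd) fun v =>
      sq_norm_le_sq_norm_add (norm_empChar_le ξ v) (norm_empChar_le η v)
  rw [integral_add (hsq η) hd, integral_const_mul] at h3
  linarith

end Equicontinuity

/-! ### Empirical averages and the initial law. -/

section EmpiricalAverages

/-- The empirical average of `φ`. -/
def empAvg {N : ℕ} (φ : ℝ → ℝ) (v : Fin N → ℝ) : ℝ := (N : ℝ)⁻¹ * ∑ j, φ (v j)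

variable {N : ℕ} {f : (Fin N → ℝ) → ℝ}

theorem continuous_empAvg (φ : ℝ →ᵇ ℝ) : Continuous fun v : Fin N → ℝ => empAvg φ v :=
  continuous_const.mul (continuous_finsetSum _ fun j _ =>
    φ.continuous.comp (continuous_apply j))

theorem abs_empAvg_le (φ : ℝ →ᵇ ℝ) (v : Fin N → ℝ) : |empAvg φ v| ≤ ‖φ‖ := by
  rw [empAvg, abs_mul, abs_inv, Nat.abs_cast]
  rcases Nat.eq_zero_or_pos N with rfl | hN
  · simp
  have hN' : (0 : ℝ) < N := by exact_mod_cast hN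
  rw [inv_mul_le_iff₀ hN']
  refine (Finset.abs_sum_le_sum_abs _ _).trans ?_
  refine (Finset.sum_le_sum fun j _ => φ.norm_coe_le_norm (v j)).trans ?_
  simp

theorem integrable_apply (P : Measure (Fin N → ℝ)) [IsProbabilityMeasure P] (φ : ℝ →ᵇ ℝ)
    (i : Fin N) : Integrable (fun v => φ (v i)) P :=
  integrable_of_norm_le (φ.continuous.comp (continuous_apply i)).stronglyMeasurable
    fun v => φ.norm_coe_le_norm (v i)

theorem integrable_apply_mul (P : Measure (Fin N → ℝ)) [IsProbabilityMeasure P] (φ : ℝ →ᵇ ℝ)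
    (i j : Fin N) : Integrable (fun v => φ (v i) * φ (v j)) P :=
  integrable_of_norm_le (C := ‖φ‖ * ‖φ‖) ((φ.continuous.comp (continuous_apply i)).mul
    (φ.continuous.comp (continuous_apply j))).stronglyMeasurable
    fun v => by
      rw [norm_mul]
      exact mul_le_mul (φ.norm_coe_le_norm _) (φ.norm_coe_le_norm _) (norm_nonneg _) (norm_nonneg _)

theorem abs_integral_apply_mul_le (P : Measure (Fin N → ℝ)) [IsProbabilityMeasure P] (φ : ℝ →ᵇ ℝ)
    (i j : Fin N) : |∫ v, φ (v i) * φ (v j) ∂P| ≤ ‖φ‖ ^ 2 := by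
  have := norm_integral_le_of_norm_le_const (μ := P) (f := fun v => φ (v i) * φ (v j))
    (C := ‖φ‖ ^ 2) (ae_of_all _ fun v => by
      rw [norm_mul, sq]
      exact mul_le_mul (φ.norm_coe_le_norm _) (φ.norm_coe_le_norm _) (norm_nonneg _)
        (norm_nonneg _))
  simpa using this

theorem IsSymmDensity.integral_empAvg (hf : IsSymmDensity f) (φ : ℝ →ᵇ ℝ) (i : Fin N) :
    ∫ v, empAvg φ v ∂densityLaw f = ∫ v, φ (v i) ∂densityLaw f := by
  have := hf.isProbabilityMeasure
  have hN : (N : ℝ) ≠ 0 := by exact_mod_cast i.pos.ne'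
  unfold empAvg
  rw [integral_const_mul, integral_finsetSum _ fun j _ => integrable_apply _ φ j,
    Finset.sum_congr rfl fun j _ => hf.integral_apply_eq φ j i]
  simp [hN]

theorem IsSymmDensity.integral_apply_mul_eq (hf : IsSymmDensity f) (φ : ℝ → ℝ) {i j k l : Fin N}
    (hij : i ≠ j) (hkl : k ≠ l) :
    ∫ v, φ (v i) * φ (v j) ∂densityLaw f = ∫ v, φ (v k) * φ (v l) ∂densityLaw f := by
  obtain ⟨σ, hk, hl⟩ : ∃ σ : Equiv.Perm (Fin N), σ k = i ∧ σ l = j := by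
    refine ⟨(Equiv.swap k i).trans (Equiv.swap (Equiv.swap k i l) j), ?_, ?_⟩
    · rw [Equiv.trans_apply, Equiv.swap_apply_left]
      refine Equiv.swap_apply_of_ne_of_ne (fun h => hkl ?_) hij
      exact (Equiv.swap k i).injective ((Equiv.swap_apply_left k i).trans h)
    · rw [Equiv.trans_apply, Equiv.swap_apply_left]
  have h := hf.integral_comp_perm σ fun v => φ (v k) * φ (v l)
  simpa only [hk, hl] using h

/-- The squared average is a mean over `N²` ordered pairs. All off-diagonal pairs have the same
expectation, and the `N` diagonal ones are off by at most `2 ‖φ‖²`. -/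
theorem IsSymmDensity.abs_integral_empAvg_sq_sub_le (hf : IsSymmDensity f) (φ : ℝ →ᵇ ℝ)
    {i j : Fin N} (hij : i ≠ j) :
    |(∫ v, empAvg φ v ^ 2 ∂densityLaw f) - ∫ v, φ (v i) * φ (v j) ∂densityLaw f|
      ≤ 2 * ‖φ‖ ^ 2 / N := by
  have := hf.isProbabilityMeasure
  set P := densityLaw f with hP
  have hN0 : (0 : ℝ) < N := by exact_mod_cast i.pos
  have e1 : ∫ v, empAvg φ v ^ 2 ∂P
      = ((N : ℝ)⁻¹) ^ 2 * ∑ a, ∑ b, ∫ v, φ (v a) * φ (v b) ∂P := by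
    have : ∀ v : Fin N → ℝ, empAvg φ v ^ 2
        = ((N : ℝ)⁻¹) ^ 2 * ∑ a, ∑ b, φ (v a) * φ (v b) := fun v => by
      rw [empAvg, mul_pow, sq (∑ j, φ (v j)), Finset.sum_mul_sum]
    simp only [this]
    rw [integral_const_mul, integral_finsetSum _ fun a _ =>
      integrable_finsetSum _ fun b _ => integrable_apply_mul P φ a b]
    congr 1
    exact Finset.sum_congr rfl fun a _ => integral_finsetSum _ fun b _ =>
      integrable_apply_mul P φ a b
  have e2 : ∫ v, φ (v i) * φ (v j) ∂P
      = ((N : ℝ)⁻¹) ^ 2 * ∑ _a : Fin N, ∑ _b : Fin N, ∫ v, φ (v i) * φ (v j) ∂P := by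
    simp only [Finset.sum_const, Finset.card_univ, Fintype.card_fin, nsmul_eq_mul]
    field_simp
  have hb : ∀ a, |∑ b, ((∫ v, φ (v a) * φ (v b) ∂P) - ∫ v, φ (v i) * φ (v j) ∂P)|
      ≤ 2 * ‖φ‖ ^ 2 := fun a => by
    rw [Finset.sum_eq_single a (fun b _ hba => sub_eq_zero.2
      (hf.integral_apply_mul_eq φ hba.symm hij)) (fun h => absurd (Finset.mem_univ a) h)]
    refine (abs_sub _ _).trans ?_
    linarith [abs_integral_apply_mul_le P φ a a, abs_integral_apply_mul_le P φ i j]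
  rw [e1, e2, ← mul_sub, ← Finset.sum_sub_distrib, abs_mul, abs_of_nonneg (by positivity)]
  simp only [← Finset.sum_sub_distrib]
  calc ((N : ℝ)⁻¹) ^ 2 * |∑ a, ∑ b, ((∫ v, φ (v a) * φ (v b) ∂P) - ∫ v, φ (v i) * φ (v j) ∂P)|
      ≤ ((N : ℝ)⁻¹) ^ 2 * ∑ _a : Fin N, 2 * ‖φ‖ ^ 2 := by
        gcongr
        exact (Finset.abs_sum_le_sum_abs _ _).trans (Finset.sum_le_sum fun a _ => hb a)
    _ = 2 * ‖φ‖ ^ 2 / N := by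
        simp only [Finset.sum_const, Finset.card_univ, Fintype.card_fin, nsmul_eq_mul]
        field_simp

end EmpiricalAverages

section InitialTime

variable {f : ∀ N : ℕ, (Fin N → ℝ) → ℝ}

/-- `x ↦ cos (ξ x)` as a bounded continuous function. -/
def cosFun (ξ : ℝ) : ℝ →ᵇ ℝ :=
  BoundedContinuousFunction.ofNormedAddCommGroup (fun x => Real.cos (ξ * x)) (by fun_prop) 1
    fun x => Real.abs_cos_le_one (ξ * x)

/-- `x ↦ sin (ξ x)` as a bounded continuous function. -/
def sinFun (ξ : ℝ) : ℝ →ᵇ ℝ :=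
  BoundedContinuousFunction.ofNormedAddCommGroup (fun x => Real.sin (ξ * x)) (by fun_prop) 1
    fun x => Real.abs_sin_le_one (ξ * x)

theorem empChar_eq_empAvg {N : ℕ} (ξ : ℝ) (v : Fin N → ℝ) :
    empChar ξ v = empAvg (cosFun ξ) v + empAvg (sinFun ξ) v * Complex.I := by
  have : ∀ x, character ξ x = (cosFun ξ x : ℂ) + sinFun ξ x * Complex.I := fun x => by
    rw [character, Complex.exp_mul_I]
    simp [cosFun, sinFun]
  simp only [empChar, empAvg, this, Finset.sum_add_distrib, ← Finset.sum_mul]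
  push_cast
  ring

theorem integrable_empAvg {N : ℕ} (P : Measure (Fin N → ℝ)) [IsProbabilityMeasure P] (φ : ℝ →ᵇ ℝ) :
    Integrable (fun v : Fin N → ℝ => empAvg φ v) P :=
  integrable_of_norm_le (continuous_empAvg φ).stronglyMeasurable (abs_empAvg_le φ)

theorem meanChar_eq_integral_empAvg {N : ℕ} (P : Measure (Fin N → ℝ)) [IsProbabilityMeasure P]
    (ξ : ℝ) : meanChar P ξ = ((∫ v, empAvg (cosFun ξ) v ∂P : ℝ) : ℂ)
      + ((∫ v, empAvg (sinFun ξ) v ∂P : ℝ) : ℂ) * Complex.I := by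
  unfold meanChar
  simp only [empChar_eq_empAvg]
  rw [integral_add (integrable_empAvg P _).ofReal ((integrable_empAvg P _).ofReal.mul_const _),
    integral_mul_const, integral_complex_ofReal, integral_complex_ofReal]

theorem devChar_eq_integral_empAvg {N : ℕ} (P : Measure (Fin N → ℝ)) [IsProbabilityMeasure P]
    (ξ : ℝ) : devChar P ξ
      = ((∫ v, empAvg (cosFun ξ) v ^ 2 ∂P) - (∫ v, empAvg (cosFun ξ) v ∂P) ^ 2)
        + ((∫ v, empAvg (sinFun ξ) v ^ 2 ∂P) - (∫ v, empAvg (sinFun ξ) v ∂P) ^ 2) := by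
  have hsq : ∀ a b : ℝ, ‖(a : ℂ) + b * Complex.I‖ ^ 2 = a ^ 2 + b ^ 2 := fun a b => by
    rw [← Complex.normSq_eq_norm_sq, Complex.normSq_add_mul_I]
  have hI : ∀ φ : ℝ →ᵇ ℝ, Integrable (fun v : Fin N → ℝ => empAvg φ v ^ 2) P := fun φ =>
    integrable_of_norm_le (C := ‖φ‖ ^ 2) ((continuous_empAvg φ).pow 2).stronglyMeasurable
      fun v => by
        rw [norm_pow]
        exact pow_le_pow_left₀ (norm_nonneg _) (abs_empAvg_le φ v) 2
  rw [devChar_eq, meanChar_eq_integral_empAvg, hsq]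
  simp only [empChar_eq_empAvg, hsq]
  rw [integral_add (hI _) (hI _)]
  ring

theorem IsChaotic.tendsto_integral_empAvg (h : IsChaotic f) (φ : ℝ →ᵇ ℝ) :
    ∃ L, Tendsto (fun N => ∫ v, empAvg φ v ∂densityLaw (f N)) atTop (𝓝 L) := by
  obtain ⟨L, hL, -⟩ := h.2 1 fun _ => φ
  refine ⟨L 0, (tendsto_add_atTop_iff_nat 1).1 ?_⟩
  refine (hL 0).congr fun n => ?_
  rw [add_comm n 1, (h.1 (1 + n)).integral_empAvg φ (Fin.castAdd n 0),
    (h.1 (1 + n)).integral_densityLaw]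
  simp only [smul_eq_mul, mul_comm]

/-- Chaos with `k = 2` and both test functions equal to `φ`: the second moment and the squared mean
have the same limit. -/
theorem IsChaotic.tendsto_variance_empAvg (h : IsChaotic f) (φ : ℝ →ᵇ ℝ) :
    Tendsto (fun N => (∫ v, empAvg φ v ^ 2 ∂densityLaw (f N))
      - (∫ v, empAvg φ v ∂densityLaw (f N)) ^ 2) atTop (𝓝 0) := by
  obtain ⟨L, hL, hLL⟩ := h.2 2 fun _ => φ
  obtain ⟨M, hM⟩ := h.tendsto_integral_empAvg φ
  have hM2 : Tendsto (fun n => ∫ v, empAvg φ v ∂densityLaw (f (2 + n))) atTop (𝓝 M) :=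
    hM.comp (tendsto_atTop_mono (fun n => Nat.le_add_left n 2) tendsto_id)
  have hLM : ∀ j, L j = M := fun j => by
    refine tendsto_nhds_unique (hL j) (hM2.congr fun n => ?_)
    rw [(h.1 (2 + n)).integral_empAvg φ (Fin.castAdd n j), (h.1 (2 + n)).integral_densityLaw]
    simp only [smul_eq_mul, mul_comm]
  have hprod : Tendsto (fun n => ∫ v, φ (v (Fin.castAdd n 0)) * φ (v (Fin.castAdd n 1))
      ∂densityLaw (f (2 + n))) atTop (𝓝 (M ^ 2)) := by
    simp only [Fin.prod_univ_two, hLM, ← sq] at hLL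
    refine hLL.congr fun n => ?_
    rw [(h.1 (2 + n)).integral_densityLaw]
    simp only [smul_eq_mul, mul_comm]
  have hdiff : Tendsto (fun n => (∫ v, empAvg φ v ^ 2 ∂densityLaw (f (2 + n)))
      - ∫ v, φ (v (Fin.castAdd n 0)) * φ (v (Fin.castAdd n 1)) ∂densityLaw (f (2 + n)))
      atTop (𝓝 0) := by
    have hz : Tendsto (fun n : ℕ => 2 * ‖φ‖ ^ 2 / ((2 + n : ℕ) : ℝ)) atTop (𝓝 0) :=
      (tendsto_const_div_atTop_nhds_zero_nat (2 * ‖φ‖ ^ 2)).comp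
        (tendsto_atTop_mono (fun n => Nat.le_add_left n 2) tendsto_id)
    refine squeeze_zero_norm (fun n => ?_) hz
    refine (h.1 (2 + n)).abs_integral_empAvg_sq_sub_le φ fun hne => ?_
    have := (Fin.castAdd_injective 2 n) hne
    exact absurd this (by decide)
  have h2 := (hdiff.add hprod).sub (hM2.pow 2)
  rw [zero_add, sub_self] at h2
  refine (tendsto_add_atTop_iff_nat 2).1 ?_
  refine h2.congr fun n => ?_
  rw [add_comm n 2]
  ring

theorem IsChaotic.eventually_devChar_le (h : IsChaotic f) (ξ : ℝ) {ε : ℝ} (hε : 0 < ε) :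
    ∀ᶠ N in atTop, devChar (densityLaw (f N)) ξ ≤ ε := by
  have h1 := (h.tendsto_variance_empAvg (cosFun ξ)).add (h.tendsto_variance_empAvg (sinFun ξ))
  rw [add_zero] at h1
  filter_upwards [h1.eventually_le_const hε] with N hN
  have := (h.1 N).isProbabilityMeasure
  rwa [devChar_eq_integral_empAvg]

theorem IsChaotic.cauchySeq_meanChar (h : IsChaotic f) (ξ : ℝ) :
    CauchySeq fun N => meanChar (densityLaw (f N)) ξ := by
  obtain ⟨a, ha⟩ := h.tendsto_integral_empAvg (cosFun ξ)
  obtain ⟨b, hb⟩ := h.tendsto_integral_empAvg (sinFun ξ)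
  have hlim := ((Complex.continuous_ofReal.tendsto a).comp ha).add
    (((Complex.continuous_ofReal.tendsto b).comp hb).mul_const Complex.I)
  refine (hlim.congr fun N => ?_).cauchySeq
  have := (h.1 N).isProbabilityMeasure
  exact (meanChar_eq_integral_empAvg _ ξ).symm

theorem IsChaotic.exists_tail_le (h : IsChaotic f) {ε : ℝ} (hε : 0 < ε) :
    ∃ K, 0 ≤ K ∧ ∀ᶠ N in atTop, ∀ i : Fin N, (densityLaw (f N)).real {v | K ≤ |v i|} ≤ ε := by
  have hp := fun N => (h.1 N).isProbabilityMeasure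
  have hm : ∀ n : ℕ, Measurable fun v : Fin (1 + n) → ℝ => v (Fin.castAdd n 0) := fun n =>
    measurable_pi_apply _
  have hμ : ∀ n : ℕ, IsProbabilityMeasure
      ((densityLaw (f (1 + n))).map fun v => v (Fin.castAdd n 0)) := fun n =>
    Measure.isProbabilityMeasure_map (hm n).aemeasurable
  obtain ⟨K, hK⟩ := exists_eventually_measureReal_tail_le
    (fun n => (densityLaw (f (1 + n))).map fun v => v (Fin.castAdd n 0)) (fun φ => by
      obtain ⟨L, hL, -⟩ := h.2 1 fun _ => φ
      refine ((hL 0).congr fun n => ?_).cauchySeq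
      refine Eq.trans ?_ (integral_map (hm n).aemeasurable φ.continuous.aestronglyMeasurable).symm
      rw [(h.1 (1 + n)).integral_densityLaw]
      simp only [smul_eq_mul, mul_comm]) hε
  refine ⟨max K 0, le_max_right _ _, ?_⟩
  have hms : ∀ K : ℝ, MeasurableSet {x : ℝ | K ≤ |x|} := fun K =>
    measurableSet_le measurable_const measurable_norm
  obtain ⟨n₀, hn₀⟩ := eventually_atTop.1 hK
  refine eventually_atTop.2 ⟨1 + n₀, fun N hN i => ?_⟩
  obtain ⟨n, rfl⟩ := Nat.exists_eq_add_of_le ((Nat.le_add_right 1 n₀).trans hN)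
  have h1 := hn₀ n (by omega)
  rw [map_measureReal_apply (hm n) (hms K)] at h1
  have h2 : ∀ j : Fin (1 + n), (densityLaw (f (1 + n))).real {v | K ≤ |v j|}
      = ∫ v, {x : ℝ | K ≤ |x|}.indicator (fun _ => (1 : ℝ)) (v j) ∂densityLaw (f (1 + n)) :=
    fun j => (integral_indicator_one (measurableSet_le measurable_const
      (continuous_apply j).abs.measurable)).symm
  calc _ ≤ (densityLaw (f (1 + n))).real {v | K ≤ |v i|} :=
        measureReal_mono fun v (hv : max K 0 ≤ |v i|) => (le_max_left K 0).trans hv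
    _ = (densityLaw (f (1 + n))).real {v | K ≤ |v (Fin.castAdd n 0)|} := by
        rw [h2, h2, (h.1 (1 + n)).integral_apply_eq _ i (Fin.castAdd n 0)]
    _ ≤ ε := h1

theorem IsChaotic.equicontinuous_empChar (h : IsChaotic f) {ε : ℝ} (hε : 0 < ε) :
    ∃ δ > 0, ∀ᶠ N in atTop, ∀ ξ η : ℝ, |ξ - η| ≤ δ →
      ∫ v, ‖empChar ξ v - empChar η v‖ ∂densityLaw (f N) ≤ ε := by
  obtain ⟨K, hK, hKN⟩ := h.exists_tail_le (show (0 : ℝ) < ε / 4 by positivity)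
  refine ⟨ε / (2 * (K + 1)), by positivity, ?_⟩
  filter_upwards [hKN, eventually_ge_atTop 1] with N hN hN1 ξ η hξη
  refine ((h.1 N).integral_norm_empChar_sub_le ⟨0, hN1⟩ hK (hN _) ξ η).trans ?_
  have h1 : |ξ - η| * K ≤ ε / (2 * (K + 1)) * (K + 1) :=
    mul_le_mul hξη (by linarith) hK (by positivity)
  have h2 : ε / (2 * (K + 1)) * (K + 1) = ε / 2 := by field_simp
  linarith

/-- Convergence at each frequency becomes uniform on bounded sets through the equicontinuity that
tightness provides. -/
theorem IsChaotic.isCharChaotic (h : IsChaotic f) : IsCharChaotic fun N => densityLaw (f N) where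
  dev ρ ε hε := by
    refine eventually_le_of_equicontinuous (fun ξ ε hε => h.eventually_devChar_le ξ hε)
      (fun ε hε => ?_) ρ hε
    obtain ⟨δ, hδ, hN⟩ := h.equicontinuous_empChar (show (0 : ℝ) < ε / 4 by positivity)
    refine ⟨δ, hδ, hN.mono fun N hN ξ η hξη => ?_⟩
    have := (h.1 N).isProbabilityMeasure
    linarith [devChar_le_add (densityLaw (f N)) ξ η, hN ξ η hξη]
  cauchy ρ ε hε := by
    -- The Cauchy property is a limit along pairs `(N, M)`, so the compactness lemma applies with
    -- pairs as the index.
    refine eventually_atTop_prod_self'.1 (eventually_le_of_equicontinuous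
      (g := fun (p : ℕ × ℕ) ξ =>
        ‖meanChar (densityLaw (f p.1)) ξ - meanChar (densityLaw (f p.2)) ξ‖)
      (fun ξ ε hε => ?_) (fun ε hε => ?_) ρ hε)
    · have h1 := cauchySeq_iff_tendsto_dist_atTop_0.1 (h.cauchySeq_meanChar ξ)
      simpa only [dist_eq_norm] using h1.eventually_le_const hε
    · obtain ⟨δ, hδ, hN⟩ := h.equicontinuous_empChar (half_pos hε)
      refine ⟨δ, hδ, ?_⟩
      obtain ⟨N₀, hN₀⟩ := eventually_atTop.1 hN
      refine eventually_atTop_prod_self'.2 ⟨N₀, fun N hN M hM ξ η hξη => ?_⟩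
      have := (h.1 N).isProbabilityMeasure
      have := (h.1 M).isProbabilityMeasure
      have h1 := (norm_meanChar_sub_le (densityLaw (f N)) ξ η).trans (hN₀ N hN ξ η hξη)
      have h2 := (norm_meanChar_sub_le (densityLaw (f M)) ξ η).trans (hN₀ M hM ξ η hξη)
      set a := meanChar (densityLaw (f N)) ξ
      set b := meanChar (densityLaw (f M)) ξ
      set c := meanChar (densityLaw (f N)) η
      set d := meanChar (densityLaw (f M)) η
      have e : a - b = (c - d) + ((a - c) - (b - d)) := by ring
      calc ‖a - b‖ = ‖(c - d) + ((a - c) - (b - d))‖ := by rw [← e]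
        _ ≤ ‖c - d‖ + (‖a - c‖ + ‖b - d‖) :=
          (norm_add_le _ _).trans (by gcongr; exact norm_sub_le _ _)
        _ ≤ ‖c - d‖ + ε := by linarith

end InitialTime

end

end KacThermostat

theorem theorem5 (lam mu β : ℝ) (hlam : 0 ≤ lam) (hmu : 0 ≤ mu) (hβ : 0 < β)
    (f : ∀ N : ℕ, ℝ → (Fin N → ℝ) → ℝ)
    (hf : ∀ N : ℕ, KacThermostat.SolvesMaster lam mu β (f N))
    (h0 : KacThermostat.IsChaotic (fun N => f N 0))
    (t : ℝ) (ht : 0 ≤ t) :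
    KacThermostat.IsChaotic (fun N => f N t) := by
  have hflow := fun N => (hf N).isJumpFlow hlam hmu hβ (h0.1 N)
  exact (KacThermostat.IsCharChaotic.propagates hflow hlam hmu h0.isCharChaotic ht).isChaotic
    fun N => (hf N).isSymmDensity hlam hmu hβ (h0.1 N) ht
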